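/- Let $\rho$ be a two-mode state, i.e. a positive operator of trace one on the two-mode Fock space with number basis $|n_1,n_2\rangle$. For a bounded operator $\omega$ on the Hilbert space of two copies of the two-mode system put $\mathcal E(\omega)=\langle 0,0|(U\otimes U)\,\omega\,(U\otimes U)^\dagger|0,0\rangle$. Here each factor $U=T^{a_1^\dagger a_1}e^{-R a_2^\dagger a_1}e^{R a_2a_1^\dagger}T^{-a_2^\dagger a_2}$, with $T=R=1/\sqrt2$, is a 50:50 beam splitter that mixes a mode of the first copy (operator $a_1$) with the corresponding mode of the second copy (operator $a_2$), and $|0,0\rangle$ is the vacuum of the two detected output modes, one of each beam splitter, namely those with label 1; the two other modes are kept. Suppose that $\rho=c\,\mathcal E(\rho\otimes\rho)$ for some real $c>0$. Then $\rho$ is a Gaussian state with vanishing first moments. That is, let $Q=(X_1,P_1,X_2,P_2)$ be the vector of canonical coordinates, with $[Q_j,Q_k]=i\Sigma_{j,k}$ and $\Sigma=\bigoplus_{j=1}^{2}\begin{pmatrix}0&1\\-1&0\end{pmatrix}$, and let $W_\xi=e^{i\xi^T\Sigma Q}$ for $\xi\in\mathbb R^4$. Then there are $d\in\mathbb R^4$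 and a real symmetric $4\times4$ matrix $\gamma$ such that $\operatorname{tr}[W_\xi\rho]=\exp\!\left(i\,\xi^T\Sigma d-\tfrac14\,\xi^T\Sigma^T\gamma\Sigma\xi\right)$ for all $\xi\in\mathbb R^4$, and $\operatorname{tr}[Q_j\rho]=0$ for $j=1,\dots,4$. -/

import Mathlib

noncomputable section

open scoped TensorProduct Kronecker Nat Matrix
open Complex

namespace Gaussify

/-! ### Fock spaces and their number states

`M` is the finite set of modes; `n : M → ℕ` lists the photon numbers of the modes. -/

/-- The Hilbert space of a system of modes `M`, with orthonormal basis the number states. -/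
abbrev Fock (M : Type) : Type := lp (fun _ : M → ℕ => ℂ) 2

/-- Finite linear combinations of number states; all the operators below that are polynomials in
creation and annihilation operators are defined on this domain. -/
abbrev FinVec (M : Type) : Type := (M → ℕ) →₀ ℂ

section Modes

variable {M : Type} [Fintype M] [DecidableEq M]

set_option linter.unusedSectionVars false
set_option linter.unusedSimpArgs false

/-- The number state `|n⟩` as a vector of the Hilbert space. -/
def numberState (n : M → ℕ) : Fock M := lp.single 2 n 1

/-- The inclusion of the finite linear combinations of number states in the Hilbert space. -/
def toFock : FinVec M →ₗ[ℂ] Fock M := Finsupp.linearCombination ℂ numberState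

/-- The number state `|n⟩` as a finite vector. -/
def ket (n : M → ℕ) : FinVec M := Finsupp.single n 1

/-- The annihilation operator `a_j`: `a_j |n⟩ = √(n_j) |n - δ_j⟩` (zero if `n_j = 0`). -/
def annihilate (j : M) : Module.End ℂ (FinVec M) :=
  Finsupp.linearCombination ℂ fun n => ((√(n j : ℝ) : ℝ) : ℂ) • ket (n - Pi.single j 1)

/-- The creation operator `a_j†`: `a_j† |n⟩ = √(n_j + 1) |n + δ_j⟩`. -/
def create (j : M) : Module.End ℂ (FinVec M) :=
  Finsupp.linearCombination ℂ fun n => ((√(n j + 1 : ℝ) : ℝ) : ℂ) • ket (n + Pi.single j 1)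

/-- The operator `t ^ (a_j† a_j)`: `|n⟩ ↦ t ^ n_j |n⟩`. -/
def powNumber (t : ℝ) (j : M) : Module.End ℂ (FinVec M) :=
  Finsupp.linearCombination ℂ fun n => ((t : ℂ) ^ n j) • ket n

/-- The exponential series `∑ₖ Lᵏ v / k!` of an operator `L` some power of which kills `v`. -/
def expNilpotent (L : Module.End ℂ (FinVec M)) (v : FinVec M) : FinVec M :=
  ∑ᶠ k : ℕ, ((k ! : ℂ))⁻¹ • (L ^ k) v

/-- The beam splitter
`U = T ^ (a₁† a₁) · exp (-R a₂† a₁) · exp (R a₂ a₁†) · T ^ (-a₂† a₂)`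
with real transmittivity `T` and reflectivity `R`, on the modes `i` (for `a₁`) and `j` (for `a₂`). -/
def beamSplitter (T R : ℝ) (i j : M) (v : FinVec M) : FinVec M :=
  powNumber T i (expNilpotent ((-R : ℂ) • (create j * annihilate i))
    (expNilpotent ((R : ℂ) • (annihilate j * create i)) (powNumber T⁻¹ j v)))

/-- The adjoint
`U† = T ^ (-a₂† a₂) · exp (R a₁ a₂†) · exp (-R a₁† a₂) · T ^ (a₁† a₁)` of the beam splitter. -/
def beamSplitterAdj (T R : ℝ) (i j : M) (v : FinVec M) : FinVec M :=
  powNumber T⁻¹ j (expNilpotent ((R : ℂ) • (annihilate i * create j))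
    (expNilpotent ((-R : ℂ) • (create i * annihilate j)) (powNumber T i v)))

/-! The next facts show that `beamSplitterAdj` is the adjoint of `beamSplitter`, and that the
exponential series in both are finite sums. -/

theorem inner_numberState (m n : M → ℕ) :
    inner ℂ (numberState m) (numberState n) = if m = n then (1 : ℂ) else 0 := by
  rw [numberState, lp.inner_single_left, numberState, lp.single_apply]
  by_cases h : m = n <;> simp [h]

theorem toFock_ket (n : M → ℕ) : toFock (ket n) = numberState n := by
  simp [toFock, ket]

theorem annihilate_ket (j : M) (n : M → ℕ) :
    annihilate j (ket n) = ((√(n j : ℝ) : ℝ) : ℂ) • ket (n - Pi.single j 1) := by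
  simp only [annihilate, ket, Finsupp.linearCombination_single, one_smul]

theorem create_ket (j : M) (n : M → ℕ) :
    create j (ket n) = ((√(n j + 1 : ℝ) : ℝ) : ℂ) • ket (n + Pi.single j 1) := by
  simp only [create, ket, Finsupp.linearCombination_single, one_smul]

theorem powNumber_ket (t : ℝ) (j : M) (n : M → ℕ) :
    powNumber t j (ket n) = ((t : ℂ) ^ n j) • ket n := by
  simp only [powNumber, ket, Finsupp.linearCombination_single, one_smul]

theorem adj_ext {L L' : Module.End ℂ (FinVec M)}
    (h : ∀ m n : M → ℕ, inner ℂ (toFock (L' (ket m))) (toFock (ket n)) =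
      inner ℂ (toFock (ket m)) (toFock (L (ket n)))) (v w : FinVec M) :
    inner ℂ (toFock (L' v)) (toFock w) = inner ℂ (toFock v) (toFock (L w)) := by
  induction v using Finsupp.induction_linear with
  | zero => simp
  | add f g hf hg => simp [inner_add_left, hf, hg]
  | single m a =>
    have e1 : (Finsupp.single m a : FinVec M) = a • ket m := by simp [ket]
    induction w using Finsupp.induction_linear with
    | zero => simp
    | add f g hf hg => simp [inner_add_right, hf, hg]
    | single n b =>
      have e2 : (Finsupp.single n b : FinVec M) = b • ket n := by simp [ket]
      rw [e1, e2]
      simp only [map_smul, inner_smul_left, inner_smul_right, h]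

theorem create_adj (j : M) (v w : FinVec M) :
    inner ℂ (toFock (create j v)) (toFock w) = inner ℂ (toFock v) (toFock (annihilate j w)) := by
  apply adj_ext
  intro m n
  simp only [create_ket, annihilate_ket, map_smul, toFock_ket, inner_smul_left, inner_smul_right,
    inner_numberState, Complex.conj_ofReal]
  by_cases h : m + Pi.single j 1 = n
  · subst h
    simp
  · rw [if_neg h]
    by_cases h0 : n j = 0
    · simp [h0]
    · rw [if_neg, mul_zero, mul_zero]
      rintro rfl
      apply h
      ext k
      by_cases hk : k = j
      · subst hk; simp; omega
      · simp [hk]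

theorem annihilate_adj (j : M) (v w : FinVec M) :
    inner ℂ (toFock (annihilate j v)) (toFock w) = inner ℂ (toFock v) (toFock (create j w)) := by
  rw [← inner_conj_symm, ← create_adj, inner_conj_symm]

theorem powNumber_adj (t : ℝ) (j : M) (v w : FinVec M) :
    inner ℂ (toFock (powNumber t j v)) (toFock w) =
      inner ℂ (toFock v) (toFock (powNumber t j w)) := by
  apply adj_ext
  intro m n
  simp only [powNumber_ket, map_smul, toFock_ket, inner_smul_left, inner_smul_right,
    inner_numberState, map_pow, Complex.conj_ofReal]
  by_cases h : m = n <;> simp [h]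

theorem hop_nilp {i : M} {L : Module.End ℂ (FinVec M)}
    (h : ∀ n, ∃ (c : ℂ) (n' : M → ℕ), L (ket n) = c • ket n' ∧ (c ≠ 0 → n' i < n i))
    (v : FinVec M) : (Function.support fun k : ℕ => ((k ! : ℂ))⁻¹ • (L ^ k) v).Finite := by
  have key : ∀ N : ℕ, ∀ v : FinVec M, v ∈ Finsupp.supported ℂ ℂ {n : M → ℕ | n i < N} →
      (L ^ N) v = 0 := by
    intro N
    induction N with
    | zero =>
      intro v hv
      simpa [Finsupp.supported_empty] using hv
    | succ N ih =>
      intro v hv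
      rw [pow_succ, Module.End.mul_apply]
      apply ih
      rw [Finsupp.supported_eq_span_single] at hv
      induction hv using Submodule.span_induction with
      | mem x hx =>
        obtain ⟨n, hn, rfl⟩ := hx
        obtain ⟨c, n', e, hc⟩ := h n
        change L (ket n) ∈ _
        rw [e]
        by_cases h0 : c = 0
        · simp [h0]
        · apply Submodule.smul_mem
          apply Finsupp.single_mem_supported
          have := hc h0
          simp at hn ⊢
          omega
      | zero => simp
      | add x y _ _ hx hy => rw [map_add]; exact Submodule.add_mem _ hx hy
      | smul a x _ hx => rw [map_smul]; exact Submodule.smul_mem _ _ hx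
  have hv : v ∈ Finsupp.supported ℂ ℂ {n : M → ℕ | n i < v.support.sup (fun n => n i) + 1} := by
    rw [Finsupp.mem_supported]
    intro n hn
    have := Finset.le_sup (f := fun n : M → ℕ => n i) hn
    simp at this ⊢
    omega
  refine (Set.finite_lt_nat (v.support.sup (fun n => n i) + 1)).subset ?_
  intro k hk
  by_contra hlt
  simp only [Set.mem_ofPred_eq, not_lt] at hlt
  apply hk
  have : (L ^ k) v = 0 := by
    rw [← Nat.sub_add_cancel hlt, pow_add, Module.End.mul_apply, key _ v hv, map_zero]
  simp [this]

theorem nilp_ca {i j : M} (hij : i ≠ j) (r : ℂ) (v : FinVec M) :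
    (Function.support fun k : ℕ =>
      ((k ! : ℂ))⁻¹ • ((r • (create j * annihilate i)) ^ k) v).Finite := by
  apply hop_nilp (i := i)
  intro n
  simp only [LinearMap.smul_apply, Module.End.mul_apply, annihilate_ket, map_smul, create_ket, smul_smul]
  refine ⟨_, _, rfl, ?_⟩
  intro hc
  have : n i ≠ 0 := by rintro h; simp [h] at hc
  simp [hij]
  omega

theorem nilp_ac {i j : M} (hij : i ≠ j) (r : ℂ) (v : FinVec M) :
    (Function.support fun k : ℕ =>
      ((k ! : ℂ))⁻¹ • ((r • (annihilate j * create i)) ^ k) v).Finite := by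
  apply hop_nilp (i := j)
  intro n
  simp only [LinearMap.smul_apply, Module.End.mul_apply, annihilate_ket, map_smul, create_ket, smul_smul]
  refine ⟨_, _, rfl, ?_⟩
  intro hc
  have : n j ≠ 0 := by rintro h; simp [h, hij.symm] at hc
  simp [hij.symm]
  omega

theorem exp_adj {L L' : Module.End ℂ (FinVec M)}
    (h : ∀ v w, inner ℂ (toFock (L' v)) (toFock w) = inner ℂ (toFock v) (toFock (L w)))
    (hL : ∀ v, (Function.support fun k : ℕ => ((k ! : ℂ))⁻¹ • (L ^ k) v).Finite)
    (hL' : ∀ v, (Function.support fun k : ℕ => ((k ! : ℂ))⁻¹ • (L' ^ k) v).Finite)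
    (v w : FinVec M) :
    inner ℂ (toFock (expNilpotent L' v)) (toFock w) =
      inner ℂ (toFock v) (toFock (expNilpotent L w)) := by
  have hp : ∀ k v w, inner ℂ (toFock ((L' ^ k) v)) (toFock w) =
      inner ℂ (toFock v) (toFock ((L ^ k) w)) := by
    intro k
    induction k with
    | zero => simp
    | succ k ih => intro v w; rw [pow_succ, Module.End.mul_apply, ih, h, pow_succ', Module.End.mul_apply]
  have h1 := finsum_eq_sum_of_support_subset (fun k : ℕ => ((k ! : ℂ))⁻¹ • (L' ^ k) v)
    (s := (hL' v).toFinset ∪ (hL w).toFinset) (by simp)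
  have h2 := finsum_eq_sum_of_support_subset (fun k : ℕ => ((k ! : ℂ))⁻¹ • (L ^ k) w)
    (s := (hL' v).toFinset ∪ (hL w).toFinset) (by simp)
  rw [expNilpotent, expNilpotent, h1, h2]
  simp only [map_sum, map_smul, sum_inner, inner_sum, inner_smul_left, inner_smul_right, hp, map_inv₀,
    Complex.conj_natCast]

/-- `beamSplitterAdj` is the adjoint of `beamSplitter`. -/
theorem beamSplitter_adjoint (T R : ℝ) {i j : M} (hij : i ≠ j) (v w : FinVec M) :
    inner ℂ (toFock (beamSplitterAdj T R i j v)) (toFock w) =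
      inner ℂ (toFock v) (toFock (beamSplitter T R i j w)) := by
  rw [beamSplitterAdj, beamSplitter, powNumber_adj, ← powNumber_adj T]
  rw [exp_adj (L := (R : ℂ) • (annihilate j * create i)) ?_ (nilp_ac hij _) (nilp_ac hij.symm _),
    exp_adj (L := (-R : ℂ) • (create j * annihilate i)) ?_ (nilp_ca hij _) (nilp_ca hij.symm _)]
  · intro v w
    simp only [LinearMap.smul_apply, Module.End.mul_apply, map_smul, inner_smul_left,
      inner_smul_right, create_adj, annihilate_adj, map_neg, Complex.conj_ofReal]
  · intro v w
    simp only [LinearMap.smul_apply, Module.End.mul_apply, map_smul, inner_smul_left,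
      inner_smul_right, create_adj, annihilate_adj, Complex.conj_ofReal]

/-- The canonical coordinates: `X_j = (a_j + a_j†) / √2` is `quadrature (j, 0)` and
`P_j = -i (a_j - a_j†) / √2` is `quadrature (j, 1)`. -/
def quadrature (r : M × Fin 2) : Module.End ℂ (FinVec M) :=
  if r.2 = 0 then ((√2 : ℝ) : ℂ)⁻¹ • (annihilate r.1 + create r.1)
  else (-I * ((√2 : ℝ) : ℂ)⁻¹) • (annihilate r.1 - create r.1)

variable (M) in
/-- The symplectic matrix, the direct sum over the modes of the blocks `(0, 1; -1, 0)`. -/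
def symplectic : Matrix (M × Fin 2) (M × Fin 2) ℝ := (1 : Matrix M M ℝ) ⊗ₖ !![0, 1; -1, 0]

/-- The operator `ξᵀ Σ R`. -/
def weylGenerator (ξ : M × Fin 2 → ℝ) : Module.End ℂ (FinVec M) :=
  ∑ r, (((ξ ᵥ* symplectic M) r : ℝ) : ℂ) • quadrature r

/-- The vector `W_ξ |n⟩`, where `W_ξ = exp (i ξᵀ Σ R)` is the Weyl displacement operator. Number
states are analytic vectors of `ξᵀ Σ R`, and the exponential series converges in norm on them. -/
def weylOnNumber (ξ : M × Fin 2 → ℝ) (n : M → ℕ) : Fock M :=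
  ∑' k : ℕ, ((k ! : ℂ))⁻¹ • toFock (((I • weylGenerator ξ) ^ k) (ket n))

/-- `ρ` is a state (density operator): positive, with trace one. -/
def IsState (ρ : Fock M →L[ℂ] Fock M) : Prop :=
  ρ.IsPositive ∧ HasSum (fun n => inner ℂ (numberState n) (ρ (numberState n))) 1

/-- The characteristic function of `ρ` at `ξ` is `z`, that is, `tr[W_ξ ρ] = tr[ρ W_ξ] = z`, the
trace being computed in the number basis. -/
def HasCharFun (ρ : Fock M →L[ℂ] Fock M) (ξ : M × Fin 2 → ℝ) (z : ℂ) : Prop :=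
  HasSum (fun n => inner ℂ (numberState n) (ρ (weylOnNumber ξ n))) z

/-- `ρ` is Gaussian: for some real vector `d` and some real symmetric matrix `γ`, its
characteristic function is `exp (i ξᵀ Σ d - ξᵀ Σᵀ γ Σ ξ / 4)`. -/
def IsGaussian (ρ : Fock M →L[ℂ] Fock M) : Prop :=
  ∃ (d : M × Fin 2 → ℝ) (γ : Matrix (M × Fin 2) (M × Fin 2) ℝ), γ.IsSymm ∧
    ∀ ξ : M × Fin 2 → ℝ, HasCharFun ρ ξ
      (cexp (I * ((ξ ⬝ᵥ (symplectic M *ᵥ d) : ℝ) : ℂ)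
        - ((ξ ⬝ᵥ (((symplectic M)ᵀ * γ * symplectic M) *ᵥ ξ) : ℝ) : ℂ) / 4))

/-- The first moment `tr[R_r ρ]`, computed in the number basis, exists and equals `z`; the
operators `R_r` are symmetric, so that `⟨n| R_r ρ |n⟩ = ⟨R_r n, ρ n⟩`. -/
def HasFirstMoment (ρ : Fock M →L[ℂ] Fock M) (r : M × Fin 2) (z : ℂ) : Prop :=
  HasSum (fun n => inner ℂ (toFock (quadrature r (ket n))) (ρ (numberState n))) z

/-- The matrix of an operator in the number basis. -/
def numberMatrix (ρ : Fock M →L[ℂ] Fock M) : Matrix (M → ℕ) (M → ℕ) ℂ :=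
  Matrix.of fun p q => inner ℂ (numberState p) (ρ (numberState q))

end Modes

/-! ### Two copies of a two-mode system -/

/-- The Hilbert space of two modes. -/
abbrev TwoMode : Type := Fock (Fin 2)

/-- The Hilbert space of two copies of a two-mode system: the Hilbert space tensor product. -/
abbrev FourMode : Type := UniformSpace.Completion (TwoMode ⊗[ℂ] TwoMode)

/-- The inclusion of the finite four-mode vectors. The modes of the first and of the second copy are
`Sum.inl i` and `Sum.inr i`, and the number state `|m, n⟩` is `|m⟩ ⊗ |n⟩`. -/
def toFourMode : FinVec (Fin 2 ⊕ Fin 2) →ₗ[ℂ] FourMode :=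
  Finsupp.linearCombination ℂ fun n =>
    ((numberState (n ∘ Sum.inl) ⊗ₜ[ℂ] numberState (n ∘ Sum.inr) : TwoMode ⊗[ℂ] TwoMode) : FourMode)

/-- The operator `ρ ⊗ σ` on four modes. -/
def tensorOp (ρ σ : TwoMode →L[ℂ] TwoMode) : FourMode →L[ℂ] FourMode :=
  (TensorProduct.mapL ρ σ).completion

/-- `(U ⊗ U)†`, where each of the two 50:50 beam splitters (`T = R = 1/√2`) mixes the two copies of
one of the two modes. -/
def beamSplittersAdj (v : FinVec (Fin 2 ⊕ Fin 2)) : FinVec (Fin 2 ⊕ Fin 2) :=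
  beamSplitterAdj (1 / √2) (1 / √2) (Sum.inl 0) (Sum.inr 0)
    (beamSplitterAdj (1 / √2) (1 / √2) (Sum.inl 1) (Sum.inr 1) v)

/-- The vector `(U ⊗ U)† |0, 0⟩ |q⟩`, with the vacuum in the two detected output modes and `|q⟩` in
the two output modes that are kept. -/
def detectedKet (q : Fin 2 → ℕ) : FourMode :=
  toFourMode (beamSplittersAdj (ket (Sum.elim 0 q)))

/-- The iteration map `ℰ(ω) = ⟨0, 0| (U ⊗ U) ω (U ⊗ U)† |0, 0⟩`, a two-mode operator given by
its matrix in the number basis. -/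
def iterationMap (ω : FourMode →L[ℂ] FourMode) : Matrix (Fin 2 → ℕ) (Fin 2 → ℕ) ℂ :=
  Matrix.of fun p q => inner ℂ (detectedKet p) (ω (detectedKet q))

end Gaussify

end

/-!
Why a fixed point of the iteration is Gaussian.

Represent an operator with matrix `A` in the number basis by its Bargmann kernel, the power series
`F(w̄, z) = ∑ A p q w̄^p z^q / √(p! q!)`. Under the correspondence of `xⁿ` with `√(n!) |n⟩`
(`bargmann`) a beam splitter is a rotation of variables, so that the vector `(U ⊗ U)† |0, 0⟩ |q⟩` is
the polynomial `∏ⱼ ((x_j' - x_j) / √2)^(q_j)` up to normalization, and `ρ = c ℰ(ρ ⊗ ρ)` becomes the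
functional equation `F(u) = c F(-u / √2) F(u / √2)` (`kernelCoeff_recursion`). Compare homogeneous
parts: the constant term is `1 / c`, the quadratic part `κ / c` is arbitrary, and in every other
degree `k` the equation has a factor `1 - 2^(-k/2) (1 + (-1)^k) ≠ 0` in front of the unknown. Hence
`F = exp κ / c` with a quadratic form `κ` (`IsSelfSimilar.homPart_eq_expPart`). In particular `F` is
even, and its first derivatives are linear forms times `F`; on operators this reads
`a_j A = ∑ₖ (α_jk a_k† A + β_jk A a_k)` together with the adjoint relation.

That `ρ` is a state enters through the expectation values `exp(-|z|²) F(z̄, z)` in coherent states.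
For a positive operator of trace one they are at most the square of the overlap of the sequence
`√(A p p)` with the Poisson amplitudes, and this overlap tends to zero as `z` goes to infinity on a
ray (`exists_poisson_overlap_lt`). So `Re κ(z̄, z) < |z|²` for `z ≠ 0`, uniformly on the sphere.
Averaging `F(z̄, z)` over the phases of `z` bounds the generating function of `A p p`
(`sq_mul_expWeight_le`), and `A` decays exponentially in the photon numbers (`exists_decay`). These
facts about `A` are collected in `IsGaussianMatrix`.

Let `G` be a field operator, a real linear combination of the canonical coordinates. The decay makes
all traces below converge. Taking the trace of the relations above against `Gᵏ` gives linear
equations for `tr[A Gᵏ a_j]` and `tr[A Gᵏ a_j†]`, with inhomogeneity `k tr[A Gᵏ⁻¹]` times a vector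
independent of `k`; the definiteness of `|z|² - Re κ(z̄, z)` makes the solution unique. Therefore
`tr[A Gᵏ⁺¹] = k tr[A Gᵏ⁻¹] tr[A G²]` (`IsGaussianMatrix.trace_field_pow_succ`), the moments are those
of a centred Gaussian, and since the exponential series may be exchanged with the trace
(`IsGaussianMatrix.summable_exp_field`), `tr[A exp(iG)] = exp(-tr[A G²] / 2)`. The first moments
vanish because `F` is even.
-/

noncomputable section

open scoped TensorProduct Kronecker Nat Matrix
open Complex

namespace Gaussify

/-! ### Polynomials and number states -/

section Bargmann

variable {M : Type} [Fintype M]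

set_option linter.unusedSectionVars false

/-- The multi-index factorial `∏ⱼ nⱼ!`. -/
def multiFact (n : M → ℕ) : ℕ := ∏ j, (n j)!

theorem multiFact_pos (n : M → ℕ) : 0 < multiFact n :=
  Finset.prod_pos fun _ _ => Nat.factorial_pos _

theorem sqrt_multiFact_ne_zero (n : M → ℕ) : ((√(multiFact n : ℝ) : ℝ) : ℂ) ≠ 0 := by
  have := multiFact_pos n
  simp only [ne_eq, ofReal_eq_zero]
  positivity

theorem multiFact_add_single [DecidableEq M] (n : M → ℕ) (j : M) :
    multiFact (n + Pi.single j 1) = (n j + 1) * multiFact n := by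
  rw [multiFact, multiFact, ← Finset.mul_prod_erase _ _ (Finset.mem_univ j),
    ← Finset.mul_prod_erase Finset.univ (fun k => (n k)!) (Finset.mem_univ j), ← mul_assoc]
  congr 1
  · simp [Nat.factorial_succ]
  · refine Finset.prod_congr rfl fun k hk => ?_
    simp [Pi.single_eq_of_ne (Finset.ne_of_mem_erase hk)]

theorem sqrt_multiFact_add_single [DecidableEq M] (n : M → ℕ) (j : M) :
    √(multiFact (n + Pi.single j 1) : ℝ) = √(n j + 1 : ℝ) * √(multiFact n : ℝ) := by
  rw [multiFact_add_single, Nat.cast_mul, Real.sqrt_mul (by positivity)]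
  push_cast
  rfl

/-- The Bargmann correspondence between polynomials and finite combinations of number states:
the monomial `x ^ n` is sent to `√(n!) |n⟩`. -/
def bargmann : MvPolynomial M ℂ →ₗ[ℂ] FinVec M :=
  (MvPolynomial.basisMonomials M ℂ).constr ℂ fun v => ((√(multiFact v : ℝ) : ℝ) : ℂ) • ket v

theorem bargmann_monomial (v : M →₀ ℕ) (a : ℂ) :
    bargmann (MvPolynomial.monomial v a) = (a * ((√(multiFact v : ℝ) : ℝ) : ℂ)) • ket v := by
  have h := (MvPolynomial.basisMonomials M ℂ).constr_basis ℂ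
    (fun v => ((√(multiFact v : ℝ) : ℝ) : ℂ) • ket v) v
  rw [MvPolynomial.coe_basisMonomials] at h
  have e : MvPolynomial.monomial v a = a • MvPolynomial.monomial v (1 : ℂ) := by
    rw [MvPolynomial.smul_monomial, smul_eq_mul, mul_one]
  rw [e, map_smul, mul_smul]
  exact congrArg _ h

variable [DecidableEq M]

theorem bargmann_X_mul (j : M) (p : MvPolynomial M ℂ) :
    bargmann (MvPolynomial.X j * p) = create j (bargmann p) := by
  induction p using MvPolynomial.induction_on' with
  | add p q hp hq => rw [mul_add, map_add, map_add, map_add, hp, hq]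
  | monomial v a =>
    rw [MvPolynomial.X, MvPolynomial.monomial_mul, bargmann_monomial, bargmann_monomial, map_smul,
      create_ket, smul_smul, one_mul, mul_assoc, Finsupp.coe_add, Finsupp.single_eq_pi_single,
      add_comm, sqrt_multiFact_add_single]
    push_cast
    rw [mul_comm (((√(v j + 1 : ℝ) : ℝ) : ℂ))]

theorem bargmann_pderiv (j : M) (p : MvPolynomial M ℂ) :
    bargmann (MvPolynomial.pderiv j p) = annihilate j (bargmann p) := by
  induction p using MvPolynomial.induction_on' with
  | add p q hp hq => rw [map_add, map_add, map_add, map_add, hp, hq]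
  | monomial v a =>
    rw [MvPolynomial.pderiv_monomial, bargmann_monomial, bargmann_monomial, map_smul,
      annihilate_ket, smul_smul, Finsupp.coe_tsub, Finsupp.single_eq_pi_single]
    congr 1
    by_cases h : v j = 0
    · simp [h]
    · obtain ⟨w, hw⟩ : ∃ w : M → ℕ, (v : M → ℕ) = w + Pi.single j 1 := by
        refine ⟨(v : M → ℕ) - Pi.single j 1, ?_⟩
        ext k
        by_cases hk : k = j
        · subst hk; simp; omega
        · simp [hk]
      rw [hw, add_tsub_cancel_right, sqrt_multiFact_add_single, Pi.add_apply, Pi.single_eq_same,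
        ofReal_mul]
      have h2 : ((√(w j + 1 : ℝ) : ℝ) : ℂ) * ((√(w j + 1 : ℝ) : ℝ) : ℂ) = w j + 1 := by
        rw [← ofReal_mul, Real.mul_self_sqrt (by positivity)]
        push_cast
        rfl
      push_cast
      linear_combination (-a * ((√(multiFact w : ℝ) : ℝ) : ℂ)) * h2

/-- The substitution `x_j ↦ t x_j`. -/
def scaleVar (t : ℂ) (j : M) : MvPolynomial M ℂ →ₐ[ℂ] MvPolynomial M ℂ :=
  MvPolynomial.aeval (Function.update MvPolynomial.X j (MvPolynomial.C t * MvPolynomial.X j))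

theorem scaleVar_X_self (t : ℂ) (j : M) :
    scaleVar t j (MvPolynomial.X j) = MvPolynomial.C t * MvPolynomial.X j := by
  simp [scaleVar]

theorem scaleVar_X_of_ne (t : ℂ) {j k : M} (h : k ≠ j) :
    scaleVar t j (MvPolynomial.X k) = MvPolynomial.X k := by
  simp [scaleVar, h]

theorem scaleVar_C (t : ℂ) (j : M) (a : ℂ) :
    scaleVar t j (MvPolynomial.C a) = MvPolynomial.C a := by
  simp [scaleVar]

theorem scaleVar_monomial (t : ℂ) (j : M) (v : M →₀ ℕ) (a : ℂ) :
    scaleVar t j (MvPolynomial.monomial v a) = MvPolynomial.monomial v (t ^ v j * a) := by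
  rw [MvPolynomial.monomial_eq, MvPolynomial.monomial_eq, map_mul, scaleVar_C,
    Finsupp.prod_fintype _ _ (by simp), map_prod, ← Finset.mul_prod_erase _ _ (Finset.mem_univ j),
    ← Finset.mul_prod_erase Finset.univ (fun k => MvPolynomial.X k ^ v k) (Finset.mem_univ j),
    map_pow, scaleVar_X_self, MvPolynomial.C_mul, MvPolynomial.C_pow]
  rw [Finset.prod_congr rfl fun k hk => by
    rw [map_pow, scaleVar_X_of_ne t (Finset.ne_of_mem_erase hk)]]
  ring

theorem bargmann_scaleVar (t : ℝ) (j : M) (p : MvPolynomial M ℂ) :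
    bargmann (scaleVar t j p) = powNumber t j (bargmann p) := by
  induction p using MvPolynomial.induction_on' with
  | add p q hp hq => rw [map_add, map_add, map_add, map_add, hp, hq]
  | monomial v a =>
    rw [scaleVar_monomial, bargmann_monomial, bargmann_monomial, map_smul, powNumber_ket, smul_smul]
    congr 1
    ring

/-- A derivation `D` with `D P = Q` and `D Q = D g = 0` has `Dᵏ (Pᵐ g) = m (m-1) ⋯ (m-k+1)
Pᵐ⁻ᵏ Qᵏ g`. -/
theorem derivation_iterate_pow_mul {A : Type*} [CommRing A] [Algebra ℂ A] (D : Derivation ℂ A A)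
    {P Q g : A} (hP : D P = Q) (hQ : D Q = 0) (hg : D g = 0) (m k : ℕ) :
    (D.toLinearMap ^ k) (P ^ m * g) = (m.descFactorial k : A) * (P ^ (m - k) * Q ^ k * g) := by
  induction k with
  | zero => simp
  | succ k ih =>
    rw [pow_succ', Module.End.mul_apply, ih]
    simp only [Derivation.coeFn_coe, Derivation.leibniz,
      Derivation.leibniz_pow, hP, hQ, hg, Derivation.map_natCast, smul_eq_mul, nsmul_eq_mul,
      Nat.descFactorial_succ, Nat.cast_mul]
    rw [show m - (k + 1) = m - k - 1 by omega]
    ring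

/-- The exponential series of a derivation acts as the translation `P ↦ P + D P` on a product
`Pᵐ g` if `D` kills `D P` and `g`. -/
theorem expNilpotent_bargmann_pow_mul {L : Module.End ℂ (FinVec M)}
    (D : Derivation ℂ (MvPolynomial M ℂ) (MvPolynomial M ℂ))
    (hL : ∀ p, bargmann (D p) = L (bargmann p)) {P Q g : MvPolynomial M ℂ} (hP : D P = Q)
    (hQ : D Q = 0) (hg : D g = 0) (m : ℕ) :
    expNilpotent L (bargmann (P ^ m * g)) = bargmann ((P + Q) ^ m * g) := by
  have hk : ∀ k, (L ^ k) (bargmann (P ^ m * g)) =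
      bargmann ((m.descFactorial k : MvPolynomial M ℂ) * (P ^ (m - k) * Q ^ k * g)) := by
    intro k
    rw [← derivation_iterate_pow_mul D hP hQ hg m k]
    generalize P ^ m * g = p
    induction k with
    | zero => simp
    | succ k ih => rw [pow_succ', Module.End.mul_apply, ih, ← hL, pow_succ', Module.End.mul_apply]; rfl
  rw [expNilpotent, finsum_eq_sum_of_support_subset (s := Finset.range (m + 1))]
  · rw [add_comm P Q, add_pow, Finset.sum_mul, map_sum]
    refine Finset.sum_congr rfl fun k _ => ?_
    rw [hk, ← map_smul]
    congr 1
    rw [Nat.descFactorial_eq_factorial_mul_choose, Nat.cast_mul, MvPolynomial.smul_eq_C_mul]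
    have : (MvPolynomial.C ((k ! : ℂ)⁻¹) : MvPolynomial M ℂ) * ((k ! : ℕ) : MvPolynomial M ℂ) = 1 := by
      rw [← map_natCast (MvPolynomial.C : ℂ →+* MvPolynomial M ℂ), ← MvPolynomial.C_mul,
        inv_mul_cancel₀ (by exact_mod_cast (Nat.factorial_pos k).ne'), MvPolynomial.C_1]
    linear_combination (((m.choose k : ℕ) : MvPolynomial M ℂ) * (P ^ (m - k) * Q ^ k * g)) * this
  · intro k hk'
    by_contra h
    apply hk'
    have : m < k := by simpa [Nat.lt_succ_iff] using h
    simp only [hk, Nat.descFactorial_of_lt this]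
    simp

/-- The adjoint beam splitter sends `x_j` to `T x_j - R x_i`, on polynomials without `x_i`. -/
theorem beamSplitterAdj_bargmann {T R : ℝ} (hT : T ≠ 0) (hTR : T ^ 2 + R ^ 2 = 1) {i j : M}
    (hij : i ≠ j) {g : MvPolynomial M ℂ} (hgi : i ∉ g.vars) (hgj : j ∉ g.vars) (m : ℕ) :
    beamSplitterAdj T R i j (bargmann (MvPolynomial.X j ^ m * g)) =
      bargmann ((MvPolynomial.C (T : ℂ) * MvPolynomial.X j
        - MvPolynomial.C (R : ℂ) * MvPolynomial.X i) ^ m * g) := by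
  have hs : ∀ (t : ℂ) (k : M), k ∉ g.vars → scaleVar t k g = g := by
    intro t k hk
    rw [scaleVar]
    conv_rhs => rw [← MvPolynomial.aeval_X_left_apply g]
    refine MvPolynomial.eval₂Hom_congr' rfl (fun l hl _ => ?_) rfl
    rw [Function.update_of_ne]
    rintro rfl
    exact hk hl
  have hdi := MvPolynomial.pderiv_eq_zero_of_notMem_vars hgi
  have hdj := MvPolynomial.pderiv_eq_zero_of_notMem_vars hgj
  rw [beamSplitterAdj, ← bargmann_scaleVar, map_mul, map_pow, scaleVar_X_of_ne _ hij.symm,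
    hs _ _ hgi,
    expNilpotent_bargmann_pow_mul
      ((MvPolynomial.C (-R : ℂ) * MvPolynomial.X i) • MvPolynomial.pderiv j)
      (Q := MvPolynomial.C (-R : ℂ) * MvPolynomial.X i) (g := g),
    expNilpotent_bargmann_pow_mul
      ((MvPolynomial.C (R : ℂ) * MvPolynomial.X j) • MvPolynomial.pderiv i)
      (Q := MvPolynomial.C (-R ^ 2 : ℂ) * MvPolynomial.X j) (g := g),
    ← bargmann_scaleVar, map_mul, map_pow, hs _ _ hgj]
  · congr 3
    simp only [map_add, map_mul, scaleVar_X_self, scaleVar_X_of_ne _ hij, scaleVar_C]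
    have e : (MvPolynomial.C ((T⁻¹ : ℝ) : ℂ) : MvPolynomial M ℂ) * (1 + MvPolynomial.C (-R ^ 2 : ℂ)) =
        MvPolynomial.C (T : ℂ) := by
      rw [← MvPolynomial.C_1, ← MvPolynomial.C_add, ← MvPolynomial.C_mul]
      congr 1
      have : (T : ℂ) ≠ 0 := by exact_mod_cast hT
      have h2 : (T : ℂ) ^ 2 + (R : ℂ) ^ 2 = 1 := by exact_mod_cast hTR
      push_cast
      field_simp
      linear_combination -h2
    rw [MvPolynomial.C_neg]
    linear_combination MvPolynomial.X j * e
  · intro p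
    simp only [Derivation.smul_apply, smul_eq_mul, LinearMap.smul_apply, Module.End.mul_apply]
    rw [mul_assoc, ← MvPolynomial.smul_eq_C_mul, map_smul, ← bargmann_X_mul, ← bargmann_pderiv,
      Derivation.leibniz, MvPolynomial.pderiv_X_of_ne hij.symm, smul_zero, add_zero, smul_eq_mul]
  · simp only [map_add, Derivation.smul_apply, MvPolynomial.pderiv_X_of_ne hij.symm,
      MvPolynomial.pderiv_C_mul, MvPolynomial.pderiv_X_self, smul_eq_mul]
    rw [mul_one, mul_zero, zero_add, MvPolynomial.C_neg, MvPolynomial.C_neg, MvPolynomial.C_pow]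
    ring
  · simp [MvPolynomial.pderiv_X_of_ne hij.symm]
  · simp [hdi]
  · intro p
    simp only [Derivation.smul_apply, smul_eq_mul, LinearMap.smul_apply, Module.End.mul_apply]
    rw [mul_assoc, ← MvPolynomial.smul_eq_C_mul, map_smul, bargmann_X_mul, bargmann_pderiv]
  · simp
  · simp [MvPolynomial.pderiv_X_of_ne hij]
  · simp [hdj]

end Bargmann

/-! ### The iteration map in the number basis -/

section Recursion

/-- The multi-index on `M ⊕ M` with the two given halves. -/
def pairIndex {M : Type} [Fintype M] (a b : M → ℕ) : M ⊕ M →₀ ℕ :=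
  Finsupp.equivFunOnFinite.symm (Sum.elim a b)

section

variable {M : Type} [Fintype M]

@[simp]
theorem pairIndex_inl (a b : M → ℕ) (j : M) : pairIndex a b (Sum.inl j) = a j := rfl

@[simp]
theorem pairIndex_inr (a b : M → ℕ) (j : M) : pairIndex a b (Sum.inr j) = b j := rfl

theorem pairIndex_comp (v : M ⊕ M →₀ ℕ) : pairIndex (v ∘ Sum.inl) (v ∘ Sum.inr) = v := by
  ext (j | j) <;> rfl

theorem degree_pairIndex (a b : M → ℕ) : (pairIndex a b).degree = ∑ j, a j + ∑ j, b j := by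
  rw [Finsupp.degree_eq_sum, Fintype.sum_sum_type]
  rfl

theorem multiFact_pairIndex (a b : M → ℕ) :
    multiFact (pairIndex a b) = multiFact a * multiFact b := by
  rw [multiFact, Fintype.prod_sum_type]
  rfl

/-- The coefficients of the Bargmann kernel of an operator with matrix `A` in the number basis, that
is, of the power series `∑ A p q z^p w^q / √(p! q!)`; its variables are indexed by `M ⊕ M`. -/
def kernelCoeff (A : Matrix (M → ℕ) (M → ℕ) ℂ) (v : M ⊕ M →₀ ℕ) : ℂ :=
  A (v ∘ Sum.inl) (v ∘ Sum.inr) / ((√(multiFact v : ℝ) : ℝ) : ℂ)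

theorem kernelCoeff_pairIndex (A : Matrix (M → ℕ) (M → ℕ) ℂ) (a b : M → ℕ) :
    kernelCoeff A (pairIndex a b) =
      A a b / (((√(multiFact a : ℝ) : ℝ) : ℂ) * ((√(multiFact b : ℝ) : ℝ) : ℂ)) := by
  rw [kernelCoeff, multiFact_pairIndex, Nat.cast_mul, Real.sqrt_mul (by positivity), ofReal_mul]
  rfl

end

/-- `∏ⱼ (T x_j' - R x_j)^(q_j)`, where the variables `x_j`, `x_j'` belong to the first and to the
second copy, expanded in monomials; here `T = R = t`. -/
theorem prod_sub_pow_eq_sum (t : ℂ) (q : Fin 2 → ℕ) :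
    ∏ j, (MvPolynomial.C t * MvPolynomial.X (Sum.inr j)
        - MvPolynomial.C t * MvPolynomial.X (Sum.inl j) : MvPolynomial (Fin 2 ⊕ Fin 2) ℂ) ^ q j =
      ∑ x ∈ Fintype.piFinset fun j => Finset.HasAntidiagonal.antidiagonal (q j),
        MvPolynomial.monomial (pairIndex (fun j => (x j).1) fun j => (x j).2)
          (t ^ (∑ j, q j) * ((-1) ^ (∑ j, (x j).1) *
            ((multiFact q : ℂ) / (multiFact (fun j => (x j).1) * multiFact fun j => (x j).2)))) := by
  have h1 : ∀ j, (MvPolynomial.C t * MvPolynomial.X (Sum.inr j)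
        - MvPolynomial.C t * MvPolynomial.X (Sum.inl j) : MvPolynomial (Fin 2 ⊕ Fin 2) ℂ) ^ q j =
      ∑ x ∈ Finset.HasAntidiagonal.antidiagonal (q j), MvPolynomial.C (t ^ q j * ((-1) ^ x.1 *
        (((q j)! : ℂ) / (x.1 ! * x.2 !)))) *
        (MvPolynomial.X (Sum.inl j) ^ x.1 * MvPolynomial.X (Sum.inr j) ^ x.2) := by
    intro j
    rw [← mul_sub, mul_pow, sub_eq_neg_add, (Commute.all _ _).add_pow', Finset.mul_sum]
    refine Finset.sum_congr rfl fun x hx => ?_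
    have hx' := Finset.HasAntidiagonal.mem_antidiagonal.1 hx
    have hc : (((q j).choose x.1 : ℕ) : ℂ) = ((q j)! : ℂ) / (x.1 ! * x.2 !) := by
      rw [← hx', Nat.cast_add_choose]
    rw [← hc, nsmul_eq_mul, neg_pow, MvPolynomial.C_mul, MvPolynomial.C_mul, MvPolynomial.C_pow,
      MvPolynomial.C_pow, MvPolynomial.C_neg, MvPolynomial.C_1, map_natCast]
    ring
  rw [Finset.prod_congr rfl fun j _ => h1 j, Finset.prod_univ_sum]
  refine Finset.sum_congr rfl fun x _ => ?_
  rw [MvPolynomial.monomial_eq, Finsupp.prod_fintype _ _ (by simp), Fintype.prod_sum_type,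
    Finset.prod_mul_distrib, Finset.prod_mul_distrib, ← map_prod]
  congr 2
  simp only [Finset.prod_mul_distrib, Finset.prod_div_distrib, Finset.prod_pow_eq_pow_sum, multiFact,
    Nat.cast_prod]

theorem sqrt_half_sq : ((1 / √2 : ℝ)) ^ 2 + (1 / √2 : ℝ) ^ 2 = 1 := by
  rw [div_pow, Real.sq_sqrt (by norm_num)]
  norm_num

theorem notMem_vars_C_mul_pow {σ : Type} {k : σ} {p : MvPolynomial σ ℂ} (h : k ∉ p.vars) (a : ℂ)
    (n : ℕ) : k ∉ (MvPolynomial.C a * p ^ n).vars := by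
  classical
  intro hk
  rcases Finset.mem_union.1 (MvPolynomial.vars_mul _ _ hk) with h1 | h1
  · simp at h1
  · exact h (MvPolynomial.vars_pow _ _ h1)

theorem notMem_vars_sub {σ : Type} {k l m : σ} {a b : ℂ} (hl : k ≠ l) (hm : k ≠ m) :
    k ∉ (MvPolynomial.C a * MvPolynomial.X l - MvPolynomial.C b * MvPolynomial.X m :
      MvPolynomial σ ℂ).vars := by
  classical
  intro hk
  have h : ∀ (a : ℂ) (l : σ), k ≠ l → k ∉ (MvPolynomial.C a * MvPolynomial.X l).vars := by
    intro a l hl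
    simpa using notMem_vars_C_mul_pow (p := MvPolynomial.X l) (by simpa using hl) a 1
  rcases Finset.mem_union.1 (MvPolynomial.vars_sub_subset _ hk) with h1 | h1
  · exact h a l hl h1
  · exact h b m hm h1

theorem beamSplittersAdj_ket (q : Fin 2 → ℕ) :
    beamSplittersAdj (ket (Sum.elim 0 q)) =
      (((√(multiFact q : ℝ) : ℝ) : ℂ)⁻¹) • bargmann
        (∏ j, (MvPolynomial.C ((1 / √2 : ℝ) : ℂ) * MvPolynomial.X (Sum.inr j)
          - MvPolynomial.C ((1 / √2 : ℝ) : ℂ) * MvPolynomial.X (Sum.inl j) :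
            MvPolynomial (Fin 2 ⊕ Fin 2) ℂ) ^ q j) := by
  have h0 : (1 / √2 : ℝ) ≠ 0 := by positivity
  have hk : ket (Sum.elim 0 q) = bargmann (M := Fin 2 ⊕ Fin 2) (MvPolynomial.X (Sum.inr 1) ^ q 1 *
      (MvPolynomial.C (((√(multiFact q : ℝ) : ℝ) : ℂ)⁻¹) * MvPolynomial.X (Sum.inr 0) ^ q 0)) := by
    have e : (MvPolynomial.X (Sum.inr 1) : MvPolynomial (Fin 2 ⊕ Fin 2) ℂ) ^ q 1 *
        (MvPolynomial.C (((√(multiFact q : ℝ) : ℝ) : ℂ)⁻¹) * MvPolynomial.X (Sum.inr 0) ^ q 0) =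
        MvPolynomial.monomial (pairIndex 0 q) (((√(multiFact q : ℝ) : ℝ) : ℂ)⁻¹) := by
      rw [MvPolynomial.monomial_eq, Finsupp.prod_fintype _ _ (by simp), Fintype.prod_sum_type]
      simp
      ring
    rw [e, bargmann_monomial, multiFact_pairIndex]
    have : multiFact (0 : Fin 2 → ℕ) = 1 := by simp [multiFact]
    rw [this, one_mul, inv_mul_cancel₀ (sqrt_multiFact_ne_zero q), one_smul]
    rfl
  rw [beamSplittersAdj, hk, beamSplitterAdj_bargmann h0 sqrt_half_sq (by simp),
    show ∀ x y z : MvPolynomial (Fin 2 ⊕ Fin 2) ℂ, x * (y * z) = z * (y * x) from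
      fun x y z => by ring, beamSplitterAdj_bargmann h0 sqrt_half_sq (by simp), ← map_smul]
  · congr 1
    rw [Fin.prod_univ_two, MvPolynomial.smul_eq_C_mul]
    ring
  · exact notMem_vars_C_mul_pow (notMem_vars_sub (by simp) (by simp)) _ _
  · exact notMem_vars_C_mul_pow (notMem_vars_sub (by simp) (by simp)) _ _
  · exact notMem_vars_C_mul_pow (by simp) _ _
  · exact notMem_vars_C_mul_pow (by simp) _ _

theorem detectedKet_eq_sum (q : Fin 2 → ℕ) :
    detectedKet q = ∑ x ∈ Fintype.piFinset fun j => Finset.HasAntidiagonal.antidiagonal (q j),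
      (((1 / √2 : ℝ) : ℂ) ^ (∑ j, q j) * ((-1) ^ (∑ j, (x j).1) *
        (((√(multiFact q : ℝ) : ℝ) : ℂ) / (((√(multiFact fun j => (x j).1) : ℝ) : ℂ) *
          ((√(multiFact fun j => (x j).2) : ℝ) : ℂ))))) •
      ((numberState (fun j => (x j).1) ⊗ₜ[ℂ] numberState (fun j => (x j).2) :
        TwoMode ⊗[ℂ] TwoMode) : FourMode) := by
  rw [detectedKet, beamSplittersAdj_ket, prod_sub_pow_eq_sum, map_sum, Finset.smul_sum, map_sum]
  refine Finset.sum_congr rfl fun x _ => ?_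
  rw [bargmann_monomial, smul_smul, map_smul]
  congr 1
  · rw [multiFact_pairIndex, Nat.cast_mul, Real.sqrt_mul (by positivity), ofReal_mul]
    have hs : ∀ n : Fin 2 → ℕ, (multiFact n : ℂ) =
        ((√(multiFact n : ℝ) : ℝ) : ℂ) * ((√(multiFact n : ℝ) : ℝ) : ℂ) := by
      intro n
      rw [← ofReal_mul, Real.mul_self_sqrt (by positivity), ofReal_natCast]
    rw [hs, hs, hs]
    have := sqrt_multiFact_ne_zero q
    have := sqrt_multiFact_ne_zero (fun j => (x j).1)
    have := sqrt_multiFact_ne_zero (fun j => (x j).2)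
    field_simp
  · rw [toFourMode, ket, Finsupp.linearCombination_single, one_smul]
    rfl

theorem inner_tensorOp (ρ : TwoMode →L[ℂ] TwoMode) (a b a' b' : Fin 2 → ℕ) :
    inner ℂ ((numberState a ⊗ₜ[ℂ] numberState b : TwoMode ⊗[ℂ] TwoMode) : FourMode)
      (tensorOp ρ ρ ((numberState a' ⊗ₜ[ℂ] numberState b' : TwoMode ⊗[ℂ] TwoMode) : FourMode)) =
      inner ℂ (numberState a) (ρ (numberState a')) *
        inner ℂ (numberState b) (ρ (numberState b')) := by
  rw [tensorOp, ContinuousLinearMap.completion_apply_coe, UniformSpace.Completion.inner_coe,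
    TensorProduct.mapL_tmul, TensorProduct.inner_tmul]

/-- In terms of the coefficients of Bargmann kernels, a fixed point of the iteration satisfies
`F(u) = c F(-u / √2) F(u / √2)`. -/
theorem kernelCoeff_recursion {ρ : TwoMode →L[ℂ] TwoMode} {c : ℝ}
    (hfix : (c : ℂ) • iterationMap (tensorOp ρ ρ) = numberMatrix ρ) (u : Fin 2 ⊕ Fin 2 →₀ ℕ) :
    kernelCoeff (numberMatrix ρ) u = c * ((1 / √2 : ℝ) : ℂ) ^ u.degree *
      ∑ x ∈ Finset.HasAntidiagonal.antidiagonal u, (-1) ^ x.1.degree *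
        (kernelCoeff (numberMatrix ρ) x.1 * kernelCoeff (numberMatrix ρ) x.2) := by
  obtain ⟨p, q, rfl⟩ : ∃ p q, u = pairIndex p q := ⟨_, _, (pairIndex_comp u).symm⟩
  have h := congrFun (congrFun hfix p) q
  rw [kernelCoeff_pairIndex, ← h, Matrix.smul_apply, smul_eq_mul, iterationMap, Matrix.of_apply,
    detectedKet_eq_sum, detectedKet_eq_sum, degree_pairIndex]
  simp only [map_sum, map_smul, sum_inner, inner_sum, inner_smul_left, inner_smul_right,
    inner_tensorOp]
  simp only [Finset.mul_sum]
  rw [Finset.sum_comm, ← Finset.sum_product' , Finset.sum_div]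
  refine Finset.sum_nbij'
    (fun z => (pairIndex (fun j => (z.1 j).1) fun j => (z.2 j).1,
      pairIndex (fun j => (z.1 j).2) fun j => (z.2 j).2))
    (fun z => (fun j => (z.1 (Sum.inl j), z.2 (Sum.inl j)),
      fun j => (z.1 (Sum.inr j), z.2 (Sum.inr j)))) ?_ ?_ ?_ ?_ ?_
  · intro z hz
    simp only [Finset.mem_product, Fintype.mem_piFinset, Finset.HasAntidiagonal.mem_antidiagonal] at hz ⊢
    ext (j | j)
    · simpa using hz.1 j
    · simpa using hz.2 j
  · intro z hz
    simp only [Finset.mem_product, Fintype.mem_piFinset, Finset.HasAntidiagonal.mem_antidiagonal] at hz ⊢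
    exact ⟨fun j => by simpa using DFunLike.congr_fun hz (Sum.inl j),
      fun j => by simpa using DFunLike.congr_fun hz (Sum.inr j)⟩
  · intro z _
    rfl
  · intro z _
    refine Prod.ext ?_ ?_ <;> ext (j | j) <;> rfl
  · intro z _
    have := sqrt_multiFact_ne_zero p
    have := sqrt_multiFact_ne_zero q
    simp only [kernelCoeff_pairIndex, degree_pairIndex, map_mul, map_pow, map_div₀, conj_ofReal,
      map_neg, map_one, numberMatrix, Matrix.of_apply]
    field_simp
    ring

end Recursion

/-! ### Solutions of `F(u) = c F(-u / √2) F(u / √2)` -/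

section FunctionalEquation

variable {σ : Type} [Fintype σ] [DecidableEq σ]

set_option linter.unusedSectionVars false

/-- The homogeneous part of degree `k` of the power series with coefficients `f`. -/
def homPart (f : (σ →₀ ℕ) → ℂ) (k : ℕ) : MvPolynomial σ ℂ :=
  ∑ v ∈ Finset.finsuppAntidiag Finset.univ k, MvPolynomial.monomial v (f v)

theorem mem_finsuppAntidiag_univ {k : ℕ} {v : σ →₀ ℕ} :
    v ∈ Finset.finsuppAntidiag Finset.univ k ↔ v.degree = k := by
  simp [Finset.mem_finsuppAntidiag, Finsupp.degree_eq_sum]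

theorem coeff_homPart (f : (σ →₀ ℕ) → ℂ) (k : ℕ) (v : σ →₀ ℕ) :
    (homPart f k).coeff v = if v.degree = k then f v else 0 := by
  rw [homPart, MvPolynomial.coeff_sum]
  simp only [MvPolynomial.coeff_monomial]
  rw [Finset.sum_ite_eq']
  simp only [mem_finsuppAntidiag_univ]

theorem homPart_isHomogeneous (f : (σ →₀ ℕ) → ℂ) (k : ℕ) : (homPart f k).IsHomogeneous k := by
  intro v hv
  rw [coeff_homPart] at hv
  have : v.degree = k := by
    by_contra h
    simp [h] at hv
  rw [← this, Finsupp.degree_eq_weight_one]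
  rfl

/-- The functional equation, on coefficients; here `r = 1 / √2`. -/
def IsSelfSimilar (f : (σ →₀ ℕ) → ℂ) (c r : ℂ) : Prop :=
  ∀ u, f u = c * r ^ u.degree *
    ∑ x ∈ Finset.HasAntidiagonal.antidiagonal u, (-1) ^ x.1.degree * (f x.1 * f x.2)

variable {f : (σ →₀ ℕ) → ℂ} {c r : ℂ}

theorem IsSelfSimilar.homPart_eq (h : IsSelfSimilar f c r) (k : ℕ) :
    homPart f k = MvPolynomial.C (c * r ^ k) *
      ∑ x ∈ Finset.HasAntidiagonal.antidiagonal k,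
        (-1) ^ x.1 * (homPart f x.1 * homPart f x.2) := by
  ext u
  have hc : ∀ x : ℕ × ℕ, MvPolynomial.coeff u ((-1) ^ x.1 * (homPart f x.1 * homPart f x.2)) =
      ∑ y ∈ Finset.HasAntidiagonal.antidiagonal u,
        if x = (y.1.degree, y.2.degree) then (-1) ^ y.1.degree * (f y.1 * f y.2) else 0 := by
    intro x
    have e : ((-1) ^ x.1 : MvPolynomial σ ℂ) = MvPolynomial.C ((-1) ^ x.1) := by simp
    rw [e, MvPolynomial.coeff_C_mul, MvPolynomial.coeff_mul, Finset.mul_sum]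
    refine Finset.sum_congr rfl fun y _ => ?_
    rw [coeff_homPart, coeff_homPart]
    by_cases h1 : y.1.degree = x.1
    · by_cases h2 : y.2.degree = x.2
      · simp [h1, h2]
      · have hx : ¬ x = (y.1.degree, y.2.degree) := fun hx => h2 (by rw [hx])
        simp [h2, hx]
    · have hx : ¬ x = (y.1.degree, y.2.degree) := fun hx => h1 (by rw [hx])
      simp [h1, hx]
  rw [MvPolynomial.coeff_C_mul, MvPolynomial.coeff_sum, Finset.sum_congr rfl fun x _ => hc x,
    Finset.sum_comm, coeff_homPart]
  have hi : ∀ y ∈ Finset.HasAntidiagonal.antidiagonal u,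
      (∑ x ∈ Finset.HasAntidiagonal.antidiagonal k,
        if x = (y.1.degree, y.2.degree) then (-1) ^ y.1.degree * (f y.1 * f y.2) else 0) =
      if u.degree = k then (-1) ^ y.1.degree * (f y.1 * f y.2) else 0 := by
    intro y hy
    rw [Finset.sum_ite_eq']
    have : u.degree = y.1.degree + y.2.degree := by
      rw [← Finset.HasAntidiagonal.mem_antidiagonal.1 hy, map_add]
    simp only [this, Finset.HasAntidiagonal.mem_antidiagonal]
  rw [Finset.sum_congr rfl hi]
  by_cases hk : u.degree = k
  · simp only [hk, if_true]
    rw [h u, hk]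
  · simp [hk]

/-- A nonzero solution has a nonzero constant term: the part of lowest degree `k` of the right side
of the functional equation would have degree `2 k`. -/
theorem IsSelfSimilar.apply_zero_ne (h : IsSelfSimilar f c r) (hf : ∃ v, f v ≠ 0) : f 0 ≠ 0 := by
  intro h0
  obtain ⟨v, hv⟩ := hf
  have key : ∀ k, homPart f k = 0 := by
    intro k
    induction k using Nat.strong_induction_on with
    | _ k ih =>
      rcases Nat.eq_zero_or_pos k with rfl | hk
      · ext u
        rw [coeff_homPart]
        by_cases hu : u.degree = 0
        · rw [Finsupp.degree_eq_zero_iff] at hu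
          simp [hu, h0]
        · simp [hu]
      · rw [h.homPart_eq, Finset.sum_eq_zero, mul_zero]
        intro x hx
        have := Finset.HasAntidiagonal.mem_antidiagonal.1 hx
        rcases lt_or_ge x.1 k with h1 | h1
        · rw [ih _ h1]; simp
        · rw [ih x.2 (by omega)]; simp
  apply hv
  have := coeff_homPart f v.degree v
  rw [key] at this
  simpa using this.symm

theorem IsSelfSimilar.apply_zero (h : IsSelfSimilar f c r) (hf : ∃ v, f v ≠ 0) :
    f 0 = c⁻¹ := by
  have h0 := h.apply_zero_ne hf
  have := h 0
  simp only [map_zero, pow_zero, mul_one, Finsupp.antidiagonal_zero, Finset.sum_singleton,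
    one_mul] at this
  have h1 : c * f 0 = 1 := mul_left_cancel₀ h0 (by linear_combination -this)
  exact eq_inv_of_mul_eq_one_right h1

/-- The quadratic form in the exponent of the solution, as a polynomial. -/
def quadPoly (f : (σ →₀ ℕ) → ℂ) (c : ℂ) : MvPolynomial σ ℂ := MvPolynomial.C c * homPart f 2

/-- The homogeneous part of degree `k` of `exp κ / c` for a quadratic form `κ`. -/
def expPart (κ : MvPolynomial σ ℂ) (c : ℂ) (k : ℕ) : MvPolynomial σ ℂ :=
  if Even k then MvPolynomial.C (c * (k / 2)!)⁻¹ * κ ^ (k / 2) else 0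

theorem sum_range_of_odd_eq_zero {A : Type*} [AddCommMonoid A] (g : ℕ → A)
    (hg : ∀ a, g (2 * a + 1) = 0) (m : ℕ) :
    ∑ i ∈ Finset.range (2 * m + 1), g i = ∑ a ∈ Finset.range (m + 1), g (2 * a) := by
  induction m with
  | zero => simp
  | succ m ih =>
    rw [show 2 * (m + 1) + 1 = 2 * m + 1 + 1 + 1 by ring, Finset.sum_range_succ,
      Finset.sum_range_succ, ih, hg, add_zero, Finset.sum_range_succ _ (m + 1)]
    rfl

theorem expPart_recursion (κ : MvPolynomial σ ℂ) (hc : c ≠ 0) (hr : r ^ 2 = 1 / 2) (k : ℕ) :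
    expPart κ c k = MvPolynomial.C (c * r ^ k) *
      ∑ x ∈ Finset.HasAntidiagonal.antidiagonal k,
        (-1) ^ x.1 * (expPart κ c x.1 * expPart κ c x.2) := by
  rcases Nat.even_or_odd' k with ⟨m, rfl | rfl⟩
  · rw [Finset.Nat.sum_antidiagonal_eq_sum_range_succ_mk, sum_range_of_odd_eq_zero]
    · have : ∀ a ∈ Finset.range (m + 1), ((-1) ^ (2 * a) : MvPolynomial σ ℂ) *
          (expPart κ c (2 * a) * expPart κ c (2 * m - 2 * a)) =
          MvPolynomial.C ((m.choose a : ℂ) * (c ^ 2 * m !)⁻¹) * κ ^ m := by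
        intro a ha
        have ham : a ≤ m := by simpa [Nat.lt_succ_iff] using ha
        rw [pow_mul, neg_one_sq, one_pow, one_mul, ← Nat.mul_sub, expPart, expPart,
          if_pos (even_two_mul _), if_pos (even_two_mul _), Nat.mul_div_cancel_left _ two_pos,
          Nat.mul_div_cancel_left _ two_pos, mul_mul_mul_comm, ← pow_add, Nat.add_sub_of_le ham,
          ← MvPolynomial.C_mul, Nat.cast_choose ℂ ham]
        congr 2
        have := Nat.factorial_ne_zero a
        have := Nat.factorial_ne_zero m
        have := Nat.factorial_ne_zero (m - a)
        field_simp
      rw [Finset.sum_congr rfl this, ← Finset.sum_mul, ← map_sum, ← Finset.sum_mul,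
        ← Nat.cast_sum, Nat.sum_range_choose, expPart, if_pos (even_two_mul _),
        Nat.mul_div_cancel_left _ two_pos, ← mul_assoc, ← MvPolynomial.C_mul, pow_mul, hr]
      congr 2
      have := Nat.factorial_ne_zero m
      push_cast
      rw [div_pow, one_pow]
      field_simp
    · intro a
      simp [expPart]
  · rw [Finset.sum_eq_zero, mul_zero]
    · simp [expPart]
    · intro x hx
      have hx' := Finset.HasAntidiagonal.mem_antidiagonal.1 hx
      by_cases h1 : Even x.1
      · have h2 : ¬ Even x.2 := by
          intro h2
          have := h1.add h2
          rw [hx'] at this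
          simp at this
        simp [expPart, h2]
      · simp [expPart, h1]

theorem homPart_zero : homPart f 0 = MvPolynomial.C (f 0) := by
  ext u
  rw [coeff_homPart, MvPolynomial.coeff_C]
  by_cases hu : u = 0
  · simp [hu]
  · rw [if_neg, if_neg (Ne.symm hu)]
    rwa [Finsupp.degree_eq_zero_iff]

/-- The solution of the functional equation is the exponential of a quadratic form. In the degrees
`k ≠ 0, 2` the equation determines the homogeneous part of degree `k` from the lower ones. -/
theorem IsSelfSimilar.homPart_eq_expPart (h : IsSelfSimilar f c r) (hf : ∃ v, f v ≠ 0) (hc : c ≠ 0)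
    (hr : r ^ 2 = 1 / 2) (k : ℕ) : homPart f k = expPart (quadPoly f c) c k := by
  have h00 : homPart f 0 = MvPolynomial.C c⁻¹ := by rw [homPart_zero, h.apply_zero hf]
  have e0 : expPart (quadPoly f c) c 0 = MvPolynomial.C c⁻¹ := by simp [expPart]
  induction k using Nat.strong_induction_on with
  | _ k ih =>
    rcases eq_or_ne k 0 with rfl | hk0
    · rw [h00, e0]
    rcases eq_or_ne k 2 with rfl | hk2
    · rw [expPart, if_pos even_two, quadPoly, Nat.div_self two_pos, pow_one, ← mul_assoc,
        ← MvPolynomial.C_mul]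
      simp [hc]
    -- The difference of the two sides is an eigenvector of the linearized equation.
    have hd : homPart f k - expPart (quadPoly f c) c k = MvPolynomial.C (r ^ k * (1 + (-1) ^ k)) *
        (homPart f k - expPart (quadPoly f c) c k) := by
      conv_lhs => rw [h.homPart_eq, expPart_recursion (quadPoly f c) hc hr, ← mul_sub,
        ← Finset.sum_sub_distrib]
      have hmem1 : (0, k) ∈ Finset.HasAntidiagonal.antidiagonal k := by simp
      have hmem2 : (k, 0) ∈ (Finset.HasAntidiagonal.antidiagonal k).erase (0, k) := by simp [hk0]
      rw [← Finset.add_sum_erase _ _ hmem1, ← Finset.add_sum_erase _ _ hmem2, Finset.sum_eq_zero,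
        h00, e0]
      · have : (MvPolynomial.C c : MvPolynomial σ ℂ) * MvPolynomial.C c⁻¹ = 1 := by
          rw [← MvPolynomial.C_mul, mul_inv_cancel₀ hc, MvPolynomial.C_1]
        simp only [MvPolynomial.C_mul, MvPolynomial.C_add, MvPolynomial.C_pow, MvPolynomial.C_neg,
          MvPolynomial.C_1, pow_zero, one_mul, add_zero]
        linear_combination (MvPolynomial.C r ^ k * (1 + (-1) ^ k) *
          (homPart f k - expPart (quadPoly f c) c k)) * this
      · intro x hx
        simp only [Finset.mem_erase, Finset.HasAntidiagonal.mem_antidiagonal, ne_eq,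
          Prod.ext_iff] at hx
        rw [ih x.1 (by omega), ih x.2 (by omega), sub_self]
    have hne : r ^ k * (1 + (-1) ^ k) ≠ 1 := by
      rcases Nat.even_or_odd' k with ⟨m, rfl | rfl⟩
      · rw [pow_mul, hr, pow_mul, neg_one_sq, one_pow, div_pow, one_pow]
        intro h2
        have h3 : (2 : ℂ) ^ m = 2 ^ 1 := by
          have : (2 : ℂ) ^ m ≠ 0 := pow_ne_zero _ two_ne_zero
          have h5 := (div_eq_iff this).1 (by rw [← h2]; ring : (2 : ℂ) / 2 ^ m = 1)
          rw [one_mul] at h5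
          rw [← h5, pow_one]
        have h4 : (2 : ℕ) ^ m = 2 ^ 1 := by exact_mod_cast h3
        have := Nat.pow_right_injective le_rfl h4
        omega
      · rw [pow_succ (-1 : ℂ), pow_mul (-1 : ℂ), neg_one_sq, one_pow]
        simp
    have h2 : MvPolynomial.C (1 - r ^ k * (1 + (-1) ^ k)) *
        (homPart f k - expPart (quadPoly f c) c k) = 0 := by
      rw [MvPolynomial.C_sub, sub_mul, ← hd, MvPolynomial.C_1, one_mul, sub_self]
    rcases mul_eq_zero.1 h2 with h3 | h3
    · rw [MvPolynomial.C_eq_zero] at h3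
      exact absurd (sub_eq_zero.1 h3).symm hne
    · exact sub_eq_zero.1 h3

/-- The coefficients of a solution in odd degrees vanish. -/
theorem IsSelfSimilar.eq_zero_of_odd (h : IsSelfSimilar f c r) (hf : ∃ v, f v ≠ 0) (hc : c ≠ 0)
    (hr : r ^ 2 = 1 / 2) {v : σ →₀ ℕ} (hv : Odd v.degree) : f v = 0 := by
  have h1 := coeff_homPart f v.degree v
  rw [h.homPart_eq_expPart hf hc hr, expPart, if_neg (Nat.not_even_iff_odd.2 hv)] at h1
  simpa using h1.symm

/-- The symmetric matrix of second derivatives of `quadPoly f c`. -/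
def quadMat (f : (σ →₀ ℕ) → ℂ) (c : ℂ) (s t : σ) : ℂ :=
  c * ((Finsupp.single t 1 s + 1 : ℕ) * f (Finsupp.single t 1 + Finsupp.single s 1))

theorem quadMat_symm (f : (σ →₀ ℕ) → ℂ) (c : ℂ) (s t : σ) : quadMat f c s t = quadMat f c t s := by
  rw [quadMat, quadMat, add_comm (Finsupp.single s 1), Finsupp.single_apply, Finsupp.single_apply]
  simp only [eq_comm]

theorem coeff_zero_pderiv_quadPoly (s t : σ) :
    (MvPolynomial.pderiv t (MvPolynomial.pderiv s (quadPoly f c))).coeff 0 = quadMat f c s t := by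
  rw [MvPolynomial.coeff_pderiv, MvPolynomial.coeff_pderiv, quadPoly, MvPolynomial.coeff_C_mul,
    coeff_homPart, if_pos, quadMat, zero_add]
  · push_cast
    simp
    ring
  · simp

theorem quadPoly_isHomogeneous : (quadPoly f c).IsHomogeneous 2 := by
  have := (MvPolynomial.isHomogeneous_C σ c).mul (homPart_isHomogeneous f 2)
  rwa [zero_add] at this

theorem pderiv_quadPoly (s : σ) : MvPolynomial.pderiv s (quadPoly f c) =
    ∑ t, MvPolynomial.C (quadMat f c s t) * MvPolynomial.X t := by
  have h1 : (MvPolynomial.pderiv s (quadPoly f c)).IsHomogeneous 1 :=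
    quadPoly_isHomogeneous.pderiv
  have h2 := h1.sum_X_mul_pderiv
  rw [one_smul] at h2
  rw [← h2]
  refine Finset.sum_congr rfl fun t _ => ?_
  have h3 : (MvPolynomial.pderiv t (MvPolynomial.pderiv s (quadPoly f c))).IsHomogeneous 0 :=
    h1.pderiv
  rw [MvPolynomial.totalDegree_eq_zero_iff_eq_C.1 (Nat.le_zero.1 h3.totalDegree_le),
    coeff_zero_pderiv_quadPoly, mul_comm]

theorem eval_quadPoly (u : σ → ℂ) :
    (quadPoly f c).eval u = (∑ s, ∑ t, quadMat f c s t * (u s * u t)) / 2 := by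
  have h := congrArg (MvPolynomial.eval u)
    (quadPoly_isHomogeneous (f := f) (c := c)).sum_X_mul_pderiv
  simp only [pderiv_quadPoly, map_sum, map_mul, MvPolynomial.eval_X, MvPolynomial.eval_C,
    nsmul_eq_mul, Nat.cast_ofNat, map_ofNat] at h
  rw [eq_div_iff two_ne_zero, mul_comm, ← h]
  refine Finset.sum_congr rfl fun s _ => ?_
  rw [Finset.mul_sum]
  refine Finset.sum_congr rfl fun t _ => ?_
  ring

/-- The differential equation `∂F/∂u_s = (∂κ/∂u_s) F` on coefficients. -/
theorem IsSelfSimilar.apply_add_single (h : IsSelfSimilar f c r) (hf : ∃ v, f v ≠ 0) (hc : c ≠ 0)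
    (hr : r ^ 2 = 1 / 2) (v : σ →₀ ℕ) (s : σ) :
    (v s + 1) * f (v + Finsupp.single s 1) =
      ∑ t, quadMat f c s t * if v t = 0 then 0 else f (v - Finsupp.single t 1) := by
  rcases Nat.eq_zero_or_pos v.degree with h0 | h0
  · have hv0 := (Finsupp.degree_eq_zero_iff v).1 h0
    rw [h.eq_zero_of_odd hf hc hr, mul_zero]
    · simp [hv0]
    · simp [hv0]
  obtain ⟨k, hk⟩ : ∃ k, v.degree = k + 1 := ⟨v.degree - 1, by omega⟩
  have hder : MvPolynomial.pderiv s (homPart f (k + 2)) =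
      MvPolynomial.pderiv s (quadPoly f c) * homPart f k := by
    rw [h.homPart_eq_expPart hf hc hr, h.homPart_eq_expPart hf hc hr, expPart, expPart]
    by_cases he : Even k
    · obtain ⟨m, rfl⟩ := he.two_dvd
      rw [if_pos (by simp [parity_simps]), if_pos he, show 2 * m + 2 = 2 * (m + 1) by ring,
        Nat.mul_div_cancel_left _ two_pos, Nat.mul_div_cancel_left _ two_pos,
        MvPolynomial.pderiv_C_mul, MvPolynomial.pderiv_pow, Nat.add_sub_cancel,
        ← map_natCast (MvPolynomial.C : ℂ →+* MvPolynomial σ ℂ)]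
      have : (MvPolynomial.C (c * ((m + 1)! : ℕ))⁻¹ * MvPolynomial.C ((m + 1 : ℕ) : ℂ) :
          MvPolynomial σ ℂ) = MvPolynomial.C (c * (m ! : ℕ))⁻¹ := by
        rw [← MvPolynomial.C_mul, Nat.factorial_succ]
        congr 1
        have := Nat.factorial_ne_zero m
        have : ((m + 1 : ℕ) : ℂ) ≠ 0 := by exact_mod_cast m.succ_ne_zero
        push_cast at this ⊢
        field_simp
      linear_combination (quadPoly f c ^ m * MvPolynomial.pderiv s (quadPoly f c)) * this
    · rw [if_neg (by simpa [parity_simps] using he), if_neg he]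
      simp
  have hco := congrArg (MvPolynomial.coeff v) hder
  rw [MvPolynomial.coeff_pderiv, coeff_homPart, if_pos (by simp [hk]), pderiv_quadPoly,
    Finset.sum_mul, MvPolynomial.coeff_sum] at hco
  rw [mul_comm, hco]
  refine Finset.sum_congr rfl fun t _ => ?_
  rw [mul_assoc, MvPolynomial.coeff_C_mul, MvPolynomial.coeff_X_mul', coeff_homPart]
  congr 1
  by_cases hvt : v t = 0
  · simp [hvt]
  · rw [if_neg hvt, if_pos (by simpa using hvt), if_pos]
    have : v = (v - Finsupp.single t 1) + Finsupp.single t 1 :=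
      (Finsupp.sub_add_single_one_cancel hvt).symm
    have h2 := congrArg Finsupp.degree this
    rw [map_add, hk, Finsupp.degree_single] at h2
    omega

/-- If the power series converges absolutely, its sum is `exp κ / c`. -/
theorem IsSelfSimilar.hasSum (h : IsSelfSimilar f c r) (hf : ∃ v, f v ≠ 0) (hc : c ≠ 0)
    (hr : r ^ 2 = 1 / 2) (u : σ → ℂ) (hs : Summable fun v : σ →₀ ℕ => f v * ∏ s, u s ^ v s) :
    HasSum (fun v : σ →₀ ℕ => f v * ∏ s, u s ^ v s)
      (c⁻¹ * cexp ((∑ s, ∑ t, quadMat f c s t * (u s * u t)) / 2)) := by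
  have hev : ∀ k, (homPart f k).eval u =
      ∑ v ∈ Finset.finsuppAntidiag Finset.univ k, f v * ∏ s, u s ^ v s := by
    intro k
    rw [homPart, map_sum]
    refine Finset.sum_congr rfl fun v _ => ?_
    rw [MvPolynomial.eval_monomial, Finsupp.prod_fintype _ _ (by simp)]
  have h1 := hs.hasSum.tsum_fiberwise (fun v => v.degree)
  have h2 : ∀ k, ∑' b : (fun v : σ →₀ ℕ => v.degree) ⁻¹' {k}, f b * ∏ s, u s ^ (b : σ →₀ ℕ) s =
      (homPart f k).eval u := by
    intro k
    rw [hev, ← Finset.tsum_subtype]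
    have : (fun v : σ →₀ ℕ => v.degree) ⁻¹' {k} =
        {v | v ∈ Finset.finsuppAntidiag (Finset.univ : Finset σ) k} := by
      ext v
      simp only [Set.mem_preimage, Set.mem_singleton_iff, Set.mem_ofPred_eq,
        mem_finsuppAntidiag_univ]
    rw [this]
    rfl
  simp only [h2] at h1
  set κ := (quadPoly f c).eval u with hκ
  have h3 : HasSum (fun k => (homPart f k).eval u) (c⁻¹ * cexp κ) := by
    have hexp : HasSum (fun m : ℕ => c⁻¹ * (κ ^ m / m !)) (c⁻¹ * cexp κ) := by
      have := NormedSpace.expSeries_div_hasSum_exp κ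
      rw [← Complex.exp_eq_exp_ℂ] at this
      exact this.mul_left _
    have hinj : Function.Injective fun m : ℕ => 2 * m := fun a b hab => by simpa using hab
    rw [← hinj.hasSum_iff]
    · have he : (fun k => (homPart f k).eval u) ∘ (fun m : ℕ => 2 * m) =
          fun m : ℕ => c⁻¹ * (κ ^ m / m !) := by
        funext m
        rw [Function.comp_apply, h.homPart_eq_expPart hf hc hr, expPart, if_pos (even_two_mul m),
          Nat.mul_div_cancel_left _ two_pos, map_mul, map_pow, MvPolynomial.eval_C, ← hκ, mul_inv]
        ring
      rwa [he]
    · intro k hk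
      rw [h.homPart_eq_expPart hf hc hr, expPart, if_neg]
      · simp
      · intro he
        obtain ⟨m, rfl⟩ := he.two_dvd
        exact hk ⟨m, rfl⟩
  rw [← eval_quadPoly, ← hκ, h3.unique h1]
  exact hs.hasSum

end FunctionalEquation

/-! ### The number matrix of a state -/

section States

variable {M : Type} [Fintype M] [DecidableEq M] {ρ : Fock M →L[ℂ] Fock M}

set_option linter.unusedSectionVars false

theorem IsState.conj_numberMatrix (hρ : IsState ρ) (p q : M → ℕ) :
    (starRingEnd ℂ) (numberMatrix ρ p q) = numberMatrix ρ q p := by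
  rw [numberMatrix, Matrix.of_apply, Matrix.of_apply, inner_conj_symm,
    hρ.1.inner_left_eq_inner_right]

/-- Cauchy-Schwarz for the positive semidefinite form `⟨x, ρ y⟩`. -/
theorem norm_inner_le_of_isPositive {E : Type*} [NormedAddCommGroup E] [InnerProductSpace ℂ E]
    {T : E →L[ℂ] E} (hT : T.IsPositive) (x y : E) :
    ‖inner ℂ x (T y)‖ ≤ √(inner ℂ x (T x)).re * √(inner ℂ y (T y)).re := by
  let _ : PreInnerProductSpace.Core ℂ E :=
    { inner := fun x y => inner ℂ x (T y)
      conj_inner_symm := fun x y => by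
        rw [inner_conj_symm, hT.inner_left_eq_inner_right]
      re_inner_nonneg := fun x => hT.re_inner_nonneg_right x
      add_left := fun x y z => inner_add_left _ _ _
      smul_left := fun x y r => inner_smul_left _ _ _ }
  have h : ‖inner ℂ x (T y)‖ * ‖inner ℂ y (T x)‖ ≤
      (inner ℂ x (T x)).re * (inner ℂ y (T y)).re :=
    InnerProductSpace.Core.inner_mul_inner_self_le (𝕜 := ℂ) x y
  have hs : ‖inner ℂ y (T x)‖ = ‖inner ℂ x (T y)‖ := by
    rw [← inner_conj_symm, RCLike.norm_conj, hT.inner_left_eq_inner_right]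
  rw [hs] at h
  rw [← Real.sqrt_mul (show 0 ≤ (inner ℂ x (T x)).re from hT.re_inner_nonneg_right x)]
  exact Real.le_sqrt_of_sq_le (by rw [sq]; exact h)

/-- The square roots of the photon number probabilities. -/
def diagRoot (ρ : Fock M →L[ℂ] Fock M) (p : M → ℕ) : ℝ := √(numberMatrix ρ p p).re

theorem diagRoot_nonneg (p : M → ℕ) : 0 ≤ diagRoot ρ p := Real.sqrt_nonneg _

theorem IsState.numberMatrix_diag (hρ : IsState ρ) (p : M → ℕ) :
    numberMatrix ρ p p = ((diagRoot ρ p ^ 2 : ℝ) : ℂ) := by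
  have h : 0 ≤ (numberMatrix ρ p p).re := hρ.1.re_inner_nonneg_right (numberState p)
  rw [diagRoot, Real.sq_sqrt h]
  exact (Complex.conj_eq_iff_re.1 (hρ.conj_numberMatrix p p)).symm

theorem IsState.norm_numberMatrix_le (hρ : IsState ρ) (p q : M → ℕ) :
    ‖numberMatrix ρ p q‖ ≤ diagRoot ρ p * diagRoot ρ q :=
  norm_inner_le_of_isPositive hρ.1 _ _

theorem IsState.hasSum_diagRoot_sq (hρ : IsState ρ) : HasSum (fun p => diagRoot ρ p ^ 2) 1 := by
  have h : HasSum (fun p => numberMatrix ρ p p) 1 := hρ.2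
  simp only [hρ.numberMatrix_diag] at h
  exact Complex.hasSum_ofReal.1 (by simpa only [ofReal_one] using h)

end States

/-! ### Convergence of the Bargmann kernel -/

section Kernel

/-- The multi-exponential weights `x ^ p / p!`. -/
def expWeight (x : Fin 2 → ℝ) (p : Fin 2 → ℕ) : ℝ := (∏ j, x j ^ p j) / multiFact p

theorem expWeight_nonneg {x : Fin 2 → ℝ} (hx : ∀ j, 0 ≤ x j) (p : Fin 2 → ℕ) :
    0 ≤ expWeight x p :=
  div_nonneg (Finset.prod_nonneg fun j _ => pow_nonneg (hx j) _) (Nat.cast_nonneg _)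

theorem hasSum_mul_of_nonneg {α β : Type*} {f : α → ℝ} {g : β → ℝ} {a b : ℝ} (hf : HasSum f a)
    (hg : HasSum g b) (hf0 : ∀ x, 0 ≤ f x) (hg0 : ∀ y, 0 ≤ g y) :
    HasSum (fun x : α × β => f x.1 * g x.2) (a * b) :=
  hf.mul hg (hf.summable.mul_of_nonneg hg.summable hf0 hg0)

theorem hasSum_expWeight {x : Fin 2 → ℝ} (hx : ∀ j, 0 ≤ x j) :
    HasSum (expWeight x) (Real.exp (∑ j, x j)) := by
  have h1 : ∀ j, HasSum (fun n : ℕ => x j ^ n / n !) (Real.exp (x j)) := fun j => by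
    have := NormedSpace.expSeries_div_hasSum_exp (x j)
    rwa [← Real.exp_eq_exp_ℝ] at this
  have h2 := hasSum_mul_of_nonneg (h1 0) (h1 1)
    (fun n => div_nonneg (pow_nonneg (hx 0) n) (by positivity))
    (fun n => div_nonneg (pow_nonneg (hx 1) n) (by positivity))
  rw [Fin.sum_univ_two, Real.exp_add, ← (finTwoArrowEquiv ℕ).symm.hasSum_iff]
  have he : expWeight x ∘ (finTwoArrowEquiv ℕ).symm =
      fun y : ℕ × ℕ => x 0 ^ y.1 / y.1 ! * (x 1 ^ y.2 / y.2 !) := by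
    funext y
    simp [expWeight, multiFact, div_mul_div_comm]
  rwa [he]

theorem sqrt_expWeight (z : Fin 2 → ℂ) (p : Fin 2 → ℕ) :
    √(expWeight (fun j => ‖z j‖ ^ 2) p) = ‖∏ j, z j ^ p j‖ / √(multiFact p : ℝ) := by
  rw [expWeight, Real.sqrt_div (Finset.prod_nonneg fun j _ => by positivity), norm_prod]
  congr 1
  rw [Real.sqrt_eq_iff_mul_self_eq (Finset.prod_nonneg fun j _ => by positivity)
    (Finset.prod_nonneg fun j _ => by positivity), ← Finset.prod_mul_distrib]
  refine Finset.prod_congr rfl fun j _ => ?_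
  rw [norm_pow]
  ring

/-- The pairs of multi-indices on `Fin 2`, as multi-indices on `Fin 2 ⊕ Fin 2`. -/
def pairEquiv : (Fin 2 → ℕ) × (Fin 2 → ℕ) ≃ (Fin 2 ⊕ Fin 2 →₀ ℕ) :=
  (Equiv.sumArrowEquivProdArrow (Fin 2) (Fin 2) ℕ).symm.trans Finsupp.equivFunOnFinite.symm

theorem pairEquiv_apply (x : (Fin 2 → ℕ) × (Fin 2 → ℕ)) : pairEquiv x = pairIndex x.1 x.2 := rfl

theorem summable_mul_sqrt_expWeight {d : (Fin 2 → ℕ) → ℝ} (hd0 : ∀ p, 0 ≤ d p)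
    (hd : Summable fun p => d p ^ 2) {x : Fin 2 → ℝ} (hx : ∀ j, 0 ≤ x j) :
    Summable fun p => d p * √(expWeight x p) := by
  refine Summable.of_nonneg_of_le (fun p => mul_nonneg (hd0 p) (Real.sqrt_nonneg _)) (fun p => ?_)
    (hd.add (hasSum_expWeight hx).summable)
  have h1 := Real.sq_sqrt (expWeight_nonneg hx p)
  have h2 := hd0 p
  have h3 := Real.sqrt_nonneg (expWeight x p)
  nlinarith [sq_nonneg (d p - √(expWeight x p)), mul_nonneg h2 h3]

variable {A : Matrix (Fin 2 → ℕ) (Fin 2 → ℕ) ℂ} {d : (Fin 2 → ℕ) → ℝ}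

theorem norm_kernel_term_le (hA : ∀ p q, ‖A p q‖ ≤ d p * d q) (u : Fin 2 ⊕ Fin 2 → ℂ)
    (x : (Fin 2 → ℕ) × (Fin 2 → ℕ)) :
    ‖kernelCoeff A (pairIndex x.1 x.2) * ∏ s, u s ^ pairIndex x.1 x.2 s‖ ≤
      (d x.1 * √(expWeight (fun j => ‖u (Sum.inl j)‖ ^ 2) x.1)) *
        (d x.2 * √(expWeight (fun j => ‖u (Sum.inr j)‖ ^ 2) x.2)) := by
  have h := hA x.1 x.2
  rw [sqrt_expWeight, sqrt_expWeight, kernelCoeff_pairIndex, Fintype.prod_sum_type]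
  simp only [pairIndex_inl, pairIndex_inr, norm_mul, norm_div, norm_real, Real.norm_eq_abs,
    abs_of_nonneg (Real.sqrt_nonneg _)]
  calc _ = ‖A x.1 x.2‖ * (‖∏ j, u (Sum.inl j) ^ x.1 j‖ / √(multiFact x.1 : ℝ) *
        (‖∏ j, u (Sum.inr j) ^ x.2 j‖ / √(multiFact x.2 : ℝ))) := by
        rw [div_mul_div_comm]
        ring
    _ ≤ (d x.1 * d x.2) * (‖∏ j, u (Sum.inl j) ^ x.1 j‖ / √(multiFact x.1 : ℝ) *
        (‖∏ j, u (Sum.inr j) ^ x.2 j‖ / √(multiFact x.2 : ℝ))) :=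
        mul_le_mul_of_nonneg_right h (by positivity)
    _ = _ := by ring

theorem summable_norm_kernel (hA : ∀ p q, ‖A p q‖ ≤ d p * d q) (hd0 : ∀ p, 0 ≤ d p)
    (hd : Summable fun p => d p ^ 2) (u : Fin 2 ⊕ Fin 2 → ℂ) :
    Summable fun v => ‖kernelCoeff A v * ∏ s, u s ^ v s‖ := by
  rw [← pairEquiv.summable_iff]
  have h1 := fun x hx => summable_mul_sqrt_expWeight (x := x) hd0 hd hx
  refine Summable.of_nonneg_of_le (fun _ => norm_nonneg _) (norm_kernel_term_le hA u)
    ((h1 (fun j => ‖u (Sum.inl j)‖ ^ 2) fun j => by positivity).mul_of_nonneg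
      (h1 (fun j => ‖u (Sum.inr j)‖ ^ 2) fun j => by positivity) ?_ ?_)
  · exact fun p => mul_nonneg (hd0 p) (Real.sqrt_nonneg _)
  · exact fun p => mul_nonneg (hd0 p) (Real.sqrt_nonneg _)

/-- The argument `(z̄, z)` of the Bargmann kernel. -/
def diagArg (z : Fin 2 → ℂ) : Fin 2 ⊕ Fin 2 → ℂ :=
  Sum.elim (fun j => (starRingEnd ℂ) (z j)) z

theorem norm_kernel_diag_le (hA : ∀ p q, ‖A p q‖ ≤ d p * d q) (hd0 : ∀ p, 0 ≤ d p)
    (hd : Summable fun p => d p ^ 2) (z : Fin 2 → ℂ) {a : ℂ}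
    (ha : HasSum (fun v => kernelCoeff A v * ∏ s, diagArg z s ^ v s) a) :
    ‖a‖ ≤ (∑' p, d p * √(expWeight (fun j => ‖z j‖ ^ 2) p)) ^ 2 := by
  rw [← pairEquiv.hasSum_iff] at ha
  have h1 := summable_mul_sqrt_expWeight (x := fun j => ‖z j‖ ^ 2) hd0 hd fun j => by positivity
  have h2 := hasSum_mul_of_nonneg h1.hasSum h1.hasSum
    (fun p => mul_nonneg (hd0 p) (Real.sqrt_nonneg _))
    (fun p => mul_nonneg (hd0 p) (Real.sqrt_nonneg _))
  rw [sq]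
  refine (ha.norm_le_of_bounded h2 fun x => ?_)
  have := norm_kernel_term_le hA (diagArg z) x
  simpa [diagArg, pairEquiv_apply] using this

end Kernel

/-! ### Exponential decay of the photon number distribution -/

section Decay

open Filter Topology MeasureTheory

/-- A square summable sequence has vanishing overlap with the Poisson amplitudes of a coherent
state whose amplitude tends to infinity. -/
theorem exists_poisson_overlap_lt {d : (Fin 2 → ℕ) → ℝ} (hd0 : ∀ p, 0 ≤ d p)
    (hd : Summable fun p => d p ^ 2) {x : Fin 2 → ℝ} (hx : ∀ j, 0 ≤ x j) (hpos : 0 < ∑ j, x j)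
    {δ : ℝ} (hδ : 0 < δ) :
    ∃ t : ℝ, 0 < t ∧
      Real.exp (-(∑ j, x j) * t / 2) * ∑' p, d p * √(expWeight (fun j => t * x j) p) < δ := by
  set b := ∑ j, x j with hb
  set ε := δ / 2 with hε
  have hε0 : 0 < ε := by positivity
  obtain ⟨T, hT⟩ : ∃ T : Finset (Fin 2 → ℕ), ∑' p : {p // p ∉ T}, d p ^ 2 < ε ^ 2 :=
    ((tendsto_tsum_compl_atTop_zero fun p => d p ^ 2).eventually_lt_const (by positivity)).exists
  have hlim : Tendsto (fun t : ℝ => ∑ p ∈ T,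
      d p * (√(t ^ ((∑ j, p j : ℕ) : ℝ) * Real.exp (-b * t)) * √(expWeight x p))) atTop (𝓝 0) := by
    rw [← Finset.sum_const_zero (s := T)]
    refine tendsto_finsetSum _ fun p _ => ?_
    have h1 := (tendsto_rpow_mul_exp_neg_mul_atTop_nhds_zero ((∑ j, p j : ℕ) : ℝ) b hpos).sqrt
    have h2 := (h1.mul_const (√(expWeight x p))).const_mul (d p)
    simpa using h2
  obtain ⟨t, ht, ht0⟩ := ((hlim.eventually_lt_const hε0).and (eventually_gt_atTop 0)).exists
  refine ⟨t, ht0, ?_⟩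
  have htx : ∀ j, 0 ≤ t * x j := fun j => mul_nonneg ht0.le (hx j)
  set w := expWeight fun j => t * x j with hw
  have hw0 : ∀ p, 0 ≤ w p := expWeight_nonneg htx
  have hws : HasSum w (Real.exp (t * b)) := by
    have := hasSum_expWeight htx
    rwa [← Finset.mul_sum] at this
  set E := Real.exp (-b * t / 2) with hE
  have hE0 : 0 < E := Real.exp_pos _
  have hEE : E * E * Real.exp (t * b) = 1 := by
    rw [hE, ← Real.exp_add, ← Real.exp_add, ← Real.exp_zero]
    congr 1
    ring
  have hsum := summable_mul_sqrt_expWeight hd0 hd htx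
  rw [← hsum.sum_add_tsum_subtype_compl T, mul_add]
  have h1 : E * ∑ p ∈ T, d p * √(w p) < ε := by
    refine lt_of_eq_of_lt ?_ ht
    rw [Finset.mul_sum]
    refine Finset.sum_congr rfl fun p _ => ?_
    have e1 : w p = t ^ (∑ j, p j) * expWeight x p := by
      rw [hw, expWeight, expWeight, ← Finset.prod_pow_eq_pow_sum, mul_div_assoc',
        ← Finset.prod_mul_distrib]
      simp only [mul_pow]
    have e2 : E = √(Real.exp (-b * t)) := by
      rw [hE, eq_comm, Real.sqrt_eq_iff_mul_self_eq (Real.exp_pos _).le (Real.exp_pos _).le,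
        ← Real.exp_add]
      congr 1
      ring
    rw [e1, e2, Real.rpow_natCast, Real.sqrt_mul (by positivity), Real.sqrt_mul (by positivity)]
    ring
  have h2 : E * ∑' p : {p // p ∉ T}, d p * √(w p) ≤ ε := by
    -- The inequality of arithmetic and geometric means, weighted by `ε E`.
    have hle : ∀ p : {p // p ∉ T}, d p * √(w p) ≤
        (1 / (2 * ε * E)) * d p ^ 2 + (ε * E / 2) * w p := by
      intro p
      obtain ⟨r, hr⟩ : ∃ r, r = √(w p) := ⟨_, rfl⟩
      have e1 : r ^ 2 = w p := by rw [hr, Real.sq_sqrt (hw0 p)]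
      rw [← hr, ← e1]
      have e2 : (1 / (2 * ε * E)) * d p ^ 2 + (ε * E / 2) * r ^ 2 - d p * r =
          (1 / (2 * ε * E)) * (d p - ε * E * r) ^ 2 := by
        field_simp
        ring
      have : 0 ≤ (1 / (2 * ε * E)) * (d p - ε * E * r) ^ 2 := by positivity
      linarith
    have s1 : Summable fun p : {p // p ∉ T} => d p ^ 2 := hd.subtype _
    have s2 : Summable fun p : {p // p ∉ T} => w p := hws.summable.subtype _
    have hle2 : ∑' p : {p // p ∉ T}, w p ≤ Real.exp (t * b) := by
      rw [← hws.tsum_eq, ← hws.summable.sum_add_tsum_subtype_compl T]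
      exact le_add_of_nonneg_left (Finset.sum_nonneg fun p _ => hw0 p)
    have s3 : Summable fun p : {p // p ∉ T} => d p * √(w p) := hsum.subtype _
    have hb1 := s3.tsum_le_tsum hle
      ((s1.mul_left (1 / (2 * ε * E))).add (s2.mul_left (ε * E / 2)))
    rw [Summable.tsum_add (s1.mul_left _) (s2.mul_left _), tsum_mul_left, tsum_mul_left] at hb1
    calc _ ≤ E * (1 / (2 * ε * E) * ε ^ 2 + ε * E / 2 * Real.exp (t * b)) := by
          refine mul_le_mul_of_nonneg_left (hb1.trans ?_) hE0.le
          gcongr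
      _ = ε / 2 + ε / 2 * (E * E * Real.exp (t * b)) := by field_simp
      _ = ε := by rw [hEE]; ring
  have h3 : ε + ε = δ := by rw [hε]; ring
  rw [← h3]
  exact add_lt_add_of_lt_of_le h1 h2

/-- A continuous real quadratic function strictly below the square norm is so uniformly. -/
theorem exists_forall_le_mul_sq_norm {N : (Fin 2 → ℂ) → ℝ} (hN : Continuous N)
    (hhom : ∀ (t : ℝ) z, N ((t : ℂ) • z) = t ^ 2 * N z)
    (hlt : ∀ z, z ≠ 0 → N z < ∑ j, ‖z j‖ ^ 2) :
    ∃ η : ℝ, 0 < η ∧ η < 1 ∧ ∀ z, N z ≤ η * ∑ j, ‖z j‖ ^ 2 := by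
  have hq : ∀ z : Fin 2 → ℂ, z ≠ 0 → 0 < ∑ j, ‖z j‖ ^ 2 := by
    intro z hz
    obtain ⟨j, hj⟩ := Function.ne_iff.1 hz
    exact Finset.sum_pos' (fun j _ => by positivity)
      ⟨j, Finset.mem_univ j, by have := norm_pos_iff.2 hj; positivity⟩
  have hs0 : ∀ z ∈ Metric.sphere (0 : Fin 2 → ℂ) 1, z ≠ 0 := by
    rintro z hz rfl
    simp at hz
  have hcont : ContinuousOn (fun z : Fin 2 → ℂ => N z / ∑ j, ‖z j‖ ^ 2) (Metric.sphere 0 1) :=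
    hN.continuousOn.div (by fun_prop) fun z hz => (hq z (hs0 z hz)).ne'
  obtain ⟨z₀, hz₀, hmax⟩ := (isCompact_sphere (0 : Fin 2 → ℂ) 1).exists_isMaxOn
    ⟨fun _ => 1, by simp [pi_norm_const]⟩ hcont
  -- The maximum with `1 / 2` keeps `η` positive.
  refine ⟨max (N z₀ / ∑ j, ‖z₀ j‖ ^ 2) (1 / 2), lt_max_of_lt_right (by norm_num),
    max_lt ((div_lt_one (hq _ (hs0 _ hz₀))).2 (hlt _ (hs0 _ hz₀))) (by norm_num), fun z => ?_⟩
  rcases eq_or_ne z 0 with rfl | hz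
  · have h0 := hhom 0 0
    rw [smul_zero] at h0
    have h1 : N 0 = 0 := by linear_combination h0
    simp [h1]
  have hn : 0 < ‖z‖ := norm_pos_iff.2 hz
  set z' : Fin 2 → ℂ := ((‖z‖⁻¹ : ℝ) : ℂ) • z with hz'
  have hmem : z' ∈ Metric.sphere (0 : Fin 2 → ℂ) 1 := by
    rw [mem_sphere_zero_iff_norm, hz', norm_smul, norm_real, norm_inv, norm_norm,
      inv_mul_cancel₀ hn.ne']
  have h1 := isMaxOn_iff.1 hmax z' hmem
  have h2 : N z' / ∑ j, ‖z' j‖ ^ 2 = N z / ∑ j, ‖z j‖ ^ 2 := by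
    have : ∑ j, ‖z' j‖ ^ 2 = ‖z‖⁻¹ ^ 2 * ∑ j, ‖z j‖ ^ 2 := by
      rw [Finset.mul_sum]
      refine Finset.sum_congr rfl fun j _ => ?_
      rw [hz', Pi.smul_apply, smul_eq_mul, norm_mul, norm_real, norm_inv, norm_norm, mul_pow]
    rw [this, hz', hhom, mul_div_mul_left]
    positivity
  rw [h2] at h1
  rw [← div_le_iff₀ (hq z hz)]
  exact h1.trans (le_max_left _ _)

/-- The uniform distribution of the phases of two modes. -/
abbrev torusMeasure : Measure (Fin 2 → AddCircle (1 : ℝ)) :=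
  Measure.pi fun _ => AddCircle.haarAddCircle

theorem integral_fourier_haar (n : ℤ) :
    ∫ θ : AddCircle (1 : ℝ), fourier n θ ∂AddCircle.haarAddCircle = if n = 0 then 1 else 0 := by
  split_ifs with h
  · simp [h]
  · exact integral_eq_zero_of_add_right_eq_neg (μ := AddCircle.haarAddCircle)
      (fourier_add_half_inv_index h one_pos)

/-- Averaging the Bargmann kernel over the phases of `z` leaves the diagonal terms. -/
theorem sq_mul_expWeight_le {A : Matrix (Fin 2 → ℕ) (Fin 2 → ℕ) ℂ} {d : (Fin 2 → ℕ) → ℝ}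
    (hA : ∀ p q, ‖A p q‖ ≤ d p * d q) (hdiag : ∀ p, A p p = ((d p ^ 2 : ℝ) : ℂ))
    (hd0 : ∀ p, 0 ≤ d p) (hd : Summable fun p => d p ^ 2) {B η : ℝ}
    (hF : ∀ z, ‖∑' v, kernelCoeff A v * ∏ s, diagArg z s ^ v s‖ ≤ B * Real.exp (η * ∑ j, ‖z j‖ ^ 2))
    {x : Fin 2 → ℝ} (hx : ∀ j, 0 ≤ x j) (p : Fin 2 → ℕ) :
    d p ^ 2 * expWeight x p ≤ B * Real.exp (η * ∑ j, x j) := by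
  set z : (Fin 2 → AddCircle (1 : ℝ)) → Fin 2 → ℂ := fun θ j => ((√(x j) : ℝ) : ℂ) * fourier 1 (θ j)
    with hz
  have hzn : ∀ θ j, ‖z θ j‖ = √(x j) := by
    intro θ j
    rw [hz, norm_mul, norm_real, Real.norm_eq_abs, abs_of_nonneg (Real.sqrt_nonneg _), fourier_apply,
      Circle.norm_coe, mul_one]
  set F : (Fin 2 ⊕ Fin 2 →₀ ℕ) → (Fin 2 → AddCircle (1 : ℝ)) → ℂ :=
    fun v θ => kernelCoeff A v * ∏ s, diagArg (z θ) s ^ v s with hFdef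
  have hzcont : ∀ s, Continuous fun θ => diagArg (z θ) s := by
    rintro (j | j)
    · simp only [diagArg, Sum.elim_inl, hz]
      fun_prop
    · simp only [diagArg, Sum.elim_inr, hz]
      fun_prop
  have hcont : ∀ v, Continuous (F v) := fun v => by
    have : ∀ s, Continuous fun θ => diagArg (z θ) s ^ v s := fun s => (hzcont s).pow _
    exact continuous_const.mul (continuous_finsetProd _ fun s _ => this s)
  have hnorm : ∀ v θ, ‖F v θ‖ = ‖F v 0‖ := by
    intro v θ
    have : ∀ θ s, ‖diagArg (z θ) s‖ = Sum.elim (fun j => √(x j)) (fun j => √(x j)) s := by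
      rintro θ (j | j) <;> simp [diagArg, hzn]
    simp only [hFdef, norm_mul, norm_prod, norm_pow, this]
  have hint := hasSum_integral_of_summable_integral_norm (μ := torusMeasure) (F := F)
    (fun v => (hcont v).integrable_of_hasCompactSupport (HasCompactSupport.of_compactSpace _)) (by
      simp only [hnorm, integral_const, smul_eq_mul, probReal_univ, one_mul]
      exact summable_norm_kernel hA hd0 hd _)
  have hval : ∀ a b, ∫ θ, F (pairIndex a b) θ ∂torusMeasure =
      ((if a = b then d a ^ 2 * expWeight x a else 0 : ℝ) : ℂ) := by
    intro a b
    have e1 : ∀ θ, F (pairIndex a b) θ = kernelCoeff A (pairIndex a b) *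
        ((∏ j, ((√(x j) : ℝ) : ℂ) ^ (a j + b j)) * ∏ j, fourier ((b j : ℤ) - a j) (θ j)) := by
      intro θ
      have hf : ∀ (n : ℕ) (y : AddCircle (1 : ℝ)), (fourier 1 y) ^ n = fourier n y := by
        intro n y
        rw [fourier_apply, fourier_apply, one_smul, natCast_zsmul, AddCircle.toCircle_nsmul,
          Circle.coe_pow]
      have hf' : ∀ (n : ℕ) (y : AddCircle (1 : ℝ)),
          ((starRingEnd ℂ) (fourier 1 y)) ^ n = fourier (-n) y := by
        intro n y
        rw [← map_pow, hf, fourier_neg]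
      simp only [hFdef]
      rw [Fintype.prod_sum_type, ← Finset.prod_mul_distrib, ← Finset.prod_mul_distrib]
      congr 1
      refine Finset.prod_congr rfl fun j _ => ?_
      simp only [diagArg, Sum.elim_inl, Sum.elim_inr, pairIndex_inl, pairIndex_inr, hz, map_mul,
        conj_ofReal, mul_pow, hf, hf']
      rw [show ((b j : ℤ) - a j) = -a j + b j by ring, fourier_add, pow_add]
      ring
    simp only [e1]
    rw [integral_const_mul, integral_const_mul, integral_fintype_prod_eq_prod]
    simp only [integral_fourier_haar]
    split_ifs with hab
    · subst hab
      simp only [sub_self, if_true, Finset.prod_const_one, mul_one, kernelCoeff_pairIndex, hdiag]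
      rw [← ofReal_mul, Real.mul_self_sqrt (Nat.cast_nonneg _), expWeight]
      have : ∀ j, ((√(x j) : ℝ) : ℂ) ^ (a j + a j) = ((x j ^ a j : ℝ) : ℂ) := by
        intro j
        rw [← ofReal_pow, ← two_mul, pow_mul, Real.sq_sqrt (hx j)]
      simp only [this]
      push_cast
      ring
    · obtain ⟨j, hj⟩ := Function.ne_iff.1 hab
      have h0 : ∏ j, (if (b j : ℤ) - a j = 0 then (1 : ℂ) else 0) = 0 :=
        Finset.prod_eq_zero (Finset.mem_univ j) (if_neg (by omega))
      rw [h0, mul_zero, mul_zero, ofReal_zero]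
  rw [← pairEquiv.hasSum_iff] at hint
  have hfun : ((fun v => ∫ θ, F v θ ∂torusMeasure) ∘ pairEquiv) =
      fun y => ((if y.1 = y.2 then d y.1 ^ 2 * expWeight x y.1 else 0 : ℝ) : ℂ) := by
    funext y
    exact hval y.1 y.2
  rw [hfun] at hint
  have hre := Complex.hasSum_re hint
  simp only [ofReal_re] at hre
  have h1 := le_hasSum hre (p, p) fun y _ => by
    split_ifs
    · exact mul_nonneg (sq_nonneg _) (expWeight_nonneg hx _)
    · exact le_rfl
  rw [if_pos rfl] at h1
  refine h1.trans ((Complex.re_le_norm _).trans ?_)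
  refine (norm_integral_le_of_norm_le_const (C := B * Real.exp (η * ∑ j, x j))
    (Eventually.of_forall fun θ => ?_)).trans (by simp)
  have := hF (z θ)
  simpa only [hzn, Real.sq_sqrt (hx _)] using this

theorem factorial_mul_exp_le (n : ℕ) :
    (n ! : ℝ) * Real.exp n ≤ Real.exp 1 * (n + 1) * (n : ℝ) ^ n := by
  rcases Nat.eq_zero_or_pos n with rfl | hn
  · simp
  suffices h : ∀ n : ℕ, ((n + 1)! : ℝ) * Real.exp (n + 1 : ℕ) ≤
      Real.exp 1 * ((n + 1 : ℕ) : ℝ) ^ (n + 2) by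
    obtain ⟨m, rfl⟩ : ∃ m, n = m + 1 := ⟨n - 1, by omega⟩
    refine (h m).trans ?_
    rw [pow_succ' _ (m + 1), mul_assoc]
    gcongr
    linarith
  intro n
  induction n with
  | zero => simp
  | succ n ih =>
    have hexp : Real.exp 1 * ((n + 1 : ℕ) : ℝ) ^ (n + 2) ≤ ((n + 2 : ℕ) : ℝ) ^ (n + 2) := by
      have hp : (0 : ℝ) < (n + 1 : ℕ) := by positivity
      have h0 : (0 : ℝ) < (n + 2 : ℕ) := by positivity
      have h1 := Real.one_sub_inv_le_log_of_pos (x := ((n + 2 : ℕ) : ℝ) / (n + 1 : ℕ)) (by positivity)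
      have h2 : Real.exp 1 ≤ (((n + 2 : ℕ) : ℝ) / (n + 1 : ℕ)) ^ (n + 2) := by
        rw [← Real.exp_log (x := (((n + 2 : ℕ) : ℝ) / (n + 1 : ℕ)) ^ (n + 2)) (by positivity),
          Real.exp_le_exp, Real.log_pow]
        calc (1 : ℝ) = ((n + 2 : ℕ) : ℝ) * (1 - (((n + 2 : ℕ) : ℝ) / (n + 1 : ℕ))⁻¹) := by
              field_simp
              push_cast
              ring
          _ ≤ _ := mul_le_mul_of_nonneg_left h1 h0.le
      rw [div_pow, le_div_iff₀ (by positivity)] at h2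
      exact h2
    calc ((n + 1 + 1)! : ℝ) * Real.exp (n + 1 + 1 : ℕ)
        = ((n + 2 : ℕ) : ℝ) * Real.exp 1 * (((n + 1)! : ℝ) * Real.exp (n + 1 : ℕ)) := by
          rw [Nat.factorial_succ (n + 1), Nat.cast_succ (n + 1), Real.exp_add]
          push_cast
          ring
      _ ≤ ((n + 2 : ℕ) : ℝ) * Real.exp 1 * (Real.exp 1 * ((n + 1 : ℕ) : ℝ) ^ (n + 2)) := by gcongr
      _ ≤ ((n + 2 : ℕ) : ℝ) * Real.exp 1 * ((n + 2 : ℕ) : ℝ) ^ (n + 2) := by gcongr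
      _ = Real.exp 1 * ((n + 1 + 1 : ℕ) : ℝ) ^ (n + 1 + 2) := by ring

/-- A bound of Gaussian type on the generating function makes the sequence decay exponentially:
take `x = p / η`. -/
theorem exists_decay {d : (Fin 2 → ℕ) → ℝ} {B η : ℝ} (hB : 0 ≤ B) (hη : 0 < η)
    (hη1 : η < 1)
    (h : ∀ x : Fin 2 → ℝ, (∀ j, 0 ≤ x j) → ∀ p,
      d p ^ 2 * expWeight x p ≤ B * Real.exp (η * ∑ j, x j)) :
    ∃ C s : ℝ, 0 ≤ C ∧ 0 < s ∧ s < 1 ∧ ∀ p, d p ≤ C * s ^ (∑ j, p j) := by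
  set a := (1 - η) / (2 * η) with ha
  have ha0 : 0 < a := div_pos (by linarith) (by linarith)
  set s := (1 + η) / 2 with hs
  have hs0 : 0 < s := by positivity
  have hsa : (1 + a) * η = s := by rw [ha, hs]; field_simp; ring
  set D := Real.exp 1 * (1 + 1 / a) with hD
  have hD0 : 0 ≤ D := by positivity
  have hone : ∀ n : ℕ, (n ! : ℝ) * Real.exp n * η ^ n ≤ D * s ^ n * (n : ℝ) ^ n := by
    intro n
    have h1 : (n + 1 : ℝ) ≤ (1 + 1 / a) * (1 + a) ^ n := by
      have h2 := one_add_mul_le_pow (a := a) (by linarith) n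
      calc (n + 1 : ℝ) ≤ (1 + 1 / a) * (1 + n * a) := by
            have : (1 + 1 / a) * (1 + n * a) = n + 1 + (1 / a + n * a) := by
              field_simp
              ring
            rw [this]
            have : 0 ≤ 1 / a + n * a := by positivity
            linarith
        _ ≤ _ := mul_le_mul_of_nonneg_left h2 (by positivity)
    calc (n ! : ℝ) * Real.exp n * η ^ n ≤ Real.exp 1 * (n + 1) * (n : ℝ) ^ n * η ^ n := by
          have := factorial_mul_exp_le n
          gcongr
      _ ≤ Real.exp 1 * ((1 + 1 / a) * (1 + a) ^ n) * (n : ℝ) ^ n * η ^ n := by gcongr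
      _ = D * s ^ n * (n : ℝ) ^ n := by rw [← hsa, hD, mul_pow]; ring
  have hmain : ∀ p, d p ^ 2 ≤ B * D ^ 2 * s ^ (∑ j, p j) := by
    intro p
    have h1 := h (fun j => p j / η) (fun j => by positivity) p
    have e1 : η * ∑ j, (p j : ℝ) / η = ∑ j, (p j : ℝ) := by
      rw [Finset.mul_sum]
      refine Finset.sum_congr rfl fun j _ => ?_
      field_simp
    rw [e1, expWeight] at h1
    simp only [Fin.sum_univ_two, Fin.prod_univ_two, multiFact, Nat.cast_mul, div_pow,
      Real.exp_add] at h1 ⊢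
    have hp : ∀ n : ℕ, (0 : ℝ) < (n : ℝ) ^ n := by
      intro n
      rcases Nat.eq_zero_or_pos n with rfl | hn
      · simp
      · positivity
    have hn0 := hp (p 0)
    have hn1 := hp (p 1)
    have hf0 : (0 : ℝ) < ((p 0)! : ℝ) := by positivity
    have hf1 : (0 : ℝ) < ((p 1)! : ℝ) := by positivity
    have h2 : d p ^ 2 * ((p 0 : ℝ) ^ p 0 * (p 1 : ℝ) ^ p 1) ≤
        B * (((p 0)! : ℝ) * Real.exp (p 0) * η ^ p 0 * (((p 1)! : ℝ) * Real.exp (p 1) * η ^ p 1)) := by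
      have hpos : 0 < ((p 0)! : ℝ) * ((p 1)! : ℝ) * (η ^ p 0 * η ^ p 1) := by positivity
      have h3 := mul_le_mul_of_nonneg_right h1 hpos.le
      refine le_of_eq_of_le ?_ (h3.trans_eq ?_)
      · field_simp
      · ring
    have h4 : d p ^ 2 * ((p 0 : ℝ) ^ p 0 * (p 1 : ℝ) ^ p 1) ≤
        B * (D * s ^ p 0 * (p 0 : ℝ) ^ p 0 * (D * s ^ p 1 * (p 1 : ℝ) ^ p 1)) := by
      refine h2.trans (mul_le_mul_of_nonneg_left ?_ hB)
      exact mul_le_mul (hone _) (hone _) (by positivity) (by positivity)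
    refine le_of_mul_le_mul_right (h4.trans_eq ?_) (mul_pos hn0 hn1)
    ring
  refine ⟨√B * D, √s, by positivity, Real.sqrt_pos.2 hs0,
    (Real.sqrt_lt' one_pos).2 (by rw [hs]; linarith), fun p => ?_⟩
  refine abs_le_of_sq_le_sq' ?_ (by positivity) |>.2
  rw [mul_pow, mul_pow, Real.sq_sqrt hB, ← pow_mul, mul_comm _ 2, pow_mul, Real.sq_sqrt hs0.le]
  exact hmain p

end Decay

/-! ### Fixed points of the iteration -/

section FixedPoint

/-- The properties of the matrix `A` of a Gaussian state without first moments in the number basis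
that determine the characteristic function: the matrix is odd-even graded, decays exponentially, and
its Bargmann kernel `F` satisfies `∂F/∂w̄ = (α w̄ + β z) F` and the conjugate equation. Here
`1 - β` and `α` are the blocks of the quadratic form of the Husimi function, and `nondeg` says that
this form is definite. -/
structure IsGaussianMatrix (A : Matrix (Fin 2 → ℕ) (Fin 2 → ℕ) ℂ) (α β : Matrix (Fin 2) (Fin 2) ℂ) :
    Prop where
  eq_zero_of_odd : ∀ p q, Odd (∑ j, p j + ∑ j, q j) → A p q = 0
  decay : ∃ C s : ℝ, 0 ≤ C ∧ 0 < s ∧ s < 1 ∧ ∀ p q, ‖A p q‖ ≤ C * s ^ (∑ j, p j) * s ^ (∑ j, q j)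
  row : ∀ p q j, ((√(p j + 1 : ℝ) : ℝ) : ℂ) * A (p + Pi.single j 1) q =
    ∑ k, α j k * (((√(p k : ℝ) : ℝ) : ℂ) * A (p - Pi.single k 1) q) +
      ∑ k, β j k * (((√(q k : ℝ) : ℝ) : ℂ) * A p (q - Pi.single k 1))
  col : ∀ p q j, ((√(q j + 1 : ℝ) : ℝ) : ℂ) * A p (q + Pi.single j 1) =
    ∑ k, (starRingEnd ℂ) (β j k) * (((√(p k : ℝ) : ℝ) : ℂ) * A (p - Pi.single k 1) q) +
      ∑ k, (starRingEnd ℂ) (α j k) * (((√(q k : ℝ) : ℝ) : ℂ) * A p (q - Pi.single k 1))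
  nondeg : ∀ z : Fin 2 → ℂ,
    (∀ j, z j = ∑ k, α j k * (starRingEnd ℂ) (z k) + ∑ k, β j k * z k) → z = 0

theorem pairIndex_add_inl (p q : Fin 2 → ℕ) (j : Fin 2) :
    pairIndex p q + Finsupp.single (Sum.inl j) 1 = pairIndex (p + Pi.single j 1) q := by
  ext (k | k) <;> simp [Finsupp.single_apply, Pi.single_apply, eq_comm]

theorem pairIndex_add_inr (p q : Fin 2 → ℕ) (j : Fin 2) :
    pairIndex p q + Finsupp.single (Sum.inr j) 1 = pairIndex p (q + Pi.single j 1) := by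
  ext (k | k) <;> simp [Finsupp.single_apply, Pi.single_apply, eq_comm]

theorem pairIndex_sub_inl (p q : Fin 2 → ℕ) (j : Fin 2) :
    pairIndex p q - Finsupp.single (Sum.inl j) 1 = pairIndex (p - Pi.single j 1) q := by
  ext (k | k) <;> simp [Finsupp.single_apply, Pi.single_apply, eq_comm]

theorem pairIndex_sub_inr (p q : Fin 2 → ℕ) (j : Fin 2) :
    pairIndex p q - Finsupp.single (Sum.inr j) 1 = pairIndex p (q - Pi.single j 1) := by
  ext (k | k) <;> simp [Finsupp.single_apply, Pi.single_apply, eq_comm]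

theorem sqrt_multiFact_sub_single (p : Fin 2 → ℕ) {k : Fin 2} (hk : p k ≠ 0) :
    √(multiFact p : ℝ) = √(p k : ℝ) * √(multiFact (p - Pi.single k 1) : ℝ) := by
  obtain ⟨w, rfl⟩ : ∃ w : Fin 2 → ℕ, p = w + Pi.single k 1 := by
    refine ⟨p - Pi.single k 1, ?_⟩
    ext l
    by_cases hl : l = k
    · subst hl; simp; omega
    · simp [hl]
  rw [add_tsub_cancel_right, sqrt_multiFact_add_single]
  simp

variable {A : Matrix (Fin 2 → ℕ) (Fin 2 → ℕ) ℂ}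

theorem kernelCoeff_add_inl (p q : Fin 2 → ℕ) (j : Fin 2) :
    ((p j : ℂ) + 1) * kernelCoeff A (pairIndex (p + Pi.single j 1) q) *
      (((√(multiFact p : ℝ) : ℝ) : ℂ) * ((√(multiFact q : ℝ) : ℝ) : ℂ)) =
      ((√(p j + 1 : ℝ) : ℝ) : ℂ) * A (p + Pi.single j 1) q := by
  have h1 := sqrt_multiFact_ne_zero p
  have h2 := sqrt_multiFact_ne_zero q
  have h3 : ((√(p j + 1 : ℝ) : ℝ) : ℂ) ≠ 0 := by
    rw [ne_eq, ofReal_eq_zero]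
    positivity
  have h4 : ((√(p j + 1 : ℝ) : ℝ) : ℂ) * ((√(p j + 1 : ℝ) : ℝ) : ℂ) = p j + 1 := by
    rw [← ofReal_mul, Real.mul_self_sqrt (by positivity)]
    push_cast
    rfl
  rw [kernelCoeff_pairIndex, sqrt_multiFact_add_single, ← h4, ofReal_mul]
  field_simp

theorem kernelCoeff_add_inr (p q : Fin 2 → ℕ) (j : Fin 2) :
    ((q j : ℂ) + 1) * kernelCoeff A (pairIndex p (q + Pi.single j 1)) *
      (((√(multiFact p : ℝ) : ℝ) : ℂ) * ((√(multiFact q : ℝ) : ℝ) : ℂ)) =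
      ((√(q j + 1 : ℝ) : ℝ) : ℂ) * A p (q + Pi.single j 1) := by
  have h := kernelCoeff_add_inl (A := A.transpose) q p j
  rw [kernelCoeff_pairIndex] at h ⊢
  rw [Matrix.transpose_apply] at h
  rw [← h]
  ring

theorem kernelCoeff_sub_inl (p q : Fin 2 → ℕ) (k : Fin 2) :
    (if p k = 0 then 0 else kernelCoeff A (pairIndex (p - Pi.single k 1) q)) *
      (((√(multiFact p : ℝ) : ℝ) : ℂ) * ((√(multiFact q : ℝ) : ℝ) : ℂ)) =
      ((√(p k : ℝ) : ℝ) : ℂ) * A (p - Pi.single k 1) q := by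
  split_ifs with hk
  · simp [hk]
  · have h1 := sqrt_multiFact_ne_zero (p - Pi.single k 1)
    have h2 := sqrt_multiFact_ne_zero q
    rw [kernelCoeff_pairIndex, sqrt_multiFact_sub_single p hk, ofReal_mul]
    field_simp

theorem kernelCoeff_sub_inr (p q : Fin 2 → ℕ) (k : Fin 2) :
    (if q k = 0 then 0 else kernelCoeff A (pairIndex p (q - Pi.single k 1))) *
      (((√(multiFact p : ℝ) : ℝ) : ℂ) * ((√(multiFact q : ℝ) : ℝ) : ℂ)) =
      ((√(q k : ℝ) : ℝ) : ℂ) * A p (q - Pi.single k 1) := by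
  have h := kernelCoeff_sub_inl (A := A.transpose) q p k
  rw [kernelCoeff_pairIndex] at h ⊢
  rw [Matrix.transpose_apply] at h
  rw [← h]
  split_ifs <;> ring

variable {c r : ℂ}

theorem IsSelfSimilar.row (h : IsSelfSimilar (kernelCoeff A) c r) (hf : ∃ v, kernelCoeff A v ≠ 0)
    (hc : c ≠ 0) (hr : r ^ 2 = 1 / 2) (p q : Fin 2 → ℕ) (j : Fin 2) :
    ((√(p j + 1 : ℝ) : ℝ) : ℂ) * A (p + Pi.single j 1) q =
    ∑ k, quadMat (kernelCoeff A) c (Sum.inl j) (Sum.inl k) *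
        (((√(p k : ℝ) : ℝ) : ℂ) * A (p - Pi.single k 1) q) +
      ∑ k, quadMat (kernelCoeff A) c (Sum.inl j) (Sum.inr k) *
        (((√(q k : ℝ) : ℝ) : ℂ) * A p (q - Pi.single k 1)) := by
  have h1 := h.apply_add_single hf hc hr (pairIndex p q) (Sum.inl j)
  rw [pairIndex_add_inl, Fintype.sum_sum_type] at h1
  simp only [pairIndex_inl, pairIndex_inr, pairIndex_sub_inl, pairIndex_sub_inr] at h1
  rw [← kernelCoeff_add_inl, h1, add_mul, Finset.sum_mul, Finset.sum_mul]
  simp only [← kernelCoeff_sub_inl, ← kernelCoeff_sub_inr, mul_assoc]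

theorem IsSelfSimilar.col (h : IsSelfSimilar (kernelCoeff A) c r) (hf : ∃ v, kernelCoeff A v ≠ 0)
    (hc : c ≠ 0) (hr : r ^ 2 = 1 / 2) (p q : Fin 2 → ℕ) (j : Fin 2) :
    ((√(q j + 1 : ℝ) : ℝ) : ℂ) * A p (q + Pi.single j 1) =
    ∑ k, quadMat (kernelCoeff A) c (Sum.inr j) (Sum.inl k) *
        (((√(p k : ℝ) : ℝ) : ℂ) * A (p - Pi.single k 1) q) +
      ∑ k, quadMat (kernelCoeff A) c (Sum.inr j) (Sum.inr k) *
        (((√(q k : ℝ) : ℝ) : ℂ) * A p (q - Pi.single k 1)) := by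
  have h1 := h.apply_add_single hf hc hr (pairIndex p q) (Sum.inr j)
  rw [pairIndex_add_inr, Fintype.sum_sum_type] at h1
  simp only [pairIndex_inl, pairIndex_inr, pairIndex_sub_inl, pairIndex_sub_inr] at h1
  rw [← kernelCoeff_add_inr, h1, add_mul, Finset.sum_mul, Finset.sum_mul]
  simp only [← kernelCoeff_sub_inl, ← kernelCoeff_sub_inr, mul_assoc]

/-- Hermitian symmetry of the Bargmann kernel. -/
theorem conj_quadMat (hA : ∀ p q, (starRingEnd ℂ) (A p q) = A q p) (c : ℝ) (s t : Fin 2 ⊕ Fin 2) :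
    (starRingEnd ℂ) (quadMat (kernelCoeff A) c s t) =
      quadMat (kernelCoeff A) c s.swap t.swap := by
  have h1 : ∀ v w : Fin 2 ⊕ Fin 2 →₀ ℕ, (∀ s, w s.swap = v s) →
      (starRingEnd ℂ) (kernelCoeff A v) = kernelCoeff A w := by
    intro v w hvw
    have e1 : w ∘ Sum.inl = v ∘ Sum.inr := funext fun j => hvw (Sum.inr j)
    have e2 : w ∘ Sum.inr = v ∘ Sum.inl := funext fun j => hvw (Sum.inl j)
    rw [← pairIndex_comp v, ← pairIndex_comp w, kernelCoeff_pairIndex, kernelCoeff_pairIndex, e1, e2,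
      map_div₀, hA, map_mul, conj_ofReal, conj_ofReal, mul_comm (ofReal _)]
  have h2 : ∀ s t : Fin 2 ⊕ Fin 2, (Finsupp.single t.swap 1 : Fin 2 ⊕ Fin 2 →₀ ℕ) s.swap =
      Finsupp.single t 1 s := by
    intro s t
    simp only [Finsupp.single_apply, Sum.swap_leftInverse.injective.eq_iff]
  rw [quadMat, quadMat, map_mul, map_mul, conj_ofReal, map_natCast, h2,
    h1 _ (Finsupp.single t.swap 1 + Finsupp.single s.swap 1)]
  intro x
  rw [Finsupp.add_apply, Finsupp.add_apply, h2, h2]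

/-- The real part of the exponent of the Bargmann kernel at `(z̄, z)`. -/
def diagForm (A : Matrix (Fin 2 → ℕ) (Fin 2 → ℕ) ℂ) (c : ℂ) (z : Fin 2 → ℂ) : ℝ :=
  ((∑ s, ∑ t, quadMat (kernelCoeff A) c s t * (diagArg z s * diagArg z t)) / 2).re

theorem continuous_diagForm (c : ℂ) : Continuous (diagForm A c) := by
  have h : ∀ s, Continuous fun z : Fin 2 → ℂ => diagArg z s := by
    rintro (j | j)
    · simp only [diagArg, Sum.elim_inl]
      fun_prop
    · simp only [diagArg, Sum.elim_inr]
      fun_prop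
  unfold diagForm
  fun_prop

theorem diagForm_smul (c : ℂ) (t : ℝ) (z : Fin 2 → ℂ) :
    diagForm A c ((t : ℂ) • z) = t ^ 2 * diagForm A c z := by
  have h : ∀ s, diagArg ((t : ℂ) • z) s = t * diagArg z s := by
    rintro (j | j) <;> simp [diagArg]
  rw [diagForm, diagForm, ← re_ofReal_mul]
  congr 1
  simp only [h, mul_div_assoc', Finset.mul_sum]
  congr 1
  refine Finset.sum_congr rfl fun s _ => Finset.sum_congr rfl fun t _ => ?_
  push_cast
  ring

/-- A solution of the equation in `IsGaussianMatrix.nondeg` is a null vector of `|z|² - Re κ(z̄, z)`, by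
Euler's identity for the quadratic form `κ`. -/
theorem diagForm_eq_of_fixed (hA : ∀ p q, (starRingEnd ℂ) (A p q) = A q p) (c : ℝ) {z : Fin 2 → ℂ}
    (hz : ∀ j, z j = ∑ k, quadMat (kernelCoeff A) c (Sum.inl j) (Sum.inl k) * (starRingEnd ℂ) (z k) +
      ∑ k, quadMat (kernelCoeff A) c (Sum.inl j) (Sum.inr k) * z k) :
    diagForm A c z = ∑ j, ‖z j‖ ^ 2 := by
  set K := quadMat (kernelCoeff A) (c : ℂ) with hK
  set a := ∑ j, ∑ k, K (Sum.inl j) (Sum.inl k) * ((starRingEnd ℂ) (z j) * (starRingEnd ℂ) (z k))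
    with ha
  set b := ∑ j, ∑ k, K (Sum.inl j) (Sum.inr k) * ((starRingEnd ℂ) (z j) * z k) with hb
  have h1 : ((∑ j, ‖z j‖ ^ 2 : ℝ) : ℂ) = a + b := by
    rw [ha, hb, ← Finset.sum_add_distrib, ofReal_sum]
    refine Finset.sum_congr rfl fun j _ => ?_
    rw [ofReal_pow, ← conj_mul']
    conv_lhs => rw [hz j]
    conv_lhs => enter [1]; rw [← hz j]
    rw [mul_add, Finset.mul_sum, Finset.mul_sum]
    congr 1 <;> exact Finset.sum_congr rfl fun k _ => by ring
  have h2 : ∑ s, ∑ t, K s t * (diagArg z s * diagArg z t) =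
      a + b + (b + (starRingEnd ℂ) a) := by
    rw [Fintype.sum_sum_type]
    simp only [Fintype.sum_sum_type, diagArg, Sum.elim_inl, Sum.elim_inr, Finset.sum_add_distrib]
    congr 2
    · rw [hb, Finset.sum_comm]
      refine Finset.sum_congr rfl fun j _ => Finset.sum_congr rfl fun k _ => ?_
      rw [hK, quadMat_symm]
      ring
    · rw [ha]
      simp only [map_sum, map_mul, conj_conj]
      refine Finset.sum_congr rfl fun j _ => Finset.sum_congr rfl fun k _ => ?_
      rw [hK, conj_quadMat hA]
      rfl
  have h3 : (∑ j, ‖z j‖ ^ 2 : ℝ) = a.re + b.re := by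
    rw [← add_re, ← h1, ofReal_re]
  rw [diagForm, h2, h3]
  have : ∀ w : ℂ, (w / 2).re = w.re / 2 := fun w => by simp
  rw [this]
  simp only [add_re, conj_re]
  ring

/-- The Bargmann kernel of a fixed point makes the state a Gaussian one. Definiteness of the form
`|z|² - κ(z̄, z)` holds because the expectation values of a trace class operator in coherent states
tend to zero at infinity. -/
theorem exists_isGaussianMatrix {ρ : TwoMode →L[ℂ] TwoMode} (hρ : IsState ρ) {c : ℝ} (hc : 0 < c)
    (hfix : (c : ℂ) • iterationMap (tensorOp ρ ρ) = numberMatrix ρ) :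
    ∃ α β, IsGaussianMatrix (numberMatrix ρ) α β := by
  set A := numberMatrix ρ with hAdef
  have hconj : ∀ p q, (starRingEnd ℂ) (A p q) = A q p := hρ.conj_numberMatrix
  have hdiag : ∀ p, A p p = ((diagRoot ρ p ^ 2 : ℝ) : ℂ) := hρ.numberMatrix_diag
  have hnorm : ∀ p q, ‖A p q‖ ≤ diagRoot ρ p * diagRoot ρ q := hρ.norm_numberMatrix_le
  have hd0 : ∀ p, 0 ≤ diagRoot ρ p := diagRoot_nonneg
  have hd := hρ.hasSum_diagRoot_sq.summable
  have hc' : (c : ℂ) ≠ 0 := by exact_mod_cast hc.ne'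
  have hr : ((1 / √2 : ℝ) : ℂ) ^ 2 = 1 / 2 := by
    rw [← ofReal_pow, div_pow, Real.sq_sqrt (by norm_num)]
    norm_num
  have hss : IsSelfSimilar (kernelCoeff A) c ((1 / √2 : ℝ) : ℂ) := kernelCoeff_recursion hfix
  have hf : ∃ v, kernelCoeff A v ≠ 0 := by
    by_contra! hcon
    have : ∀ p, diagRoot ρ p ^ 2 = 0 := by
      intro p
      have h1 := hcon (pairIndex p p)
      rw [kernelCoeff_pairIndex, div_eq_zero_iff, hdiag, ofReal_eq_zero] at h1
      exact h1.resolve_right (mul_ne_zero (sqrt_multiFact_ne_zero _) (sqrt_multiFact_ne_zero _))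
    have h2 := hρ.hasSum_diagRoot_sq
    simp only [this] at h2
    exact zero_ne_one (hasSum_zero.unique h2)
  set N := diagForm A c with hN
  have hsum : ∀ z, ∃ a : ℂ, HasSum (fun v => kernelCoeff A v * ∏ s, diagArg z s ^ v s) a ∧
      ‖a‖ = c⁻¹ * Real.exp (N z) := by
    intro z
    refine ⟨_, hss.hasSum hf hc' hr _ (summable_norm_kernel hnorm hd0 hd _).of_norm, ?_⟩
    rw [norm_mul, norm_inv, norm_real, Real.norm_eq_abs, abs_of_pos hc, norm_exp]
    rfl
  have hlt : ∀ z, z ≠ 0 → N z < ∑ j, ‖z j‖ ^ 2 := by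
    intro z hz
    by_contra! hge
    have hpos : 0 < ∑ j, ‖z j‖ ^ 2 := by
      obtain ⟨j, hj⟩ := Function.ne_iff.1 hz
      exact Finset.sum_pos' (fun j _ => by positivity)
        ⟨j, Finset.mem_univ j, by have := norm_pos_iff.2 hj; positivity⟩
    obtain ⟨t, ht, hlt⟩ := exists_poisson_overlap_lt hd0 hd (x := fun j => ‖z j‖ ^ 2)
      (fun j => by positivity) hpos (δ := √(c⁻¹)) (by positivity)
    obtain ⟨a, ha, han⟩ := hsum (((√t : ℝ) : ℂ) • z)
    have h1 := norm_kernel_diag_le hnorm hd0 hd _ ha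
    have h2 : ∀ j, ‖(((√t : ℝ) : ℂ) • z) j‖ ^ 2 = t * ‖z j‖ ^ 2 := by
      intro j
      rw [Pi.smul_apply, smul_eq_mul, norm_mul, norm_real, Real.norm_eq_abs, mul_pow, sq_abs,
        Real.sq_sqrt ht.le]
    simp only [h2] at h1
    rw [han, hN, diagForm_smul, Real.sq_sqrt ht.le] at h1
    set S := ∑' p, diagRoot ρ p * √(expWeight (fun j => t * ‖z j‖ ^ 2) p)
    have hS : 0 ≤ S := tsum_nonneg fun p => mul_nonneg (hd0 p) (Real.sqrt_nonneg _)
    have h3 : (Real.exp (-(∑ j, ‖z j‖ ^ 2) * t / 2) * S) ^ 2 < c⁻¹ := by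
      have := pow_lt_pow_left₀ hlt (by positivity) two_ne_zero
      rwa [Real.sq_sqrt (by positivity)] at this
    have h4 : c⁻¹ ≤ (Real.exp (-(∑ j, ‖z j‖ ^ 2) * t / 2) * S) ^ 2 := by
      rw [mul_pow, ← Real.exp_nat_mul]
      calc c⁻¹ ≤ c⁻¹ * Real.exp (t * (N z - ∑ j, ‖z j‖ ^ 2)) :=
            le_mul_of_one_le_right (by positivity)
              (Real.one_le_exp (mul_nonneg ht.le (sub_nonneg.2 hge)))
        _ = Real.exp (((2 : ℕ) : ℝ) * (-(∑ j, ‖z j‖ ^ 2) * t / 2)) *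
            (c⁻¹ * Real.exp (t * N z)) := by
            rw [mul_left_comm, ← Real.exp_add]
            congr 2
            push_cast
            ring
        _ ≤ _ := mul_le_mul_of_nonneg_left h1 (Real.exp_pos _).le
    exact absurd h4 (not_le.2 h3)
  obtain ⟨η, hη0, hη1, hη⟩ := exists_forall_le_mul_sq_norm (continuous_diagForm (A := A) (c : ℂ))
    (diagForm_smul _) hlt
  obtain ⟨C, s, hC, hs0, hs1, hdecay⟩ := exists_decay (B := c⁻¹) (by positivity) hη0 hη1
    fun x hx p => sq_mul_expWeight_le hnorm hdiag hd0 hd (η := η) (fun z => by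
      obtain ⟨a, ha, han⟩ := hsum z
      rw [ha.tsum_eq, han]
      exact mul_le_mul_of_nonneg_left (Real.exp_le_exp.2 (hη z)) (by positivity)) hx p
  refine ⟨Matrix.of fun j k => quadMat (kernelCoeff A) c (Sum.inl j) (Sum.inl k),
    Matrix.of fun j k => quadMat (kernelCoeff A) c (Sum.inl j) (Sum.inr k), ?_, ?_, ?_, ?_, ?_⟩
  · intro p q hpq
    have h1 := hss.eq_zero_of_odd hf hc' hr (v := pairIndex p q) (by rwa [degree_pairIndex])
    rw [kernelCoeff_pairIndex, div_eq_zero_iff] at h1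
    exact h1.resolve_right (mul_ne_zero (sqrt_multiFact_ne_zero _) (sqrt_multiFact_ne_zero _))
  · refine ⟨C ^ 2, s, by positivity, hs0, hs1, fun p q => (hnorm p q).trans ?_⟩
    refine (mul_le_mul (hdecay p) (hdecay q) (hd0 q) (by positivity)).trans_eq ?_
    ring
  · exact fun p q j => hss.row hf hc' hr p q j
  · intro p q j
    simp only [Matrix.of_apply, conj_quadMat hconj, Sum.swap_inl, Sum.swap_inr]
    exact hss.col hf hc' hr p q j
  · intro z hz
    by_contra hne
    exact absurd (diagForm_eq_of_fixed hconj c hz) (hlt z hne).ne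

end FixedPoint

/-! ### Growth of polynomials in the creation and annihilation operators -/

section Growth

/-- The `ℓ¹` norm of the coefficients of a finite combination of number states. -/
def l1Norm (v : FinVec (Fin 2)) : ℝ := v.sum fun _ a => ‖a‖

/-- The span of the number states with at most `D` photons. -/
def photonLE (D : ℕ) : Submodule ℂ (FinVec (Fin 2)) :=
  Finsupp.supported ℂ ℂ {n | ∑ j, n j ≤ D}

theorem l1Norm_nonneg (v : FinVec (Fin 2)) : 0 ≤ l1Norm v :=
  Finset.sum_nonneg fun _ _ => norm_nonneg _

theorem l1Norm_ket (n : Fin 2 → ℕ) : l1Norm (ket n) = 1 := by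
  rw [l1Norm, ket, Finsupp.sum_single_index] <;> simp

theorem l1Norm_smul (a : ℂ) (v : FinVec (Fin 2)) : l1Norm (a • v) = ‖a‖ * l1Norm v := by
  rw [l1Norm, l1Norm, Finsupp.sum_smul_index' (by simp), Finsupp.mul_sum]
  simp only [smul_eq_mul, norm_mul]

theorem l1Norm_add_le (v w : FinVec (Fin 2)) : l1Norm (v + w) ≤ l1Norm v + l1Norm w := by
  classical
  have h := fun u : FinVec (Fin 2) => Finsupp.sum_of_support_subset u
    (s := v.support ∪ w.support ∪ (v + w).support) (g := fun _ a => ‖a‖)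
  rw [l1Norm, l1Norm, l1Norm, h v (by intro; simp +contextual) (by simp),
    h w (by intro; simp +contextual) (by simp), h (v + w) (by intro; simp +contextual) (by simp),
    ← Finset.sum_add_distrib]
  exact Finset.sum_le_sum fun n _ => norm_add_le _ _

theorem l1Norm_sum_le {ι : Type*} (s : Finset ι) (v : ι → FinVec (Fin 2)) :
    l1Norm (∑ i ∈ s, v i) ≤ ∑ i ∈ s, l1Norm (v i) :=
  Finset.le_sum_of_subadditive l1Norm (by simp [l1Norm]) l1Norm_add_le s v

theorem ket_mem_photonLE {n : Fin 2 → ℕ} {D : ℕ} (h : ∑ j, n j ≤ D) : ket n ∈ photonLE D :=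
  Finsupp.single_mem_supported ℂ 1 h

theorem photonLE_mono {D E : ℕ} (h : D ≤ E) : photonLE D ≤ photonLE E :=
  Finsupp.supported_mono fun _ hn => le_trans hn h

/-- An operator that raises the photon number by at most `m`, with norm at most `b D` on the states
with at most `D` photons. -/
def HasGrowth (L : Module.End ℂ (FinVec (Fin 2))) (m : ℕ) (b : ℕ → ℝ) : Prop :=
  ∀ D, ∀ v ∈ photonLE D, L v ∈ photonLE (D + m) ∧ l1Norm (L v) ≤ b D * l1Norm v

theorem hasGrowth_of_ket {L : Module.End ℂ (FinVec (Fin 2))} {m : ℕ} {b : ℕ → ℝ}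
    (h : ∀ D n, ∑ j, n j ≤ D → L (ket n) ∈ photonLE (D + m) ∧ l1Norm (L (ket n)) ≤ b D) :
    HasGrowth L m b := by
  intro D v hv
  have hv' : ∀ n ∈ v.support, ∑ j, n j ≤ D := fun n hn => (Finsupp.mem_supported ℂ v).1 hv hn
  have e : v = ∑ n ∈ v.support, v n • ket n := by
    conv_lhs => rw [← Finsupp.sum_single v, Finsupp.sum]
    exact Finset.sum_congr rfl fun n _ => by simp [ket]
  have e2 : L v = ∑ n ∈ v.support, v n • L (ket n) := by
    conv_lhs => rw [e]
    simp only [map_sum, map_smul]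
  rw [e2]
  refine ⟨Submodule.sum_mem _ fun n hn => Submodule.smul_mem _ _ (h D n (hv' n hn)).1,
    (l1Norm_sum_le _ _).trans ?_⟩
  rw [l1Norm, Finsupp.sum, Finset.mul_sum]
  refine Finset.sum_le_sum fun n hn => ?_
  rw [l1Norm_smul, mul_comm]
  exact mul_le_mul_of_nonneg_right (h D n (hv' n hn)).2 (norm_nonneg _)

theorem HasGrowth.add {L L' : Module.End ℂ (FinVec (Fin 2))} {m : ℕ} {b b' : ℕ → ℝ}
    (h : HasGrowth L m b) (h' : HasGrowth L' m b') :
    HasGrowth (L + L') m fun D => b D + b' D := by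
  intro D v hv
  obtain ⟨h1, h2⟩ := h D v hv
  obtain ⟨h3, h4⟩ := h' D v hv
  exact ⟨Submodule.add_mem _ h1 h3, (l1Norm_add_le _ _).trans (by rw [add_mul]; gcongr)⟩

theorem HasGrowth.smul {L : Module.End ℂ (FinVec (Fin 2))} {m : ℕ} {b : ℕ → ℝ}
    (h : HasGrowth L m b) (a : ℂ) : HasGrowth (a • L) m fun D => ‖a‖ * b D := by
  intro D v hv
  obtain ⟨h1, h2⟩ := h D v hv
  refine ⟨Submodule.smul_mem _ _ h1, ?_⟩
  rw [LinearMap.smul_apply, l1Norm_smul, mul_assoc]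
  gcongr

theorem sum_add_single (n : Fin 2 → ℕ) (j : Fin 2) :
    ∑ k, (n + Pi.single j 1 : Fin 2 → ℕ) k = ∑ k, n k + 1 := by
  simp only [Pi.add_apply, Finset.sum_add_distrib, Finset.sum_pi_single', Finset.mem_univ, if_true]

theorem le_sum_photons (n : Fin 2 → ℕ) (j : Fin 2) : n j ≤ ∑ k, n k :=
  Finset.single_le_sum (fun _ _ => Nat.zero_le _) (Finset.mem_univ j)

theorem hasGrowth_annihilate (j : Fin 2) : HasGrowth (annihilate j) 1 fun D => √(D + 1 : ℝ) := by
  refine hasGrowth_of_ket fun D n hn => ?_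
  rw [annihilate_ket]
  refine ⟨Submodule.smul_mem _ _ (ket_mem_photonLE ?_), ?_⟩
  · have : ∑ k, (n - Pi.single j 1 : Fin 2 → ℕ) k ≤ ∑ k, n k :=
      Finset.sum_le_sum fun k _ => Nat.sub_le _ _
    omega
  · rw [l1Norm_smul, l1Norm_ket, mul_one, norm_real, Real.norm_eq_abs,
      abs_of_nonneg (Real.sqrt_nonneg _)]
    refine Real.sqrt_le_sqrt ?_
    have := le_sum_photons n j
    have : n j ≤ D + 1 := by omega
    exact_mod_cast this

theorem hasGrowth_create (j : Fin 2) : HasGrowth (create j) 1 fun D => √(D + 1 : ℝ) := by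
  refine hasGrowth_of_ket fun D n hn => ?_
  rw [create_ket]
  refine ⟨Submodule.smul_mem _ _ (ket_mem_photonLE ?_), ?_⟩
  · rw [sum_add_single]
    omega
  · rw [l1Norm_smul, l1Norm_ket, mul_one, norm_real, Real.norm_eq_abs,
      abs_of_nonneg (Real.sqrt_nonneg _)]
    refine Real.sqrt_le_sqrt ?_
    have := le_sum_photons n j
    have : n j ≤ D := by omega
    have : (n j : ℝ) ≤ D := by exact_mod_cast this
    linarith

/-- The self-adjoint field operator `∑ⱼ (uⱼ aⱼ + ūⱼ aⱼ†)`. -/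
def field (u : Fin 2 → ℂ) : Module.End ℂ (FinVec (Fin 2)) :=
  ∑ j, (u j • annihilate j + (starRingEnd ℂ) (u j) • create j)

theorem hasGrowth_field (u : Fin 2 → ℂ) :
    ∃ K : ℝ, 0 ≤ K ∧ HasGrowth (field u) 1 fun D => K * √(D + 1 : ℝ) := by
  refine ⟨2 * ∑ j, ‖u j‖, by positivity, ?_⟩
  have h := fun j => ((hasGrowth_annihilate j).smul (u j)).add
    ((hasGrowth_create j).smul ((starRingEnd ℂ) (u j)))
  have h2 := (h 0).add (h 1)
  rw [field, Fin.sum_univ_two]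
  intro D v hv
  refine ⟨(h2 D v hv).1, (h2 D v hv).2.trans_eq ?_⟩
  simp only [RCLike.norm_conj, Fin.sum_univ_two]
  ring

theorem l1Norm_pow_ket_le {L : Module.End ℂ (FinVec (Fin 2))} {K : ℝ} (hK : 0 ≤ K)
    (hL : HasGrowth L 1 fun D => K * √(D + 1 : ℝ)) (n : Fin 2 → ℕ) (k : ℕ) :
    (L ^ k) (ket n) ∈ photonLE (∑ j, n j + k) ∧
      l1Norm ((L ^ k) (ket n)) ≤ K ^ k * √((∑ j, n j + 1).ascFactorial k : ℝ) := by
  induction k with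
  | zero => simp [l1Norm_ket, ket_mem_photonLE]
  | succ k ih =>
    obtain ⟨h1, h2⟩ := hL _ _ ih.1
    rw [pow_succ', Module.End.mul_apply]
    refine ⟨h1, h2.trans ?_⟩
    rw [Nat.ascFactorial_succ, Nat.cast_mul, Real.sqrt_mul (Nat.cast_nonneg _), pow_succ']
    have e : ((∑ j, n j + k : ℕ) : ℝ) + 1 = ((∑ j, n j + 1 + k : ℕ) : ℝ) := by push_cast; ring
    dsimp only
    rw [e, mul_mul_mul_comm]
    exact mul_le_mul_of_nonneg_left ih.2 (by positivity)

/-- Operators with polynomial growth; the polynomials in creation and annihilation operators have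
this property. -/
def IsTame (L : Module.End ℂ (FinVec (Fin 2))) : Prop :=
  ∃ (m : ℕ) (C : ℝ), 0 ≤ C ∧ HasGrowth L m fun D => C * (D + 1 : ℝ) ^ m

theorem HasGrowth.isTame {L : Module.End ℂ (FinVec (Fin 2))} {K : ℝ} (hK : 0 ≤ K)
    (hL : HasGrowth L 1 fun D => K * √(D + 1 : ℝ)) : IsTame L := by
  refine ⟨1, K, hK, fun D v hv => ⟨(hL D v hv).1, (hL D v hv).2.trans ?_⟩⟩
  have h : √(D + 1 : ℝ) ≤ (D + 1 : ℝ) ^ 1 := by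
    rw [pow_one, Real.sqrt_le_left (by positivity)]
    nlinarith [(Nat.cast_nonneg D : (0 : ℝ) ≤ D)]
  have := l1Norm_nonneg v
  dsimp only
  gcongr

theorem isTame_annihilate (j : Fin 2) : IsTame (annihilate j) :=
  HasGrowth.isTame zero_le_one (by simpa using hasGrowth_annihilate j)

theorem isTame_create (j : Fin 2) : IsTame (create j) :=
  HasGrowth.isTame zero_le_one (by simpa using hasGrowth_create j)

theorem isTame_one : IsTame 1 :=
  ⟨0, 1, zero_le_one, fun D v hv => by simpa using hv⟩

theorem IsTame.smul {L : Module.End ℂ (FinVec (Fin 2))} (h : IsTame L) (a : ℂ) : IsTame (a • L) := by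
  obtain ⟨m, C, hC, h⟩ := h
  refine ⟨m, ‖a‖ * C, by positivity, ?_⟩
  simpa only [mul_assoc] using h.smul a

theorem IsTame.add {L L' : Module.End ℂ (FinVec (Fin 2))} (h : IsTame L) (h' : IsTame L') :
    IsTame (L + L') := by
  obtain ⟨m, C, hC, h⟩ := h
  obtain ⟨m', C', hC', h'⟩ := h'
  refine ⟨m + m', C + C', by positivity, fun D v hv => ?_⟩
  obtain ⟨h1, h2⟩ := h D v hv
  obtain ⟨h3, h4⟩ := h' D v hv
  refine ⟨Submodule.add_mem _ (photonLE_mono (by omega) h1) (photonLE_mono (by omega) h3),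
    (l1Norm_add_le _ _).trans ((add_le_add h2 h4).trans ?_)⟩
  have hD : (1 : ℝ) ≤ (D : ℝ) + 1 := by linarith [(Nat.cast_nonneg D : (0 : ℝ) ≤ D)]
  have e1 : (D + 1 : ℝ) ^ m ≤ (D + 1 : ℝ) ^ (m + m') := pow_le_pow_right₀ hD (by omega)
  have e2 : (D + 1 : ℝ) ^ m' ≤ (D + 1 : ℝ) ^ (m + m') := pow_le_pow_right₀ hD (by omega)
  have := l1Norm_nonneg v
  dsimp only
  rw [← add_mul, add_mul C C']
  gcongr

theorem IsTame.sum {ι : Type*} {s : Finset ι} {L : ι → Module.End ℂ (FinVec (Fin 2))}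
    (h : ∀ i ∈ s, IsTame (L i)) : IsTame (∑ i ∈ s, L i) :=
  Finset.sum_induction _ IsTame (fun _ _ => IsTame.add)
    (by simpa using (isTame_one.smul 0)) h

theorem IsTame.mul {L L' : Module.End ℂ (FinVec (Fin 2))} (h : IsTame L) (h' : IsTame L') :
    IsTame (L * L') := by
  obtain ⟨m, C, hC, h⟩ := h
  obtain ⟨m', C', hC', h'⟩ := h'
  refine ⟨m + m', C * (m' + 1 : ℝ) ^ m * C', by positivity, fun D v hv => ?_⟩
  obtain ⟨h1, h2⟩ := h' D v hv
  obtain ⟨h3, h4⟩ := h _ _ h1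
  rw [Module.End.mul_apply]
  refine ⟨photonLE_mono (by omega) h3, h4.trans ?_⟩
  dsimp only at h2 ⊢
  have h5 : ((D + m' : ℕ) : ℝ) + 1 ≤ (m' + 1) * (D + 1) := by
    push_cast
    nlinarith [(Nat.cast_nonneg D : (0 : ℝ) ≤ D), (Nat.cast_nonneg m' : (0 : ℝ) ≤ m'),
      mul_nonneg (Nat.cast_nonneg D : (0 : ℝ) ≤ D) (Nat.cast_nonneg m' : (0 : ℝ) ≤ m')]
  calc _ ≤ C * ((m' + 1 : ℝ) * (D + 1)) ^ m * (C' * (D + 1 : ℝ) ^ m' * l1Norm v) := by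
        have := l1Norm_nonneg (L' v)
        gcongr
    _ = _ := by rw [mul_pow, pow_add]; ring

theorem IsTame.pow {L : Module.End ℂ (FinVec (Fin 2))} (h : IsTame L) (k : ℕ) : IsTame (L ^ k) := by
  induction k with
  | zero => exact isTame_one
  | succ k ih => rw [pow_succ]; exact ih.mul h

theorem isTame_field (u : Fin 2 → ℂ) : IsTame (field u) := by
  obtain ⟨K, hK, h⟩ := hasGrowth_field u
  exact h.isTame hK

end Growth

/-! ### Commutation relations -/

section Commutators

theorem exists_bargmann_eq_ket (n : Fin 2 → ℕ) : ∃ p, bargmann p = ket n := by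
  refine ⟨MvPolynomial.monomial (Finsupp.equivFunOnFinite.symm n)
    (((√(multiFact n : ℝ) : ℝ) : ℂ)⁻¹), ?_⟩
  rw [bargmann_monomial]
  change (_ * ((√(multiFact n : ℝ) : ℝ) : ℂ)) • ket n = ket n
  rw [inv_mul_cancel₀ (sqrt_multiFact_ne_zero n), one_smul]

theorem end_ext_bargmann {L L' : Module.End ℂ (FinVec (Fin 2))}
    (h : ∀ p, L (bargmann p) = L' (bargmann p)) : L = L' := by
  refine Finsupp.lhom_ext' fun n => LinearMap.ext_ring ?_
  obtain ⟨p, hp⟩ := exists_bargmann_eq_ket n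
  change L (ket n) = L' (ket n)
  rw [← hp, h]

theorem annihilate_mul_annihilate (j k : Fin 2) :
    annihilate j * annihilate k = annihilate k * annihilate j := by
  refine end_ext_bargmann fun p => ?_
  simp only [Module.End.mul_apply, ← bargmann_pderiv]
  have h : ⁅MvPolynomial.pderiv (R := ℂ) j, MvPolynomial.pderiv (R := ℂ) k⁆ = 0 := by
    refine MvPolynomial.derivation_ext fun i => ?_
    rw [Derivation.commutator_apply, MvPolynomial.pderiv_X, MvPolynomial.pderiv_X, Pi.single_apply,
      Pi.single_apply]
    split_ifs <;> simp
  have h2 := DFunLike.congr_fun h p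
  rw [Derivation.commutator_apply, Derivation.zero_apply, sub_eq_zero] at h2
  rw [h2]

theorem create_mul_create (j k : Fin 2) : create j * create k = create k * create j := by
  refine end_ext_bargmann fun p => ?_
  simp only [Module.End.mul_apply, ← bargmann_X_mul]
  rw [mul_left_comm]

theorem annihilate_mul_create (j k : Fin 2) :
    annihilate j * create k = create k * annihilate j + (if j = k then 1 else 0) := by
  refine end_ext_bargmann fun p => ?_
  rw [LinearMap.add_apply, Module.End.mul_apply, Module.End.mul_apply, ← bargmann_X_mul,
    ← bargmann_pderiv, ← bargmann_pderiv, ← bargmann_X_mul, Derivation.leibniz, map_add,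
    smul_eq_mul, smul_eq_mul]
  congr 1
  split_ifs with h
  · subst h; simp
  · rw [MvPolynomial.pderiv_X_of_ne (Ne.symm h)]; simp

theorem annihilate_mul_field (u : Fin 2 → ℂ) (j : Fin 2) :
    annihilate j * field u = field u * annihilate j + (starRingEnd ℂ) (u j) • 1 := by
  have h : ∀ k, annihilate j * (u k • annihilate k + (starRingEnd ℂ) (u k) • create k) =
      (u k • annihilate k + (starRingEnd ℂ) (u k) • create k) * annihilate j +
        if j = k then (starRingEnd ℂ) (u k) • 1 else 0 := by
    intro k
    rw [mul_add, add_mul, mul_smul_comm, mul_smul_comm, smul_mul_assoc, smul_mul_assoc,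
      annihilate_mul_annihilate, annihilate_mul_create, smul_add, add_assoc]
    split_ifs <;> simp
  rw [field, Finset.mul_sum, Finset.sum_congr rfl fun k _ => h k, Finset.sum_add_distrib,
    Finset.sum_mul, Finset.sum_ite_eq, if_pos (Finset.mem_univ j)]

theorem create_mul_field (u : Fin 2 → ℂ) (j : Fin 2) :
    create j * field u = field u * create j + (-u j) • 1 := by
  have h : ∀ k, create j * (u k • annihilate k + (starRingEnd ℂ) (u k) • create k) =
      (u k • annihilate k + (starRingEnd ℂ) (u k) • create k) * create j +
        if j = k then (-u k) • 1 else 0 := by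
    intro k
    have := annihilate_mul_create k j
    rw [mul_add, add_mul, mul_smul_comm, mul_smul_comm, smul_mul_assoc, smul_mul_assoc,
      create_mul_create, this, smul_add]
    simp only [eq_comm (a := k)]
    split_ifs
    · rename_i hjk
      subst hjk
      module
    · simp
  rw [field, Finset.mul_sum, Finset.sum_congr rfl fun k _ => h k, Finset.sum_add_distrib,
    Finset.sum_mul, Finset.sum_ite_eq, if_pos (Finset.mem_univ j)]

theorem mul_pow_of_commutator {R : Type*} [Ring R] [Algebra ℂ R] {x y : R} {a : ℂ}
    (h : x * y = y * x + a • 1) (k : ℕ) :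
    x * y ^ k = y ^ k * x + (k * a) • y ^ (k - 1) := by
  induction k with
  | zero => simp
  | succ k ih =>
    rw [pow_succ y k, ← mul_assoc, ih, add_mul, mul_assoc, h, mul_add, smul_mul_assoc,
      Nat.add_sub_cancel, mul_smul_comm, mul_one, ← mul_assoc, add_assoc]
    congr 1
    rcases Nat.eq_zero_or_pos k with rfl | hk
    · simp
    · rw [← pow_succ, Nat.sub_add_cancel hk, ← add_smul]
      congr 1
      push_cast
      ring

end Commutators

/-! ### Traces and moments -/

section Moments

/-- The functional `v ↦ ⟨p| A v⟩`, where `A` is a matrix in the number basis. -/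
def rowFun (A : Matrix (Fin 2 → ℕ) (Fin 2 → ℕ) ℂ) (p : Fin 2 → ℕ) : FinVec (Fin 2) →ₗ[ℂ] ℂ :=
  Finsupp.linearCombination ℂ fun q => A p q

/-- The trace of `A L`, computed in the number basis. -/
def trace (A : Matrix (Fin 2 → ℕ) (Fin 2 → ℕ) ℂ) (L : Module.End ℂ (FinVec (Fin 2))) : ℂ :=
  ∑' n, rowFun A n (L (ket n))

variable {A : Matrix (Fin 2 → ℕ) (Fin 2 → ℕ) ℂ} {α β : Matrix (Fin 2) (Fin 2) ℂ}

theorem rowFun_ket (p q : Fin 2 → ℕ) : rowFun A p (ket q) = A p q := by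
  simp [rowFun, ket]

theorem norm_rowFun_le {C s : ℝ} (hC : 0 ≤ C) (hs : 0 < s) (hs1 : s < 1)
    (h : ∀ p q, ‖A p q‖ ≤ C * s ^ (∑ j, p j) * s ^ (∑ j, q j)) (p : Fin 2 → ℕ)
    (v : FinVec (Fin 2)) : ‖rowFun A p v‖ ≤ C * s ^ (∑ j, p j) * l1Norm v := by
  rw [rowFun, Finsupp.linearCombination_apply, l1Norm, Finsupp.sum, Finsupp.sum, Finset.mul_sum]
  refine (norm_sum_le _ _).trans (Finset.sum_le_sum fun q _ => ?_)
  rw [norm_smul, mul_comm]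
  refine mul_le_mul_of_nonneg_right ((h p q).trans ?_) (norm_nonneg _)
  exact mul_le_of_le_one_right (by positivity) (pow_le_one₀ hs.le hs1.le)

theorem summable_pow_photons {s : ℝ} (hs : 0 ≤ s) (hs1 : s < 1) :
    Summable fun n : Fin 2 → ℕ => s ^ (∑ j, n j) := by
  have h := summable_geometric_of_lt_one hs hs1
  have h2 := h.mul_of_nonneg h (fun n => pow_nonneg hs n) (fun n => pow_nonneg hs n)
  rw [← (finTwoArrowEquiv ℕ).symm.summable_iff]
  convert h2 using 2 with x
  simp [Fin.sum_univ_two, pow_add]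

theorem exists_poly_mul_pow_le {s : ℝ} (hs : 0 < s) (hs1 : s < 1) (m : ℕ) :
    ∃ C t : ℝ, 0 ≤ t ∧ t < 1 ∧ ∀ N : ℕ, (N + 1 : ℝ) ^ m * s ^ N ≤ C * t ^ N := by
  obtain ⟨t, hst, ht1⟩ := exists_between hs1
  have ht0 : 0 < t := hs.trans hst
  have hq : s / t < 1 := (div_lt_one ht0).2 hst
  have hlim := tendsto_pow_const_mul_const_pow_of_abs_lt_one m
    (r := s / t) (by rwa [abs_of_pos (div_pos hs ht0)])
  obtain ⟨C, hC⟩ := hlim.bddAbove_range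
  refine ⟨C * (t / s), t, ht0.le, ht1, fun N => ?_⟩
  have h1 : ((N + 1 : ℕ) : ℝ) ^ m * (s / t) ^ (N + 1) ≤ C := hC ⟨N + 1, rfl⟩
  have h2 : (N + 1 : ℝ) ^ m * s ^ N = ((N + 1 : ℕ) : ℝ) ^ m * (s / t) ^ (N + 1) * (t / s) * t ^ N := by
    rw [pow_succ, div_pow]
    push_cast
    field_simp
  rw [h2]
  gcongr

theorem IsGaussianMatrix.summable_trace (h : IsGaussianMatrix A α β)
    {L : Module.End ℂ (FinVec (Fin 2))} (hL : IsTame L) :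
    Summable fun n => rowFun A n (L (ket n)) := by
  obtain ⟨C, s, hC, hs, hs1, hA⟩ := h.decay
  obtain ⟨m, C', hC', hL⟩ := hL
  obtain ⟨C'', t, ht, ht1, hb⟩ := exists_poly_mul_pow_le hs hs1 m
  refine Summable.of_norm_bounded ((summable_pow_photons ht ht1).mul_left (C * C' * C'')) fun n => ?_
  have h1 := (hL _ _ (ket_mem_photonLE (le_refl (∑ j, n j)))).2
  rw [l1Norm_ket, mul_one] at h1
  refine (norm_rowFun_le hC hs hs1 hA n _).trans ?_
  calc _ ≤ C * s ^ (∑ j, n j) * (C' * (((∑ j, n j : ℕ) : ℝ) + 1) ^ m) := by gcongr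
    _ = C * C' * ((((∑ j, n j : ℕ) : ℝ) + 1) ^ m * s ^ (∑ j, n j)) := by ring
    _ ≤ C * C' * (C'' * t ^ (∑ j, n j)) := by
        have := hb (∑ j, n j)
        gcongr
    _ = _ := by ring

theorem IsGaussianMatrix.hasSum_trace (h : IsGaussianMatrix A α β)
    {L : Module.End ℂ (FinVec (Fin 2))} (hL : IsTame L) :
    HasSum (fun n => rowFun A n (L (ket n))) (trace A L) :=
  (h.summable_trace hL).hasSum

theorem IsGaussianMatrix.trace_add (h : IsGaussianMatrix A α β)
    {L L' : Module.End ℂ (FinVec (Fin 2))} (hL : IsTame L) (hL' : IsTame L') :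
    trace A (L + L') = trace A L + trace A L' := by
  refine HasSum.unique (h.hasSum_trace (hL.add hL')) ?_
  simpa only [LinearMap.add_apply, map_add] using (h.hasSum_trace hL).add (h.hasSum_trace hL')

theorem trace_smul (a : ℂ) (L : Module.End ℂ (FinVec (Fin 2))) :
    trace A (a • L) = a * trace A L := by
  simp only [trace, LinearMap.smul_apply, map_smul, smul_eq_mul, tsum_mul_left]

theorem IsGaussianMatrix.trace_sum (h : IsGaussianMatrix A α β) {ι : Type*} (s : Finset ι)
    {L : ι → Module.End ℂ (FinVec (Fin 2))} (hL : ∀ i ∈ s, IsTame (L i)) :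
    trace A (∑ i ∈ s, L i) = ∑ i ∈ s, trace A (L i) := by
  refine HasSum.unique (h.hasSum_trace (IsTame.sum hL)) ?_
  simpa only [LinearMap.sum_apply, map_sum] using hasSum_sum fun i hi => h.hasSum_trace (hL i hi)

theorem add_single_injective (j : Fin 2) :
    Function.Injective fun n : Fin 2 → ℕ => n + Pi.single j 1 :=
  add_left_injective _

theorem mem_range_add_single {j : Fin 2} {n : Fin 2 → ℕ} (hn : n j ≠ 0) :
    n ∈ Set.range fun n : Fin 2 → ℕ => n + Pi.single j 1 := by
  refine ⟨n - Pi.single j 1, ?_⟩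
  ext l
  by_cases hl : l = j
  · subst hl; simp; omega
  · simp [hl]

/-- Cyclicity of the trace for an annihilation operator. -/
theorem IsGaussianMatrix.hasSum_mul_annihilate (h : IsGaussianMatrix A α β)
    {L : Module.End ℂ (FinVec (Fin 2))} (hL : IsTame L) (j : Fin 2) :
    HasSum (fun n : Fin 2 → ℕ =>
        ((√(n j + 1 : ℝ) : ℝ) : ℂ) * rowFun A (n + Pi.single j 1) (L (ket n)))
      (trace A (L * annihilate j)) := by
  have h1 := h.hasSum_trace (hL.mul (isTame_annihilate j))
  rw [← (add_single_injective j).hasSum_iff] at h1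
  · convert h1 using 2 with n
    rw [Function.comp_apply, Module.End.mul_apply, annihilate_ket, add_tsub_cancel_right, map_smul,
      map_smul, smul_eq_mul]
    simp
  · intro n hn
    have : n j = 0 := by
      by_contra h0
      exact hn (mem_range_add_single h0)
    simp [annihilate_ket, this]

/-- Cyclicity of the trace for a creation operator. -/
theorem IsGaussianMatrix.hasSum_mul_create (h : IsGaussianMatrix A α β)
    {L : Module.End ℂ (FinVec (Fin 2))} (hL : IsTame L) (j : Fin 2) :
    HasSum (fun n : Fin 2 → ℕ => ((√(n j : ℝ) : ℝ) : ℂ) * rowFun A (n - Pi.single j 1) (L (ket n)))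
      (trace A (L * create j)) := by
  have h1 := h.hasSum_trace (hL.mul (isTame_create j))
  rw [← (add_single_injective j).hasSum_iff]
  · convert h1 using 2 with n
    rw [Function.comp_apply, Module.End.mul_apply, create_ket, add_tsub_cancel_right, map_smul,
      map_smul, smul_eq_mul]
    simp
  · intro n hn
    have : n j = 0 := by
      by_contra h0
      exact hn (mem_range_add_single h0)
    simp [this]

theorem linearMap_ext_ket {f g : FinVec (Fin 2) →ₗ[ℂ] ℂ} (h : ∀ q, f (ket q) = g (ket q))
    (v : FinVec (Fin 2)) : f v = g v := by
  have : f = g := Finsupp.lhom_ext' fun q => LinearMap.ext_ring (h q)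
  rw [this]

theorem IsGaussianMatrix.rowFun_row (h : IsGaussianMatrix A α β) (p : Fin 2 → ℕ) (j : Fin 2)
    (v : FinVec (Fin 2)) :
    ((√(p j + 1 : ℝ) : ℝ) : ℂ) * rowFun A (p + Pi.single j 1) v =
      ∑ k, α j k * (((√(p k : ℝ) : ℝ) : ℂ) * rowFun A (p - Pi.single k 1) v) +
        ∑ k, β j k * rowFun A p (annihilate k v) := by
  have := linearMap_ext_ket (f := ((√(p j + 1 : ℝ) : ℝ) : ℂ) • rowFun A (p + Pi.single j 1))
    (g := ∑ k, (α j k * ((√(p k : ℝ) : ℝ) : ℂ)) • rowFun A (p - Pi.single k 1) +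
        ∑ k, β j k • (rowFun A p).comp (annihilate k)) (fun q => by
      simp only [LinearMap.smul_apply, LinearMap.add_apply, LinearMap.sum_apply,
        LinearMap.comp_apply, annihilate_ket, map_smul, rowFun_ket, smul_eq_mul, h.row p q j,
        mul_assoc]) v
  simpa only [LinearMap.smul_apply, LinearMap.add_apply, LinearMap.sum_apply,
    LinearMap.comp_apply, smul_eq_mul, mul_assoc] using this

theorem IsGaussianMatrix.rowFun_col (h : IsGaussianMatrix A α β) (p : Fin 2 → ℕ) (j : Fin 2)
    (v : FinVec (Fin 2)) :
    rowFun A p (create j v) =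
      ∑ k, (starRingEnd ℂ) (β j k) * (((√(p k : ℝ) : ℝ) : ℂ) * rowFun A (p - Pi.single k 1) v) +
        ∑ k, (starRingEnd ℂ) (α j k) * rowFun A p (annihilate k v) := by
  have := linearMap_ext_ket (f := (rowFun A p).comp (create j))
    (g := ∑ k, ((starRingEnd ℂ) (β j k) * ((√(p k : ℝ) : ℝ) : ℂ)) • rowFun A (p - Pi.single k 1) +
        ∑ k, (starRingEnd ℂ) (α j k) • (rowFun A p).comp (annihilate k)) (fun q => by
      simp only [LinearMap.smul_apply, LinearMap.add_apply, LinearMap.sum_apply,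
        LinearMap.comp_apply, annihilate_ket, create_ket, map_smul, rowFun_ket, smul_eq_mul,
        h.col p q j, mul_assoc]) v
  simpa only [LinearMap.smul_apply, LinearMap.add_apply, LinearMap.sum_apply,
    LinearMap.comp_apply, smul_eq_mul, mul_assoc] using this

/-- The trace of the relation `a_j A = ∑ₖ (α_jk a_k† A + β_jk A a_k)` multiplied by `L`. -/
theorem IsGaussianMatrix.trace_mul_annihilate (h : IsGaussianMatrix A α β)
    {L : Module.End ℂ (FinVec (Fin 2))} (hL : IsTame L) (j : Fin 2) :
    trace A (L * annihilate j) =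
      ∑ k, α j k * trace A (L * create k) + ∑ k, β j k * trace A (annihilate k * L) := by
  refine (h.hasSum_mul_annihilate hL j).unique ?_
  have h1 := hasSum_sum (s := Finset.univ) fun k _ => (h.hasSum_mul_create hL k).mul_left (α j k)
  have h2 := hasSum_sum (s := Finset.univ) fun k _ =>
    (h.hasSum_trace ((isTame_annihilate k).mul hL)).mul_left (β j k)
  simpa only [h.rowFun_row, Module.End.mul_apply] using h1.add h2

/-- The trace of the relation `A a_j† = ∑ₖ (β̄_jk a_k† A + ᾱ_jk A a_k)` multiplied by `L`. -/
theorem IsGaussianMatrix.trace_create_mul (h : IsGaussianMatrix A α β)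
    {L : Module.End ℂ (FinVec (Fin 2))} (hL : IsTame L) (j : Fin 2) :
    trace A (create j * L) =
      ∑ k, (starRingEnd ℂ) (β j k) * trace A (L * create k) +
        ∑ k, (starRingEnd ℂ) (α j k) * trace A (annihilate k * L) := by
  refine (h.hasSum_trace ((isTame_create j).mul hL)).unique ?_
  have h1 := hasSum_sum (s := Finset.univ) fun k _ =>
    (h.hasSum_mul_create hL k).mul_left ((starRingEnd ℂ) (β j k))
  have h2 := hasSum_sum (s := Finset.univ) fun k _ =>
    (h.hasSum_trace ((isTame_annihilate k).mul hL)).mul_left ((starRingEnd ℂ) (α j k))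
  simpa only [Module.End.mul_apply, h.rowFun_col] using h1.add h2

/-- Nondegeneracy for the complexification of `z ↦ z - α z̄ - β z`. -/
theorem IsGaussianMatrix.eq_zero_of_pair (h : IsGaussianMatrix A α β) {y y' : Fin 2 → ℂ}
    (hy : ∀ j, y j = ∑ k, α j k * y' k + ∑ k, β j k * y k)
    (hy' : ∀ j, y' j = ∑ k, (starRingEnd ℂ) (β j k) * y' k + ∑ k, (starRingEnd ℂ) (α j k) * y k) :
    y = 0 ∧ y' = 0 := by
  have hc : ∀ j, (starRingEnd ℂ) (y' j) = ∑ k, β j k * (starRingEnd ℂ) (y' k) +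
      ∑ k, α j k * (starRingEnd ℂ) (y k) := by
    intro j
    conv_lhs => rw [hy' j]
    simp only [map_add, map_sum, map_mul, conj_conj]
  -- The set of solutions is stable under `(y, y') ↦ (conj y', conj y)`, so that `y + conj y'` and
  -- `i (y - conj y')` solve the real equation.
  have h1 := h.nondeg (fun j => y j + (starRingEnd ℂ) (y' j)) (fun j => by
    conv_lhs => rw [hy j, hc j]
    simp only [map_add, conj_conj, mul_add, Finset.sum_add_distrib]
    ring)
  have h2 := h.nondeg (fun j => I * (y j - (starRingEnd ℂ) (y' j))) (fun j => by
    conv_lhs => rw [hy j, hc j]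
    simp only [map_sub, map_mul, conj_conj, conj_I, Fin.sum_univ_two]
    ring)
  have h3 : ∀ j, y j = 0 := by
    intro j
    have e1 : y j + (starRingEnd ℂ) (y' j) = 0 := congrFun h1 j
    have e2 : I * (y j - (starRingEnd ℂ) (y' j)) = 0 := congrFun h2 j
    have e3 := (mul_eq_zero.1 e2).resolve_left I_ne_zero
    linear_combination (e1 + e3) / 2
  refine ⟨funext h3, funext fun j => ?_⟩
  have e1 : y j + (starRingEnd ℂ) (y' j) = 0 := congrFun h1 j
  rw [h3, zero_add] at e1
  simpa using e1

theorem IsGaussianMatrix.trace_annihilate_mul_field_pow (h : IsGaussianMatrix A α β)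
    (u : Fin 2 → ℂ) (k : ℕ) (j : Fin 2) :
    trace A (annihilate j * field u ^ k) = trace A (field u ^ k * annihilate j) +
      k * trace A (field u ^ (k - 1)) * (starRingEnd ℂ) (u j) := by
  have e := mul_pow_of_commutator (R := Module.End ℂ (FinVec (Fin 2)))
    (annihilate_mul_field u j) k
  rw [e, h.trace_add, trace_smul]
  · ring
  · exact ((isTame_field u).pow k).mul (isTame_annihilate j)
  · exact ((isTame_field u).pow _).smul _

theorem IsGaussianMatrix.trace_create_mul_field_pow (h : IsGaussianMatrix A α β)
    (u : Fin 2 → ℂ) (k : ℕ) (j : Fin 2) :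
    trace A (create j * field u ^ k) = trace A (field u ^ k * create j) -
      k * trace A (field u ^ (k - 1)) * u j := by
  have e := mul_pow_of_commutator (R := Module.End ℂ (FinVec (Fin 2)))
    (create_mul_field u j) k
  rw [e, h.trace_add, trace_smul]
  · ring
  · exact ((isTame_field u).pow k).mul (isTame_create j)
  · exact ((isTame_field u).pow _).smul _

theorem IsGaussianMatrix.trace_mul_field (h : IsGaussianMatrix A α β) (u : Fin 2 → ℂ)
    {L : Module.End ℂ (FinVec (Fin 2))} (hL : IsTame L) :
    trace A (L * field u) = ∑ j, (u j * trace A (L * annihilate j) +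
      (starRingEnd ℂ) (u j) * trace A (L * create j)) := by
  have ha := fun j => ((hL.mul (isTame_annihilate j)).smul (u j))
  have hc := fun j => ((hL.mul (isTame_create j)).smul ((starRingEnd ℂ) (u j)))
  rw [field, Finset.mul_sum]
  simp only [mul_add, mul_smul_comm]
  rw [h.trace_sum _ fun j _ => (ha j).add (hc j)]
  refine Finset.sum_congr rfl fun j _ => ?_
  rw [h.trace_add (ha j) (hc j), trace_smul, trace_smul]

/-- Wick's theorem in recursive form: the moments of a field operator are those of a centred
Gaussian random variable. -/
theorem IsGaussianMatrix.trace_field_pow_succ (h : IsGaussianMatrix A α β) (u : Fin 2 → ℂ)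
    (h1 : trace A 1 = 1) (k : ℕ) :
    trace A (field u ^ (k + 1)) = k * trace A (field u ^ (k - 1)) * trace A (field u ^ 2) := by
  set μ : ℕ → ℂ := fun k => k * trace A (field u ^ (k - 1)) with hμ
  set y : ℕ → Fin 2 → ℂ := fun k j => trace A (field u ^ k * annihilate j) with hy
  set y' : ℕ → Fin 2 → ℂ := fun k j => trace A (field u ^ k * create j) with hy'
  have hμ1 : μ 1 = 1 := by simp [hμ, h1]
  have e1 : ∀ k j, y k j = ∑ l, α j l * y' k l +
      ∑ l, β j l * (y k l + μ k * (starRingEnd ℂ) (u l)) := by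
    intro k j
    have := h.trace_mul_annihilate ((isTame_field u).pow k) j
    simpa only [h.trace_annihilate_mul_field_pow] using this
  have e2 : ∀ k j, y' k j - μ k * u j = ∑ l, (starRingEnd ℂ) (β j l) * y' k l +
      ∑ l, (starRingEnd ℂ) (α j l) * (y k l + μ k * (starRingEnd ℂ) (u l)) := by
    intro k j
    have := h.trace_create_mul ((isTame_field u).pow k) j
    simpa only [h.trace_annihilate_mul_field_pow, h.trace_create_mul_field_pow] using this
  -- Both sides solve the same linear system up to the factor `μ k`.
  obtain ⟨hz, hz'⟩ := h.eq_zero_of_pair (y := fun j => y k j - μ k * y 1 j)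
    (y' := fun j => y' k j - μ k * y' 1 j)
    (fun j => by
      have a1 := e1 k j
      have a2 := e1 1 j
      rw [hμ1] at a2
      simp only [Fin.sum_univ_two] at a1 a2 ⊢
      linear_combination a1 - μ k * a2)
    (fun j => by
      have a1 := e2 k j
      have a2 := e2 1 j
      rw [hμ1] at a2
      simp only [Fin.sum_univ_two] at a1 a2 ⊢
      linear_combination a1 - μ k * a2)
  have f1 : ∀ j, y k j = μ k * y 1 j := fun j => sub_eq_zero.1 (congrFun hz j)
  have f2 : ∀ j, y' k j = μ k * y' 1 j := fun j => sub_eq_zero.1 (congrFun hz' j)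
  have g : ∀ k, trace A (field u ^ (k + 1)) =
      ∑ j, (u j * y k j + (starRingEnd ℂ) (u j) * y' k j) := by
    intro k
    rw [pow_succ, h.trace_mul_field u ((isTame_field u).pow k)]
  have g2 : trace A (field u ^ 2) = ∑ j, (u j * y 1 j + (starRingEnd ℂ) (u j) * y' 1 j) := g 1
  rw [g k, g2, Finset.mul_sum]
  refine Finset.sum_congr rfl fun j _ => ?_
  rw [f1, f2]
  ring

/-- The second moment of a field operator is real. -/
theorem IsGaussianMatrix.trace_field_sq_im (h : IsGaussianMatrix A α β) (u : Fin 2 → ℂ)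
    (h1 : trace A 1 = 1) : (trace A (field u ^ 2)).im = 0 := by
  set y : Fin 2 → ℂ := fun j => trace A (field u * annihilate j) with hy
  set y' : Fin 2 → ℂ := fun j => trace A (field u * create j) with hy'
  have hn : trace A (field u ^ (1 - 1)) = 1 := by simpa using h1
  have c1 : ∀ j, trace A (annihilate j * field u) = y j + (starRingEnd ℂ) (u j) := by
    intro j
    have := h.trace_annihilate_mul_field_pow u 1 j
    rw [hn] at this
    simpa using this
  have c2 : ∀ j, trace A (create j * field u) = y' j - u j := by
    intro j
    have := h.trace_create_mul_field_pow u 1 j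
    rw [hn] at this
    simpa using this
  have e1 : ∀ j, y j = ∑ l, α j l * y' l + ∑ l, β j l * (y l + (starRingEnd ℂ) (u l)) := by
    intro j
    have := h.trace_mul_annihilate (isTame_field u) j
    simpa only [c1] using this
  have e2 : ∀ j, y' j - u j = ∑ l, (starRingEnd ℂ) (β j l) * y' l +
      ∑ l, (starRingEnd ℂ) (α j l) * (y l + (starRingEnd ℂ) (u l)) := by
    intro j
    have := h.trace_create_mul (isTame_field u) j
    simpa only [c1, c2] using this
  have e3 : ∀ j, (starRingEnd ℂ) (y' j) - (starRingEnd ℂ) (u j) =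
      ∑ l, β j l * (starRingEnd ℂ) (y' l) + ∑ l, α j l * ((starRingEnd ℂ) (y l) + u l) := by
    intro j
    have := congrArg (starRingEnd ℂ) (e2 j)
    simpa only [map_sub, map_add, map_sum, map_mul, conj_conj] using this
  -- The difference of `⟨a_j G⟩` and the conjugate of `⟨G a_j†⟩` solves the homogeneous system.
  have h2 := h.nondeg (fun j => I * (y j + (starRingEnd ℂ) (u j) - (starRingEnd ℂ) (y' j)))
    (fun j => by
      have a1 := e1 j
      have a3 := e3 j
      simp only [map_sub, map_add, map_mul, conj_conj, conj_I, Fin.sum_univ_two] at a1 a3 ⊢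
      linear_combination I * (a1 - a3))
  have h3 : ∀ j, y j = (starRingEnd ℂ) (y' j) - (starRingEnd ℂ) (u j) := by
    intro j
    have := (mul_eq_zero.1 (congrFun h2 j)).resolve_left I_ne_zero
    linear_combination this
  have g : trace A (field u ^ 2) = ∑ j, (u j * y j + (starRingEnd ℂ) (u j) * y' j) := by
    rw [sq, h.trace_mul_field u (isTame_field u)]
  rw [g, im_sum]
  refine Finset.sum_eq_zero fun j _ => ?_
  rw [h3]
  simp only [add_im, mul_im, sub_re, sub_im, conj_re, conj_im]
  ring

end Moments

/-! ### The characteristic function -/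

section CharacteristicFunction

/-- The bound `(N + k choose k) xᵏ (1 - x)ᴺ ≤ 1` trades the growth of the field operators in the
photon number `N` against their growth in the power `k`. -/
theorem sqrt_ascFactorial_div_le {x K : ℝ} (hx : 0 < x) (hx1 : x < 1) (hK : 0 ≤ K) (N k : ℕ) :
    (k ! : ℝ)⁻¹ * (K ^ k * √((N + 1).ascFactorial k : ℝ)) ≤
      ((K / √x) ^ k / √(k ! : ℝ)) * (√(1 - x))⁻¹ ^ N := by
  have h1 : ((N + k).choose k : ℝ) * (x ^ k * (1 - x) ^ N) ≤ 1 := by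
    have h2 : ∀ m ∈ Finset.range (N + k + 1),
        0 ≤ x ^ m * (1 - x) ^ (N + k - m) * ((N + k).choose m : ℝ) := fun m _ =>
      mul_nonneg (mul_nonneg (pow_nonneg hx.le _) (pow_nonneg (by linarith) _)) (Nat.cast_nonneg _)
    have h3 := Finset.single_le_sum h2 (Finset.mem_range.2 (by omega : k < N + k + 1))
    rw [← add_pow, add_sub_cancel, one_pow, Nat.add_sub_cancel] at h3
    linarith
  have hp : 0 < x ^ k * (1 - x) ^ N := mul_pos (pow_pos hx _) (pow_pos (by linarith) _)
  have h2 : √((N + k).choose k : ℝ) ≤ (√x ^ k * √(1 - x) ^ N)⁻¹ := by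
    refine Real.sqrt_le_iff.2 ⟨by positivity, ?_⟩
    rw [inv_pow, mul_pow, pow_right_comm, pow_right_comm _ N, Real.sq_sqrt hx.le,
      Real.sq_sqrt (by linarith), ← one_div, le_div_iff₀ hp]
    exact h1
  have hf : 0 < √(k ! : ℝ) := Real.sqrt_pos.2 (by exact_mod_cast Nat.factorial_pos k)
  have hf2 : (k ! : ℝ)⁻¹ * √(k ! : ℝ) = (√(k ! : ℝ))⁻¹ := by
    rw [inv_mul_eq_div, Real.sqrt_div_self]
  have hsx : 0 < √x := Real.sqrt_pos.2 hx
  have hsx1 : 0 < √(1 - x) := Real.sqrt_pos.2 (by linarith)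
  rw [Nat.ascFactorial_eq_factorial_mul_choose, Nat.cast_mul, Real.sqrt_mul (Nat.cast_nonneg _)]
  calc _ ≤ (k ! : ℝ)⁻¹ * (K ^ k * (√(k ! : ℝ) * (√x ^ k * √(1 - x) ^ N)⁻¹)) := by gcongr
    _ = _ := by
      rw [mul_left_comm, ← mul_assoc (k ! : ℝ)⁻¹, hf2, div_pow, inv_pow]
      field_simp

theorem summable_pow_div_sqrt_factorial {a : ℝ} (ha : 0 ≤ a) :
    Summable fun k : ℕ => a ^ k / √(k ! : ℝ) := by
  have h1 := Real.summable_pow_div_factorial ((2 * a) ^ 2)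
  have h2 := summable_geometric_of_lt_one (r := (1 / 4 : ℝ)) (by norm_num) (by norm_num)
  refine Summable.of_nonneg_of_le (fun k => by positivity) (fun k => ?_) (h1.add h2)
  have hf : 0 < √(k ! : ℝ) := Real.sqrt_pos.2 (by exact_mod_cast Nat.factorial_pos k)
  have hf2 : √(k ! : ℝ) ^ 2 = k ! := Real.sq_sqrt (Nat.cast_nonneg _)
  have e : a ^ k / √(k ! : ℝ) = ((2 * a) ^ k / √(k ! : ℝ)) * (1 / 2) ^ k := by
    rw [mul_pow, one_div_pow]
    field_simp
  have e1 : ((2 * a) ^ 2) ^ k / (k ! : ℝ) = ((2 * a) ^ k / √(k ! : ℝ)) ^ 2 := by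
    rw [div_pow, hf2, pow_right_comm]
  have e2 : (1 / 4 : ℝ) ^ k = ((1 / 2) ^ k) ^ 2 := by
    rw [← pow_mul, mul_comm, pow_mul]
    norm_num
  rw [e, e1, e2]
  nlinarith [sq_nonneg ((2 * a) ^ k / √(k ! : ℝ) - (1 / 2) ^ k),
    sq_nonneg ((2 * a) ^ k / √(k ! : ℝ)), sq_nonneg ((1 / 2 : ℝ) ^ k)]

/-- The moments of a centred Gaussian random variable of variance `m 2` sum up to its characteristic
function. -/
theorem hasSum_of_wick {m : ℕ → ℂ} (h0 : m 0 = 1) (h : ∀ k, m (k + 1) = k * m (k - 1) * m 2) :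
    HasSum (fun k : ℕ => ((k ! : ℂ))⁻¹ * (I ^ k * m k)) (cexp (-m 2 / 2)) := by
  have hodd : ∀ k, m (2 * k + 1) = 0 := by
    intro k
    induction k with
    | zero => simpa using h 0
    | succ k ih =>
      have := h (2 * k + 2)
      rw [show 2 * k + 2 - 1 = 2 * k + 1 by omega, ih, mul_zero, zero_mul] at this
      exact this
  have heven : ∀ k, (((2 * k)! : ℂ))⁻¹ * (I ^ (2 * k) * m (2 * k)) = (-m 2 / 2) ^ k / (k ! : ℂ) := by
    intro k
    induction k with
    | zero => simp [h0]
    | succ k ih =>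
      have e := h (2 * k + 1)
      rw [Nat.add_sub_cancel] at e
      have f1 : ((2 * k)! : ℂ) ≠ 0 := by exact_mod_cast Nat.factorial_ne_zero _
      have f2 : (k ! : ℂ) ≠ 0 := by exact_mod_cast Nat.factorial_ne_zero _
      have f3 : (k + 1 : ℂ) ≠ 0 := by exact_mod_cast Nat.succ_ne_zero k
      have f4 : (2 * k + 1 : ℂ) ≠ 0 := by exact_mod_cast Nat.succ_ne_zero (2 * k)
      have g : ((2 * (k + 1))! : ℂ) = (2 * (k + 1)) * (2 * k + 1) * (2 * k)! := by
        rw [show 2 * (k + 1) = 2 * k + 1 + 1 by ring, Nat.factorial_succ, Nat.factorial_succ]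
        push_cast
        ring
      have g2 : ((k + 1)! : ℂ) = (k + 1) * k ! := by
        rw [Nat.factorial_succ]; push_cast; ring
      calc _ = (((2 * k)! : ℂ))⁻¹ * (I ^ (2 * k) * m (2 * k)) * (-m 2 / (2 * (k + 1))) := by
            rw [g, show 2 * (k + 1) = 2 * k + 1 + 1 by ring, e, pow_succ, pow_succ, mul_assoc,
              mul_assoc (I ^ (2 * k)) I I, I_mul_I]
            push_cast
            field_simp
        _ = _ := by
            rw [ih, g2, pow_succ]
            field_simp
  have he : HasSum (fun k : ℕ => (((2 * k)! : ℂ))⁻¹ * (I ^ (2 * k) * m (2 * k)))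
      (cexp (-m 2 / 2)) := by
    simp only [heven, Complex.exp_eq_exp_ℂ]
    exact NormedSpace.expSeries_div_hasSum_exp (-m 2 / 2)
  have ho : HasSum (fun k : ℕ => (((2 * k + 1)! : ℂ))⁻¹ * (I ^ (2 * k + 1) * m (2 * k + 1))) 0 := by
    simp only [hodd, mul_zero]
    exact hasSum_zero
  rw [← add_zero (cexp _)]
  exact he.even_add_odd ho

variable {A : Matrix (Fin 2 → ℕ) (Fin 2 → ℕ) ℂ} {α β : Matrix (Fin 2) (Fin 2) ℂ}

/-- The exponential decay of `A` makes the exponential series of a field operator absolutely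
summable, jointly with the sum over the number states. -/
theorem IsGaussianMatrix.summable_exp_field (h : IsGaussianMatrix A α β) (u : Fin 2 → ℂ) :
    Summable fun x : (Fin 2 → ℕ) × ℕ =>
      ((x.2 ! : ℂ))⁻¹ * (I ^ x.2 * rowFun A x.1 ((field u ^ x.2) (ket x.1))) := by
  obtain ⟨C, s, hC, hs, hs1, hA⟩ := h.decay
  obtain ⟨K, hK, hG⟩ := hasGrowth_field u
  -- Any `x` with `s < √(1 - x)` will do.
  set x : ℝ := (1 - s ^ 2) / 2 with hx
  have hs2 : s ^ 2 < 1 := by nlinarith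
  have hx0 : 0 < x := by rw [hx]; linarith
  have hx1 : x < 1 := by rw [hx]; nlinarith
  have hsx : s < √(1 - x) := Real.lt_sqrt_of_sq_lt (by rw [hx]; linarith)
  have hr0 : 0 ≤ s * (√(1 - x))⁻¹ := by positivity
  have hr1 : s * (√(1 - x))⁻¹ < 1 := by
    rw [← div_eq_mul_inv]
    exact (div_lt_one (hs.trans hsx)).2 hsx
  have hsum := ((summable_pow_photons hr0 hr1).mul_left C).mul_of_nonneg
    (summable_pow_div_sqrt_factorial (a := K / √x) (by positivity))
    (fun n => by positivity) (fun k => by positivity)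
  refine Summable.of_norm_bounded hsum fun ⟨n, k⟩ => ?_
  have h1 := norm_rowFun_le hC hs hs1 hA n ((field u ^ k) (ket n))
  have h2 := (l1Norm_pow_ket_le hK hG n k).2
  have h3 := sqrt_ascFactorial_div_le hx0 hx1 hK (∑ j, n j) k
  simp only [norm_mul, norm_inv, norm_pow, norm_I, one_pow, one_mul, RCLike.norm_natCast]
  calc (k ! : ℝ)⁻¹ * ‖rowFun A n ((field u ^ k) (ket n))‖
      ≤ (k ! : ℝ)⁻¹ * (C * s ^ (∑ j, n j) * (K ^ k * √((∑ j, n j + 1).ascFactorial k : ℝ))) := by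
        gcongr
        exact h1.trans (by gcongr)
    _ = C * s ^ (∑ j, n j) * ((k ! : ℝ)⁻¹ * (K ^ k * √((∑ j, n j + 1).ascFactorial k : ℝ))) := by
        ring
    _ ≤ C * s ^ (∑ j, n j) * (((K / √x) ^ k / √(k ! : ℝ)) * (√(1 - x))⁻¹ ^ (∑ j, n j)) := by
        gcongr
    _ = _ := by
        rw [mul_pow]
        ring

/-- The trace of `A exp (i G)` for a field operator `G`. -/
theorem IsGaussianMatrix.hasSum_exp_field (h : IsGaussianMatrix A α β) (h1 : trace A 1 = 1)
    (u : Fin 2 → ℂ) :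
    HasSum (fun n => ∑' k : ℕ, ((k ! : ℂ))⁻¹ * (I ^ k * rowFun A n ((field u ^ k) (ket n))))
      (cexp (-trace A (field u ^ 2) / 2)) := by
  have hF := h.summable_exp_field u
  have e1 := hF.hasSum.prod_fiberwise fun n => (hF.prod_factor n).hasSum
  have e2 := ((Equiv.prodComm ℕ (Fin 2 → ℕ)).hasSum_iff.2 hF.hasSum).prod_fiberwise
    (g := fun k : ℕ => ((k ! : ℂ))⁻¹ * (I ^ k * trace A (field u ^ k)))
    fun k => by
      have := ((h.hasSum_trace ((isTame_field u).pow k)).mul_left (I ^ k)).mul_left ((k ! : ℂ))⁻¹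
      exact this
  have e3 := hasSum_of_wick (m := fun k => trace A (field u ^ k)) (by simpa using h1)
    (h.trace_field_pow_succ u h1)
  rwa [e2.unique e3] at e1

theorem norm_toFock_le (v : FinVec (Fin 2)) : ‖toFock v‖ ≤ l1Norm v := by
  rw [toFock, Finsupp.linearCombination_apply, l1Norm]
  refine (norm_sum_le _ _).trans (Finset.sum_le_sum fun n _ => ?_)
  have hn : ‖(numberState n : Fock (Fin 2))‖ = 1 := by
    rw [numberState, lp.norm_single (by norm_num), norm_one]
  rw [norm_smul, hn, mul_one]

theorem inner_toFock (ρ : TwoMode →L[ℂ] TwoMode) (n : Fin 2 → ℕ) (v : FinVec (Fin 2)) :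
    inner ℂ (numberState n) (ρ (toFock v)) = rowFun (numberMatrix ρ) n v :=
  linearMap_ext_ket (f := (innerSL ℂ (numberState n)).toLinearMap ∘ₗ ρ.toLinearMap ∘ₗ toFock)
    (g := rowFun (numberMatrix ρ) n) (fun q => by
      rw [rowFun_ket]
      simp [toFock_ket, numberMatrix]) v

theorem I_smul_pow_apply (L : Module.End ℂ (FinVec (Fin 2))) (k : ℕ) (v : FinVec (Fin 2)) :
    ((I • L) ^ k) v = I ^ k • (L ^ k) v := by
  rw [smul_pow, LinearMap.smul_apply]

/-- Number states are analytic vectors of the field operators. -/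
theorem summable_exp_field_ket (u : Fin 2 → ℂ) (n : Fin 2 → ℕ) :
    Summable fun k : ℕ => ((k ! : ℂ))⁻¹ • toFock (((I • field u) ^ k) (ket n)) := by
  obtain ⟨K, hK, hG⟩ := hasGrowth_field u
  refine Summable.of_norm_bounded ((summable_pow_div_sqrt_factorial
    (a := K / √(1 / 2)) (by positivity)).mul_right ((√(1 - 1 / 2))⁻¹ ^ (∑ j, n j))) fun k => ?_
  refine le_trans ?_ (sqrt_ascFactorial_div_le (by norm_num) (by norm_num) hK (∑ j, n j) k)
  rw [I_smul_pow_apply, map_smul, norm_smul, norm_smul, norm_pow, norm_I, one_pow, one_mul, norm_inv,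
    RCLike.norm_natCast]
  gcongr
  exact (norm_toFock_le _).trans (l1Norm_pow_ket_le hK hG n k).2

theorem trace_numberMatrix_one {ρ : TwoMode →L[ℂ] TwoMode} (hρ : IsState ρ) :
    trace (numberMatrix ρ) 1 = 1 := by
  rw [← hρ.2.tsum_eq, trace]
  exact tsum_congr fun n => by rw [Module.End.one_apply, rowFun_ket]; rfl

/-- The coordinates `uⱼ` with `∑ᵣ cᵣ Qᵣ = ∑ⱼ (uⱼ aⱼ + ūⱼ aⱼ†)`. -/
def fieldCoord (c : Fin 2 × Fin 2 → ℝ) (j : Fin 2) : ℂ :=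
  ((√2 : ℝ) : ℂ)⁻¹ * (c (j, 0) - I * c (j, 1))

theorem sum_smul_quadrature (c : Fin 2 × Fin 2 → ℝ) :
    ∑ r, (c r : ℂ) • quadrature r = field (fieldCoord c) := by
  rw [Fintype.sum_prod_type, field]
  refine Finset.sum_congr rfl fun j _ => ?_
  have e : (starRingEnd ℂ) (fieldCoord c j) = ((√2 : ℝ) : ℂ)⁻¹ * (c (j, 0) + I * c (j, 1)) := by
    simp only [fieldCoord, map_mul, map_sub, map_inv₀, conj_ofReal, conj_I]
    ring
  rw [Fin.sum_univ_two, e, fieldCoord]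
  simp only [quadrature, if_true, one_ne_zero, if_false]
  module

theorem isTame_quadrature (r : Fin 2 × Fin 2) : IsTame (quadrature r) := by
  have h1 := isTame_annihilate r.1
  have h2 := isTame_create r.1
  rw [quadrature]
  split_ifs
  · exact (h1.add h2).smul _
  · have h3 := h1.add (h2.smul (-1))
    rw [neg_one_smul ℂ (create r.1), ← sub_eq_add_neg] at h3
    exact h3.smul _

/-- The covariance matrix `γ_rs = Re tr[A (Q_r Q_s + Q_s Q_r)]`. -/
def covariance (A : Matrix (Fin 2 → ℕ) (Fin 2 → ℕ) ℂ) : Matrix (Fin 2 × Fin 2) (Fin 2 × Fin 2) ℝ :=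
  Matrix.of fun r s =>
    (trace A (quadrature r * quadrature s)).re + (trace A (quadrature s * quadrature r)).re

theorem covariance_isSymm : (covariance A).IsSymm :=
  Matrix.IsSymm.ext fun _ _ => add_comm _ _

theorem IsGaussianMatrix.covariance_form (h : IsGaussianMatrix A α β) (h1 : trace A 1 = 1)
    (c : Fin 2 × Fin 2 → ℝ) :
    ((c ⬝ᵥ (covariance A *ᵥ c) : ℝ) : ℂ) = 2 * trace A (field (fieldCoord c) ^ 2) := by
  have hq : ∀ r s, IsTame (quadrature r * quadrature s) := fun r s =>
    (isTame_quadrature r).mul (isTame_quadrature s)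
  have e : trace A (field (fieldCoord c) ^ 2) =
      ∑ r, ∑ s, (c r : ℂ) * (c s * trace A (quadrature r * quadrature s)) := by
    rw [← sum_smul_quadrature, sq, Finset.sum_mul]
    simp only [Finset.mul_sum, smul_mul_assoc, mul_smul_comm]
    rw [h.trace_sum _ fun r _ => IsTame.sum fun s _ => ((hq r s).smul _).smul _]
    refine Finset.sum_congr rfl fun r _ => ?_
    rw [h.trace_sum _ fun s _ => ((hq r s).smul _).smul _]
    exact Finset.sum_congr rfl fun s _ => by simp only [trace_smul]; ring
  have e2 : (trace A (field (fieldCoord c) ^ 2)).re =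
      ∑ r, ∑ s, c r * (c s * (trace A (quadrature r * quadrature s)).re) := by
    rw [e, re_sum]
    refine Finset.sum_congr rfl fun r _ => ?_
    rw [re_sum]
    exact Finset.sum_congr rfl fun s _ => by rw [re_ofReal_mul, re_ofReal_mul]
  have e3 : c ⬝ᵥ (covariance A *ᵥ c) = 2 * (trace A (field (fieldCoord c) ^ 2)).re := by
    have e4 : (trace A (field (fieldCoord c) ^ 2)).re =
        ∑ r, ∑ s, c r * (c s * (trace A (quadrature s * quadrature r)).re) := by
      rw [e2, Finset.sum_comm]
      exact Finset.sum_congr rfl fun r _ => Finset.sum_congr rfl fun s _ => by ring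
    rw [two_mul]
    nth_rewrite 1 [e2]
    rw [e4, ← Finset.sum_add_distrib]
    simp only [dotProduct, Matrix.mulVec, covariance, Matrix.of_apply, Finset.mul_sum,
      ← Finset.sum_add_distrib]
    exact Finset.sum_congr rfl fun r _ => Finset.sum_congr rfl fun s _ => by ring
  rw [e3]
  refine Complex.ext ?_ ?_ <;> simp [h.trace_field_sq_im _ h1]

theorem symplectic_mulVec (ξ : Fin 2 × Fin 2 → ℝ) :
    symplectic (Fin 2) *ᵥ ξ = -(ξ ᵥ* symplectic (Fin 2)) := by
  have h : (symplectic (Fin 2))ᵀ = -symplectic (Fin 2) := by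
    ext ⟨a, b⟩ ⟨c, d⟩
    fin_cases a <;> fin_cases b <;> fin_cases c <;> fin_cases d <;> simp [symplectic]
  rw [← Matrix.vecMul_transpose, h, Matrix.vecMul_neg]

theorem IsGaussianMatrix.hasCharFun {ρ : TwoMode →L[ℂ] TwoMode} (hρ : IsState ρ)
    (h : IsGaussianMatrix (numberMatrix ρ) α β) (ξ : Fin 2 × Fin 2 → ℝ) :
    HasCharFun ρ ξ (cexp (-trace (numberMatrix ρ)
      (field (fieldCoord (ξ ᵥ* symplectic (Fin 2))) ^ 2) / 2)) := by
  set u := fieldCoord (ξ ᵥ* symplectic (Fin 2)) with hu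
  have hW : weylGenerator ξ = field u := sum_smul_quadrature _
  have key := h.hasSum_exp_field (trace_numberMatrix_one hρ) u
  rw [HasCharFun]
  convert key using 2 with n
  have hs := summable_exp_field_ket u n
  rw [weylOnNumber, hW]
  have := ((innerSL ℂ (numberState n)).comp ρ).map_tsum hs
  refine this.trans (tsum_congr fun k => ?_)
  rw [map_smul, I_smul_pow_apply, map_smul, map_smul, smul_eq_mul, smul_eq_mul]
  congr 2
  exact inner_toFock ρ n _

theorem IsGaussianMatrix.isGaussian {ρ : TwoMode →L[ℂ] TwoMode} (hρ : IsState ρ)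
    (h : IsGaussianMatrix (numberMatrix ρ) α β) : IsGaussian ρ := by
  refine ⟨0, covariance (numberMatrix ρ), covariance_isSymm, fun ξ => ?_⟩
  have e := h.covariance_form (trace_numberMatrix_one hρ) (ξ ᵥ* symplectic (Fin 2))
  have e2 : ξ ⬝ᵥ (((symplectic (Fin 2))ᵀ * covariance (numberMatrix ρ) * symplectic (Fin 2)) *ᵥ ξ) =
      (ξ ᵥ* symplectic (Fin 2)) ⬝ᵥ (covariance (numberMatrix ρ) *ᵥ (ξ ᵥ* symplectic (Fin 2))) := by
    rw [← Matrix.mulVec_mulVec, ← Matrix.mulVec_mulVec, Matrix.dotProduct_mulVec,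
      Matrix.vecMul_transpose, symplectic_mulVec, Matrix.mulVec_neg, neg_dotProduct_neg]
  rw [e2, e]
  convert h.hasCharFun hρ ξ using 2
  simp
  ring

/-- The first moments vanish term by term, since `⟨p| ρ |q⟩ = 0` unless `p` and `q` have the same
parity. -/
theorem IsGaussianMatrix.hasFirstMoment {ρ : TwoMode →L[ℂ] TwoMode}
    (h : IsGaussianMatrix (numberMatrix ρ) α β) (r : Fin 2 × Fin 2) : HasFirstMoment ρ r 0 := by
  have hz : ∀ p q : Fin 2 → ℕ, Odd (∑ j, p j + ∑ j, q j) →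
      inner ℂ (numberState p) (ρ (numberState q)) = 0 := h.eq_zero_of_odd
  rw [HasFirstMoment]
  convert hasSum_zero with n
  have h1 : inner ℂ (toFock (create r.1 (ket n))) (ρ (numberState n)) = 0 := by
    rw [create_ket, map_smul, toFock_ket, inner_smul_left, hz, mul_zero]
    rw [sum_add_single]
    exact ⟨∑ j, n j, by ring⟩
  have h2 : inner ℂ (toFock (annihilate r.1 (ket n))) (ρ (numberState n)) = 0 := by
    rw [annihilate_ket, map_smul, toFock_ket, inner_smul_left]
    by_cases h0 : n r.1 = 0
    · simp [h0]
    · obtain ⟨m, hm⟩ := mem_range_add_single h0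
      dsimp only at hm
      rw [← hm, add_tsub_cancel_right, hz, mul_zero]
      rw [sum_add_single]
      exact ⟨∑ j, m j, by ring⟩
  rw [quadrature]
  split_ifs
  · rw [LinearMap.smul_apply, LinearMap.add_apply, map_smul, map_add, inner_smul_left,
      inner_add_left, h1, h2, add_zero, mul_zero]
  · rw [LinearMap.smul_apply, LinearMap.sub_apply, map_smul, map_sub, inner_smul_left,
      inner_sub_left, h1, h2, sub_zero, mul_zero]

end CharacteristicFunction

end Gaussify

end

theorem proposition2 (ρ : Gaussify.TwoMode →L[ℂ] Gaussify.TwoMode) (hρ : Gaussify.IsState ρ)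
    (c : ℝ) (hc : 0 < c)
    (hfix : (c : ℂ) • Gaussify.iterationMap (Gaussify.tensorOp ρ ρ) = Gaussify.numberMatrix ρ) :
    Gaussify.IsGaussian ρ ∧ ∀ r : Fin 2 × Fin 2, Gaussify.HasFirstMoment ρ r 0 := by
  obtain ⟨α, β, h⟩ := Gaussify.exists_isGaussianMatrix hρ hc hfix
  exact ⟨h.isGaussian hρ, h.hasFirstMoment⟩
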